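/- \textbf{Setting.} A \emph{vote} over a finite set $C$ of candidates is a linear order on $C$; a profile is a tuple of votes. The 2-approval score $s(c,P)$ of a candidate $c$ in a profile $P$ is the number of votes of $P$ that rank $c$ in one of the first two positions, and the cowinners of $P$ are the candidates of maximal score. An instance consists of a finite set $X$ of $m$ initial candidates, a profile $P_X=\langle V_1,\dots,V_n\rangle$ over $X$ with $n\ge 1$ votes, a candidate $x^*\in X$, and an integer $k\ge 1$, encoded in unary. Let $Y=\{y_1,\dots,y_k\}$ be a set of $k$ new candidates. Then $x^*$ is a \emph{possible cowinner} if there is a profile $P'$ over $X\cup Y$ whose restriction to $X$ is $P_X$ and in which $x^*$ is a cowinner. \textbf{The algorithm CheckCowinner$(P_X,x^*,Y)$.} The working profile $P$ starts as $P_X$. Put $\Delta(P,c)=s(c,P)-s(x^*,P)$, where scores count occurrences in the first two positions. For $x\in X$ let $\mathrm{HP}(P,x)$, $\mathrm{MP}(P,x)$ be the sets of votes of $P$ with $x$ in second position and with top candidate in $X\setminus\{x^*\}$, resp. in $Y\cup\{x^*\}$; let $\mathrm{LP}(P,x)$ be the set of votes with $x$ on top and second candidate in $X\setminus\{x^*\}$.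 To \emph{insert on} a vote means to put on top of it the new candidate with the lowest current score (the lowest index among ties). Let $X^\bullet=\{x\in X:\Delta(P_X,x)>0\}$, $X_1=\{x\in X^\bullet: |\mathrm{HP}(P_X,x)|>\Delta(P_X,x)\}$, $X_2=X^\bullet\setminus X_1$, $T=0$. \begin{enumerate} \item For each $x\in X_2$ and each $V\in \mathrm{HP}(P,x)$: insert on $V$ and increase $T$ by $1$. \item For each $x\in X_2$ and each $V\in\mathrm{MP}(P,x)$: if $\Delta(P,x)>0$, insert on $V$ and increase $T$ by $1$; otherwise mark $x$. Then remove all marked candidates from $X_2$. \item If $\Delta(P,y)>0$ for some $y\in Y$, return false. \item Let $\phi$ be the maximum value of an integral flow from $s$ to $t$ in the network with the edges $(s,x)$ of capacity $\Delta(P,x)$ for $x\in X_1$; $(V,x)$ of capacity $1$ for $x\in X_2$, $V\in\mathrm{LP}(P,x)$; $(x',V)$ of capacity $1$ for every such $V$ whose second candidate $x'$ lies in $X_1$; and $(x,t)$ of capacity $\Delta(P,x)$ for $x\in X_2$. Return true if $$\phi\ \ge\ \sum_{x\in X^\bullet}\Delta(P,x)+\sum_{x\in X_2}\Delta(P,x)-\bigl(k\cdot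 s(x^*,P_X)-T\bigr),$$ and false otherwise. \end{enumerate} \textbf{Theorem.} (a) For every instance with $k\ge 2$, CheckCowinner returns true if and only if $x^*$ is a possible cowinner under 2-approval with respect to the addition of $k$ new candidates. (b) The answer of CheckCowinner is computable in time polynomial in the size of the instance. (c) The problem of deciding, for a given instance (with any $k\ge1$), whether $x^*$ is a possible cowinner under 2-approval with respect to the addition of $k$ new candidates is in $\mathsf{P}$. -/

import Mathlib

noncomputable section

namespace PCW

/-! ### Votes, profiles, `K`-approval -/

/-- `V` is a linear order over the finite candidate set `C`, written as the list of all
candidates from the most to the least preferred one. -/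
def IsVote {C : Type} (V : List C) : Prop :=
  V.Nodup ∧ ∀ c : C, c ∈ V

/-- An `n`-tuple of rankings; it is a `C`-profile if every entry is a `C`-vote. -/
def IsProfile {C : Type} {n : ℕ} (P : Fin n → List C) : Prop :=
  ∀ i, IsVote (P i)

/-- The number of entries of `P` in which `c` stands at position `j` (positions start at `0`). -/
def numAt {C : Type} [DecidableEq C] {n : ℕ} (P : Fin n → List C) (j : ℕ) (c : C) : ℕ :=
  (Finset.univ.filter fun i => (P i)[j]? = some c).card

/-- The `K`-approval score: how often `c` stands in one of the first `K` positions. -/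
def approvalScore {C : Type} [DecidableEq C] {n : ℕ} (K : ℕ) (P : Fin n → List C) (c : C) : ℕ :=
  ∑ j ∈ Finset.range K, numAt P j c

/-- The set of cowinners of `P` under `K`-approval. -/
def approvalWinners {C : Type} [DecidableEq C] {n : ℕ} (K : ℕ) (P : Fin n → List C) : Set C :=
  {c | ∀ d, approvalScore K P d ≤ approvalScore K P c}

/-- The projection to `X` of a ranking of `X ∪ Y` (a disjoint union). -/
def projection {X Y : Type} (V : List (X ⊕ Y)) : List X :=
  V.filterMap Sum.getLeft?

/-- `P'` extends `P` if its projection to the initial candidates is `P`. -/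
def Extends {X Y : Type} {n : ℕ} (P' : Fin n → List (X ⊕ Y)) (P : Fin n → List X) : Prop :=
  ∀ i, projection (P' i) = P i

/-! ### The problem -/

/-- A voting situation with a varying set of candidates together with a distinguished initial
candidate: `n ≥ 1` voters, initial candidates `X = Fin m`, an `X`-profile, a number `k ≥ 1` of
new candidates, and `xstar ∈ X`. -/
structure Instance where
  m : ℕ
  n : ℕ
  k : ℕ
  n_pos : 0 < n
  k_pos : 0 < k
  profile : Fin n → List (Fin m)
  isProfile : IsProfile profile
  xstar : Fin m

/-- `xstar` is a possible cowinner under `K`-approval: some profile over the `m` initial and the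
`k` new candidates extends the given profile and has `xstar` among its cowinners. -/
def PossibleCowinner (K : ℕ) (I : Instance) : Prop :=
  ∃ P' : Fin I.n → List (Fin I.m ⊕ Fin I.k),
    IsProfile P' ∧ Extends P' I.profile ∧ Sum.inl I.xstar ∈ approvalWinners K P'

/-! ### Integral flows -/

/-- An integral flow from `s` to `t` in the network with edge capacities `cap`
(capacity `0` means that there is no edge). -/
structure IsFlow {W : Type} [Fintype W] (cap : W → W → ℕ) (s t : W) (f : W → W → ℕ) : Prop where
  le_cap : ∀ u v, f u v ≤ cap u v
  conserve : ∀ v, v ≠ s → v ≠ t → ∑ u, f u v = ∑ u, f v u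

/-- The net amount of flow that leaves `s`. -/
def flowValue {W : Type} [Fintype W] (s : W) (f : W → W → ℕ) : ℤ :=
  ∑ v, (f s v : ℤ) - ∑ v, (f v s : ℤ)

/-- The value of a maximum flow. The set is nonempty (zero flow) and bounded above by the total
capacity of the edges that leave `s`. -/
def maxFlow {W : Type} [Fintype W] (cap : W → W → ℕ) (s t : W) : ℤ :=
  sSup {z | ∃ f, IsFlow cap s t f ∧ z = flowValue s f}

/-! ### The algorithm CheckCowinner

The working profile of the algorithm contains, for each voter, the initial vote with the new
candidates that have been inserted on top so far. New candidates that are not inserted are thought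
of as being at the bottom and are not listed. -/

/-- A working profile. -/
abbrev Work (I : Instance) : Type := Fin I.n → List (Fin I.m ⊕ Fin I.k)

/-- The working profile at the start. -/
def initWork (I : Instance) : Work I :=
  fun i => (I.profile i).map Sum.inl

/-- `Δ(P, c)`: the 2-approval score of `c` minus that of `xstar`. -/
def delta (I : Instance) (P : Work I) (c : Fin I.m ⊕ Fin I.k) : ℤ :=
  (approvalScore 2 P c : ℤ) - approvalScore 2 P (Sum.inl I.xstar)

/-- High priority: `x` is second, and the top candidate is in `X \ {xstar}`. -/
def InHP (I : Instance) (P : Work I) (x : Fin I.m) (i : Fin I.n) : Prop :=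
  (P i)[1]? = some (Sum.inl x) ∧ ∃ a, a ≠ I.xstar ∧ (P i)[0]? = some (Sum.inl a)

/-- Medium priority: `x` is second, and the top candidate is in `Y ∪ {xstar}`. -/
def InMP (I : Instance) (P : Work I) (x : Fin I.m) (i : Fin I.n) : Prop :=
  (P i)[1]? = some (Sum.inl x) ∧
    ((P i)[0]? = some (Sum.inl I.xstar) ∨ ∃ y, (P i)[0]? = some (Sum.inr y))

/-- Low priority: `x` is on top, and the second candidate is in `X \ {xstar}`. -/
def InLP (I : Instance) (P : Work I) (x : Fin I.m) (i : Fin I.n) : Prop :=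
  (P i)[0]? = some (Sum.inl x) ∧ ∃ a, a ≠ I.xstar ∧ (P i)[1]? = some (Sum.inl a)

instance (I : Instance) (P : Work I) (x : Fin I.m) (i : Fin I.n) : Decidable (InHP I P x i) := by
  unfold InHP
  infer_instance

instance (I : Instance) (P : Work I) (x : Fin I.m) (i : Fin I.n) : Decidable (InMP I P x i) := by
  unfold InMP
  infer_instance

instance (I : Instance) (P : Work I) (x : Fin I.m) (i : Fin I.n) : Decidable (InLP I P x i) := by
  unfold InLP
  infer_instance

/-- The votes of `HP(P, x)`, in the order of the voters. -/
def HP (I : Instance) (P : Work I) (x : Fin I.m) : List (Fin I.n) :=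
  (List.finRange I.n).filter fun i => decide (InHP I P x i)

/-- The votes of `MP(P, x)`, in the order of the voters. -/
def MP (I : Instance) (P : Work I) (x : Fin I.m) : List (Fin I.n) :=
  (List.finRange I.n).filter fun i => decide (InMP I P x i)

/-- The new candidate with the lowest score, with the lowest index among ties. -/
def lowestNew (I : Instance) (P : Work I) : Option (Fin I.k) :=
  (List.finRange I.k).find? fun j =>
    decide (∀ j' : Fin I.k, delta I P (Sum.inr j) ≤ delta I P (Sum.inr j'))

/-- AddNewAlternativeOnTop: insert the new candidate of lowest score on top of vote `i`. -/
def addNewOnTop (I : Instance) (P : Work I) (i : Fin I.n) : Work I :=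
  match lowestNew I P with
  | none => P
  | some y => Function.update P i (Sum.inr y :: P i)

/-- The candidates that beat `xstar` in the initial profile. -/
def Xbullet (I : Instance) : Finset (Fin I.m) :=
  Finset.univ.filter fun x => 0 < delta I (initWork I) (Sum.inl x)

/-- The candidates of `Xbullet` with more high priority votes than needed. -/
def X₁ (I : Instance) : Finset (Fin I.m) :=
  (Xbullet I).filter fun x =>
    delta I (initWork I) (Sum.inl x) < ((HP I (initWork I) x).length : ℤ)

/-- The other candidates of `Xbullet`. -/
def X₂ (I : Instance) : Finset (Fin I.m) :=
  (Xbullet I).filter fun x =>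
    ((HP I (initWork I) x).length : ℤ) ≤ delta I (initWork I) (Sum.inl x)

/-- The variables of the algorithm: the profile `P`, the number `T` of insertions, the set `REM`. -/
structure Vars (I : Instance) where
  P : Work I
  T : ℕ
  REM : Finset (Fin I.m)

/-- One insertion on top of vote `i`, with `T++`. -/
def insertStep (I : Instance) (S : Vars I) (i : Fin I.n) : Vars I :=
  { S with P := addNewOnTop I S.P i, T := S.T + 1 }

/-- The members of `X₂`, in increasing order. -/
def X₂list (I : Instance) : List (Fin I.m) :=
  (List.finRange I.m).filter fun x => decide (x ∈ X₂ I)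

/-- Phase 1: for each `x ∈ X₂` and each `V ∈ HP(P, x)`, insert a new candidate on top of `V`. -/
def phase1 (I : Instance) : Vars I :=
  (X₂list I).foldl
    (fun S x => (HP I S.P x).foldl (fun S' i => insertStep I S' i) S)
    ⟨initWork I, 0, ∅⟩

/-- Phase 2: for each `x ∈ X₂` and each `V ∈ MP(P, x)`, insert a new candidate on top of `V` if
`Δ(P, x) > 0`, and put `x` into `REM` otherwise. -/
def phase2 (I : Instance) : Vars I :=
  (X₂list I).foldl
    (fun S x => (MP I S.P x).foldl
      (fun S' i =>
        if 0 < delta I S'.P (Sum.inl x) then insertStep I S' i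
        else { S' with REM := insert x S'.REM }) S)
    (phase1 I)

/-- `X₂` after the removal of `REM`. -/
def X₂' (I : Instance) : Finset (Fin I.m) :=
  X₂ I \ (phase2 I).REM

/-- The nodes `s`, `t`, the candidates and the votes of the flow network. -/
abbrev Node (I : Instance) : Type := Bool ⊕ (Fin I.m ⊕ Fin I.n)

/-- The source. -/
def source (I : Instance) : Node I := Sum.inl false

/-- The sink. -/
def sink (I : Instance) : Node I := Sum.inl true

/-- BuildMaxFlowGraph `(P, xstar, A, B)`. The edges are `(s, x)` for `x ∈ A` with weight `Δ(P, x)`;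
`(V, x)` for `x ∈ B` and `V ∈ LP(P, x)` with weight `1`; `(x', V)` with weight `1` if moreover
the candidate `x'` in second position of `V` is in `A`; `(x, t)` for `x ∈ B` with weight
`Δ(P, x)`. -/
def flowCap (I : Instance) (P : Work I) (A B : Finset (Fin I.m)) : Node I → Node I → ℕ
  | Sum.inl false, Sum.inr (Sum.inl x) => if x ∈ A then (delta I P (Sum.inl x)).toNat else 0
  | Sum.inr (Sum.inr i), Sum.inr (Sum.inl x) => if x ∈ B ∧ InLP I P x i then 1 else 0
  | Sum.inr (Sum.inl x'), Sum.inr (Sum.inr i) =>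
      if x' ∈ A ∧ (P i)[1]? = some (Sum.inl x') ∧ ∃ x ∈ B, InLP I P x i then 1 else 0
  | Sum.inr (Sum.inl x), Sum.inl true => if x ∈ B then (delta I P (Sum.inl x)).toNat else 0
  | _, _ => 0

/-- CheckCowinner. -/
def checkCowinner (I : Instance) : Bool :=
  let P := (phase2 I).P
  let T := (phase2 I).T
  if ∃ y : Fin I.k, 0 < delta I P (Sum.inr y) then false
  else
    decide (
      ∑ x ∈ Xbullet I, delta I P (Sum.inl x) + ∑ x ∈ X₂' I, delta I P (Sum.inl x)
          - ((I.k : ℤ) * approvalScore 2 (initWork I) (Sum.inl I.xstar) - T)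
        ≤ maxFlow (flowCap I P (X₁ I) (X₂' I)) (source I) (sink I))

/-! ### Polynomial time

The machine is a random access machine with addition and truncated subtraction at unit cost (no
multiplication, so that numbers of at most linearly many bits arise and the polynomial time classes
are those of Turing machines), with structured control. Its memory consists of registers and of
arrays of natural numbers; a program mentions finitely many of them. -/

/-- Expressions; `lt` and `eq` have the value `1` or `0`. -/
inductive Expr where
  | const (c : ℕ)
  | var (x : ℕ)
  | get (a : ℕ) (idx : Expr)
  | add (e₁ e₂ : Expr)
  | sub (e₁ e₂ : Expr)
  | lt (e₁ e₂ : Expr)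
  | eq (e₁ e₂ : Expr)

/-- Programs. -/
inductive Prog where
  | skip
  | assign (x : ℕ) (e : Expr)
  | store (a : ℕ) (idx e : Expr)
  | seq (p q : Prog)
  | ite (e : Expr) (p q : Prog)
  | while (e : Expr) (p : Prog)

/-- The memory: registers and arrays. -/
structure Mem where
  var : ℕ → ℕ
  arr : ℕ → ℕ → ℕ

/-- The value of an expression. -/
def Expr.eval (σ : Mem) : Expr → ℕ
  | const c => c
  | var x => σ.var x
  | get a idx => σ.arr a (idx.eval σ)
  | add e₁ e₂ => e₁.eval σ + e₂.eval σ
  | sub e₁ e₂ => e₁.eval σ - e₂.eval σ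
  | lt e₁ e₂ => if e₁.eval σ < e₂.eval σ then 1 else 0
  | eq e₁ e₂ => if e₁.eval σ = e₂.eval σ then 1 else 0

/-- `Exec p σ t σ'`: the program `p`, started in `σ`, halts in `σ'` after `t` steps. Every
assignment, every store, every `skip` and every evaluation of a test is one step (the
expressions of a program have a fixed size). -/
inductive Exec : Prog → Mem → ℕ → Mem → Prop where
  | skip (σ : Mem) : Exec Prog.skip σ 1 σ
  | assign (x : ℕ) (e : Expr) (σ : Mem) :
      Exec (Prog.assign x e) σ 1 ⟨Function.update σ.var x (e.eval σ), σ.arr⟩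
  | store (a : ℕ) (idx e : Expr) (σ : Mem) :
      Exec (Prog.store a idx e) σ 1
        ⟨σ.var, Function.update σ.arr a
          (Function.update (σ.arr a) (idx.eval σ) (e.eval σ))⟩
  | seq {p q : Prog} {σ σ' σ'' : Mem} {t t' : ℕ} :
      Exec p σ t σ' → Exec q σ' t' σ'' → Exec (Prog.seq p q) σ (t + t') σ''
  | ite_true {e : Expr} {p q : Prog} {σ σ' : Mem} {t : ℕ} :
      e.eval σ ≠ 0 → Exec p σ t σ' → Exec (Prog.ite e p q) σ (t + 1) σ'
  | ite_false {e : Expr} {p q : Prog} {σ σ' : Mem} {t : ℕ} :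
      e.eval σ = 0 → Exec q σ t σ' → Exec (Prog.ite e p q) σ (t + 1) σ'
  | while_true {e : Expr} {p : Prog} {σ σ' σ'' : Mem} {t t' : ℕ} :
      e.eval σ ≠ 0 → Exec p σ t σ' → Exec (Prog.while e p) σ' t' σ'' →
        Exec (Prog.while e p) σ (t + t' + 1) σ''
  | while_false {e : Expr} {p : Prog} {σ : Mem} :
      e.eval σ = 0 → Exec (Prog.while e p) σ 1 σ

/-- Execution is deterministic. -/
theorem Exec.det {p : Prog} {σ : Mem} {t : ℕ} {σ₁ : Mem} (h : Exec p σ t σ₁) :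
    ∀ {t' : ℕ} {σ₂ : Mem}, Exec p σ t' σ₂ → t = t' ∧ σ₁ = σ₂ := by
  induction h with
  | skip | assign | store => intro t' σ₂ h'; cases h'; exact ⟨rfl, rfl⟩
  | seq _ _ ih₁ ih₂ =>
    intro t' σ₂ h'
    cases h' with
    | seq a b =>
      obtain ⟨rfl, rfl⟩ := ih₁ a
      obtain ⟨rfl, rfl⟩ := ih₂ b
      exact ⟨rfl, rfl⟩
  | ite_true he _ ih =>
    intro t' σ₂ h'
    cases h' with
    | ite_true _ a => obtain ⟨rfl, rfl⟩ := ih a; exact ⟨rfl, rfl⟩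
    | ite_false he' _ => exact absurd he' he
  | ite_false he _ ih =>
    intro t' σ₂ h'
    cases h' with
    | ite_true he' _ => exact absurd he he'
    | ite_false _ a => obtain ⟨rfl, rfl⟩ := ih a; exact ⟨rfl, rfl⟩
  | while_true he _ _ ih₁ ih₂ =>
    intro t' σ₂ h'
    cases h' with
    | while_true _ a b =>
      obtain ⟨rfl, rfl⟩ := ih₁ a
      obtain ⟨rfl, rfl⟩ := ih₂ b
      exact ⟨rfl, rfl⟩
    | while_false he' => exact absurd he' he
  | while_false he =>
    intro t' σ₂ h'
    cases h' with
    | while_true he' _ _ => exact absurd he he'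
    | while_false _ => exact ⟨rfl, rfl⟩

/-- The initial memory: array `0` holds the input sequence, register `0` its length, and
everything else is `0`. -/
def initMem (l : List ℕ) : Mem where
  var := Function.update (fun _ => 0) 0 l.length
  arr := Function.update (fun _ _ => 0) 0 (fun i => l.getD i 0)

/-- The size of an input sequence: the total length of the binary representations, with one
separator for each entry. -/
def inputSize (l : List ℕ) : ℕ :=
  (l.map fun a => Nat.size a + 1).sum

/-- `f` is computed by one program in polynomial time: on the input `enc a` it halts
within `poly (size of the input)` steps with the answer, `1` or `0`, in register `0`. -/
def PolyTimeComputable {α : Type} (enc : α → List ℕ) (f : α → Bool) : Prop :=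
  ∃ (p : Prog) (poly : Polynomial ℕ), ∀ a : α, ∃ (t : ℕ) (σ : Mem),
    Exec p (initMem (enc a)) t σ ∧ t ≤ poly.eval (inputSize (enc a)) ∧
      σ.var 0 = if f a then 1 else 0

/-- The decision problem `Q`, with instances encoded by `enc`, is in P. -/
def InP {α : Type} (enc : α → List ℕ) (Q : α → Prop) : Prop :=
  ∃ f : α → Bool, PolyTimeComputable enc f ∧ ∀ a, f a = true ↔ Q a

/-- The encoding of an instance: `m`, `n`, `xstar`, then the `n` votes one after the other, each
as the list of its `m` candidates from best to worst, then `k` in unary. -/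
def encode (I : Instance) : List ℕ :=
  [I.m, I.n, (I.xstar : ℕ)]
    ++ (List.ofFn fun i => (I.profile i).map fun c => (c : ℕ)).flatten
    ++ List.replicate I.k 1

end PCW

end

noncomputable section

set_option linter.unusedSectionVars false

namespace PCW

/-! ### A structured language with bounded sums and loops

All sums, array initialisations and loops have the same bound, the length `L` of the input, so
that every program of this language runs in polynomial time. -/

/-! Only the first two candidates of a vote matter, and an extension acts on initial candidates only
through the number c i ∈ {0, 1, 2} of new candidates in the first two positions of vote i: one
pushes out the second candidate, two push out both. Let s be the initial score of x*. The new
candidates receive ∑ c i approvals together, and this may be at most k·s if x* is to cowin.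
Conversely, handing the new candidates out cyclically spreads such a total so that none gets more
than s, provided that no vote takes more than k of them. So the question is whether insertion
numbers with sum at most k·s can take its excess over x* from every candidate
(`insertions_of_possibleCowinner`, `possibleCowinner_of_insertions`).

Call a candidate with positive excess late if it needs all its high priority votes, and early
otherwise. A late candidate loses an approval for one insertion where it is second, and also where
it is on top of a late candidate, since there the first insertion is wanted anyway. What remains of
its demand is `capTop`; it has to come from votes with the candidate on top, at two insertions each.
The first of the two is wasted unless it pushes out an early candidate that still has to lose
approvals. Early candidates can always be served by single insertions. The bill is therefore ∑
excess + ∑ capTop − |M|, where M is the set of votes used doubly. Viewing a vote as an edge from its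
first to its second candidate, M is a b-matching with bounds `capTop` and `capSec`. This is `Crit`;
`crit_of_insertions` and `insertions_of_crit` show that it decides the matter.

The algorithm performs the cheap insertions for late candidates, after which Δ equals `capTop` on
them. Its flows are exactly the b-matchings M, and T accounts for the excess already removed. If a
new candidate beats x*, balance of the new scores forces T > k·s, which `Crit` excludes. Thus
`checkCowinner_iff_crit` holds for every k. The hypothesis k ≥ 2 only serves to realise c i = 2 by
two different new candidates; for k = 1 the simpler `CritOne` takes over.

For the complexity claims, every loop of a small structured language runs exactly as often as the
input is long, so its programs compile to polynomial time. By the equivalence it suffices to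
evaluate `Crit`, that is, to find a maximum b-matching. This is done by augmenting paths:
`age_closed` and `card_le_of_stuck` give optimality when no augmentation starts, and the `Walk`
lemmas show that an augmentation which starts also succeeds. -/

/-- Expressions. `cond c e₁ e₂` is `e₁` if `c ≠ 0` and `e₂` otherwise, `sum v e` is the sum of `e`
over the values `v < L`, and `len` is `L`. -/
inductive Tm where
  | const (c : ℕ)
  | var (x : ℕ)
  | len
  | get (a : ℕ) (idx : Tm)
  | add (e₁ e₂ : Tm)
  | sub (e₁ e₂ : Tm)
  | lt (e₁ e₂ : Tm)
  | eq (e₁ e₂ : Tm)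
  | cond (c e₁ e₂ : Tm)
  | sum (v : ℕ) (e : Tm)

/-- Change of one register. -/
def Mem.setVar (σ : Mem) (x a : ℕ) : Mem := ⟨Function.update σ.var x a, σ.arr⟩

/-- Change of one array. -/
def Mem.setArr (σ : Mem) (a : ℕ) (g : ℕ → ℕ) : Mem := ⟨σ.var, Function.update σ.arr a g⟩

@[simp] theorem Mem.setVar_var (σ : Mem) (x a y : ℕ) :
    (σ.setVar x a).var y = if y = x then a else σ.var y := by
  simp [Mem.setVar, Function.update_apply]

@[simp] theorem Mem.setVar_arr (σ : Mem) (x a : ℕ) : (σ.setVar x a).arr = σ.arr := rfl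

@[simp] theorem Mem.setArr_var (σ : Mem) (a : ℕ) (g : ℕ → ℕ) : (σ.setArr a g).var = σ.var := rfl

@[simp] theorem Mem.setArr_arr (σ : Mem) (a : ℕ) (g : ℕ → ℕ) (b : ℕ) :
    (σ.setArr a g).arr b = if b = a then g else σ.arr b := by
  simp [Mem.setArr, Function.update_apply]

/-- The value of an expression. -/
def Tm.eval (L : ℕ) : Tm → Mem → ℕ
  | const c, _ => c
  | var x, σ => σ.var x
  | len, _ => L
  | get a idx, σ => σ.arr a (idx.eval L σ)
  | add e₁ e₂, σ => e₁.eval L σ + e₂.eval L σ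
  | sub e₁ e₂, σ => e₁.eval L σ - e₂.eval L σ
  | lt e₁ e₂, σ => if e₁.eval L σ < e₂.eval L σ then 1 else 0
  | eq e₁ e₂, σ => if e₁.eval L σ = e₂.eval L σ then 1 else 0
  | cond c e₁ e₂, σ => if c.eval L σ ≠ 0 then e₁.eval L σ else e₂.eval L σ
  | sum v e, σ => ∑ i ∈ Finset.range L, e.eval L (σ.setVar v i)

/-- Statements. `fill a v e` sets `a[v]` to `e` for all `v < L` simultaneously, and `loop s`
repeats `s` `L` times. -/
inductive Stm where
  | assign (x : ℕ) (e : Tm)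
  | fill (a v : ℕ) (e : Tm)
  | seq (s₁ s₂ : Stm)
  | cond (c : Tm) (s : Stm)
  | loop (s : Stm)

/-- The effect of a statement. -/
def Stm.run (L : ℕ) : Stm → Mem → Mem
  | assign x e, σ => σ.setVar x (e.eval L σ)
  | fill a v e, σ => σ.setArr a fun i => if i < L then e.eval L (σ.setVar v i) else σ.arr a i
  | seq s₁ s₂, σ => s₂.run L (s₁.run L σ)
  | cond c s, σ => if c.eval L σ ≠ 0 then s.run L σ else σ
  | loop s, σ => (s.run L)^[L] σ

/-! ### Compilation

Register `x` of the structured language becomes register `2 x + 2`, array `a` becomes array `2 a`.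
The odd registers hold intermediate values, array `1` is a buffer, and register `0` holds `L`. -/

/-- A program that puts the value of an expression into register `2 r + 1` and that uses only the
odd registers from there on for intermediate values. -/
def Tm.compile : Tm → ℕ → Prog
  | const c, r => .assign (2 * r + 1) (.const c)
  | var x, r => .assign (2 * r + 1) (.var (2 * x + 2))
  | len, r => .assign (2 * r + 1) (.var 0)
  | get a idx, r => .seq (idx.compile r) (.assign (2 * r + 1) (.get (2 * a) (.var (2 * r + 1))))
  | add e₁ e₂, r => .seq (.seq (e₁.compile r) (e₂.compile (r + 1)))
      (.assign (2 * r + 1) (.add (.var (2 * r + 1)) (.var (2 * (r + 1) + 1))))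
  | sub e₁ e₂, r => .seq (.seq (e₁.compile r) (e₂.compile (r + 1)))
      (.assign (2 * r + 1) (.sub (.var (2 * r + 1)) (.var (2 * (r + 1) + 1))))
  | lt e₁ e₂, r => .seq (.seq (e₁.compile r) (e₂.compile (r + 1)))
      (.assign (2 * r + 1) (.lt (.var (2 * r + 1)) (.var (2 * (r + 1) + 1))))
  | eq e₁ e₂, r => .seq (.seq (e₁.compile r) (e₂.compile (r + 1)))
      (.assign (2 * r + 1) (.eq (.var (2 * r + 1)) (.var (2 * (r + 1) + 1))))
  | cond c e₁ e₂, r =>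
      .seq (c.compile r) (.ite (.var (2 * r + 1)) (e₁.compile r) (e₂.compile r))
  | sum v e, r =>
      .seq (.assign (2 * r + 1) (.const 0)) <|
      .seq (.assign (2 * (r + 1) + 1) (.var (2 * v + 2))) <|
      .seq (.assign (2 * v + 2) (.const 0)) <|
      .seq (.while (.lt (.var (2 * v + 2)) (.var 0)) <|
        .seq (e.compile (r + 2)) <|
        .seq (.assign (2 * r + 1) (.add (.var (2 * r + 1)) (.var (2 * (r + 2) + 1)))) <|
        .assign (2 * v + 2) (.add (.var (2 * v + 2)) (.const 1))) <|
      .assign (2 * v + 2) (.var (2 * (r + 1) + 1))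

/-- A bound for the running time. -/
def Tm.cost : Tm → Polynomial ℕ
  | const _ | var _ | len => 1
  | get _ idx => idx.cost + 1
  | add e₁ e₂ | sub e₁ e₂ | lt e₁ e₂ | eq e₁ e₂ => e₁.cost + e₂.cost + 1
  | cond c e₁ e₂ => c.cost + e₁.cost + e₂.cost + 1
  | sum _ e => Polynomial.X * (e.cost + 3) + 5

/-- The state `μ` of the compiled program represents the state `σ`. -/
structure Represents (L : ℕ) (σ μ : Mem) : Prop where
  len : μ.var 0 = L
  var : ∀ x, μ.var (2 * x + 2) = σ.var x
  arr : ∀ a, μ.arr (2 * a) = σ.arr a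

theorem Exec.assign_setVar (x : ℕ) (e : Expr) (σ : Mem) :
    Exec (Prog.assign x e) σ 1 (σ.setVar x (e.eval σ)) :=
  Exec.assign x e σ

theorem Exec.store_setArr (a : ℕ) (idx e : Expr) (σ : Mem) :
    Exec (Prog.store a idx e) σ 1
      (σ.setArr a (Function.update (σ.arr a) (idx.eval σ) (e.eval σ))) :=
  Exec.store a idx e σ

/-- The invariant rule for loops that count register `v` up to the length in register `0`. As `Inv
i` fixes the counter, the body has to perform the increment; every round pays one extra step for the
test, and the failing test one more. -/
theorem Exec.countingLoop {p : Prog} {v L c : ℕ} (Inv : ℕ → Mem → Prop)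
    (hv : ∀ i μ, Inv i μ → μ.var v = i ∧ μ.var 0 = L)
    (hp : ∀ i < L, ∀ μ, Inv i μ → ∃ t μ', Exec p μ t μ' ∧ t ≤ c ∧ Inv (i + 1) μ')
    {μ : Mem} (h0 : Inv 0 μ) :
    ∃ t μ', Exec (Prog.while (.lt (.var v) (.var 0)) p) μ t μ' ∧ t ≤ L * (c + 1) + 1 ∧
      Inv L μ' := by
  suffices H : ∀ d i μ, i + d = L → Inv i μ → ∃ t μ',
      Exec (Prog.while (.lt (.var v) (.var 0)) p) μ t μ' ∧ t ≤ d * (c + 1) + 1 ∧ Inv L μ' from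
    H L 0 μ (by simp) h0
  intro d
  induction d with
  | zero =>
    intro i μ hi h
    obtain ⟨h1, h2⟩ := hv i μ h
    refine ⟨1, μ, .while_false (by simp [Expr.eval, h1, h2]; omega), by simp, ?_⟩
    have : i = L := by omega
    exact this ▸ h
  | succ d ih =>
    intro i μ hi h
    obtain ⟨h1, h2⟩ := hv i μ h
    obtain ⟨t, μ', he, ht, hI⟩ := hp i (by omega) μ h
    obtain ⟨t', μ'', he', ht', hI'⟩ := ih (i + 1) μ' (by omega) hI
    refine ⟨_, μ'', .while_true (by simp [Expr.eval, h1, h2]; omega) he he', ?_, hI'⟩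
    nlinarith

/-- The odd registers are not part of the represented state, so code that writes only there keeps
the representation. -/
theorem Represents.of_odd {L r : ℕ} {σ μ μ' : Mem} (h : Represents L σ μ)
    (harr : μ'.arr = μ.arr) (hvar : ∀ x, (∀ s, r ≤ s → x ≠ 2 * s + 1) → μ'.var x = μ.var x) :
    Represents L σ μ' where
  len := by rw [hvar 0 (by omega), h.len]
  var x := by rw [hvar _ (by omega), h.var]
  arr a := by rw [harr, h.arr]

/-- The second operand is computed with temporaries from `r + 1` on, so it cannot overwrite the
value of the first. -/
theorem Tm.exec_binary {L : ℕ} {e₁ e₂ : Tm} {op : Expr → Expr → Expr} {g : ℕ → ℕ → ℕ}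
    (hop : ∀ a b μ, (op a b).eval μ = g (a.eval μ) (b.eval μ))
    (ih₁ : ∀ (r : ℕ) (σ μ : Mem), Represents L σ μ → ∃ t μ', Exec (e₁.compile r) μ t μ' ∧
      t ≤ e₁.cost.eval L ∧ μ'.arr = μ.arr ∧
      (∀ x, (∀ s, r ≤ s → x ≠ 2 * s + 1) → μ'.var x = μ.var x) ∧
      μ'.var (2 * r + 1) = e₁.eval L σ)
    (ih₂ : ∀ (r : ℕ) (σ μ : Mem), Represents L σ μ → ∃ t μ', Exec (e₂.compile r) μ t μ' ∧
      t ≤ e₂.cost.eval L ∧ μ'.arr = μ.arr ∧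
      (∀ x, (∀ s, r ≤ s → x ≠ 2 * s + 1) → μ'.var x = μ.var x) ∧
      μ'.var (2 * r + 1) = e₂.eval L σ)
    (r : ℕ) (σ μ : Mem) (h : Represents L σ μ) :
    ∃ t μ', Exec (.seq (.seq (e₁.compile r) (e₂.compile (r + 1)))
      (.assign (2 * r + 1) (op (.var (2 * r + 1)) (.var (2 * (r + 1) + 1))))) μ t μ' ∧
      t ≤ (e₁.cost + e₂.cost + 1).eval L ∧ μ'.arr = μ.arr ∧
      (∀ x, (∀ s, r ≤ s → x ≠ 2 * s + 1) → μ'.var x = μ.var x) ∧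
      μ'.var (2 * r + 1) = g (e₁.eval L σ) (e₂.eval L σ) := by
  obtain ⟨t₁, μ₁, x₁, c₁, a₁, v₁, w₁⟩ := ih₁ r σ μ h
  obtain ⟨t₂, μ₂, x₂, c₂, a₂, v₂, w₂⟩ := ih₂ (r + 1) σ μ₁ (h.of_odd a₁ v₁)
  refine ⟨_, _, .seq (.seq x₁ x₂) (.assign_setVar _ _ _), ?_, by simp [a₁, a₂], ?_, ?_⟩
  · simp; omega
  · intro x hx
    rw [Mem.setVar_var, if_neg (hx r le_rfl), v₂ x (fun s hs => hx s (by omega)), v₁ x hx]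
  · simp only [Mem.setVar_var, if_true, hop, Expr.eval]
    rw [w₂, v₂ _ (by omega), w₁]

/-- The induction needs all `r`, since subexpressions are compiled with higher temporaries and must
spare the lower ones. An expression has no side effects: even the summation register gets its old
value back. -/
theorem Tm.exec {L : ℕ} (e : Tm) : ∀ (r : ℕ) (σ μ : Mem), Represents L σ μ →
    ∃ t μ', Exec (e.compile r) μ t μ' ∧ t ≤ e.cost.eval L ∧ μ'.arr = μ.arr ∧
      (∀ x, (∀ s, r ≤ s → x ≠ 2 * s + 1) → μ'.var x = μ.var x) ∧
      μ'.var (2 * r + 1) = e.eval L σ := by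
  induction e with
  | const c =>
    intro r σ μ h
    refine ⟨1, _, .assign_setVar _ _ _, by simp [cost], rfl, ?_, by simp [Expr.eval, eval]⟩
    intro x hx
    rw [Mem.setVar_var, if_neg (hx r le_rfl)]
  | var y =>
    intro r σ μ h
    refine ⟨1, _, .assign_setVar _ _ _, by simp [cost], rfl, ?_, by simp [Expr.eval, eval, h.var]⟩
    intro x hx
    rw [Mem.setVar_var, if_neg (hx r le_rfl)]
  | len =>
    intro r σ μ h
    refine ⟨1, _, .assign_setVar _ _ _, by simp [cost], rfl, ?_, by simp [Expr.eval, eval, h.len]⟩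
    intro x hx
    rw [Mem.setVar_var, if_neg (hx r le_rfl)]
  | get a idx ih =>
    intro r σ μ h
    obtain ⟨t₁, μ₁, x₁, c₁, a₁, v₁, w₁⟩ := ih r σ μ h
    refine ⟨_, _, .seq x₁ (.assign_setVar _ _ _), ?_, by simp [a₁], ?_, ?_⟩
    · simp [cost, c₁]
    · intro x hx
      rw [Mem.setVar_var, if_neg (hx r le_rfl), v₁ x hx]
    · simp [Expr.eval, eval, w₁, a₁, h.arr]
  | add e₁ e₂ ih₁ ih₂ =>
    exact Tm.exec_binary (op := .add) (g := fun a b => a + b) (fun _ _ _ => rfl) ih₁ ih₂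
  | sub e₁ e₂ ih₁ ih₂ =>
    exact Tm.exec_binary (op := .sub) (g := fun a b => a - b) (fun _ _ _ => rfl) ih₁ ih₂
  | lt e₁ e₂ ih₁ ih₂ =>
    exact Tm.exec_binary (op := .lt) (g := fun a b => if a < b then 1 else 0)
      (fun _ _ _ => rfl) ih₁ ih₂
  | eq e₁ e₂ ih₁ ih₂ =>
    exact Tm.exec_binary (op := .eq) (g := fun a b => if a = b then 1 else 0)
      (fun _ _ _ => rfl) ih₁ ih₂
  | cond c e₁ e₂ ih ih₁ ih₂ =>
    intro r σ μ h
    obtain ⟨t, μ₁, x₁, c₁, a₁, v₁, w₁⟩ := ih r σ μ h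
    by_cases hc : c.eval L σ = 0
    · obtain ⟨t₂, μ₂, x₂, c₂, a₂, v₂, w₂⟩ := ih₂ r σ μ₁ (h.of_odd a₁ v₁)
      refine ⟨_, _, .seq x₁ (.ite_false (by simp [Expr.eval, w₁, hc]) x₂), ?_, by simp [a₁, a₂],
        ?_, by simp [eval, hc, w₂]⟩
      · simp [cost]; omega
      · intro x hx
        rw [v₂ x hx, v₁ x hx]
    · obtain ⟨t₂, μ₂, x₂, c₂, a₂, v₂, w₂⟩ := ih₁ r σ μ₁ (h.of_odd a₁ v₁)
      refine ⟨_, _, .seq x₁ (.ite_true (by simp [Expr.eval, w₁, hc]) x₂), ?_, by simp [a₁, a₂],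
        ?_, by simp [eval, hc, w₂]⟩
      · simp [cost]; omega
      · intro x hx
        rw [v₂ x hx, v₁ x hx]
  | sum v e ih =>
    intro r σ μ h
    -- Temporary `r` accumulates the sum, `r + 1` keeps the old value of the summation register, and
    -- the summand works from `r + 2` on.
    have loop := Exec.countingLoop (v := 2 * v + 2) (L := L) (c := e.cost.eval L + 2)
      (p := .seq (e.compile (r + 2)) <|
        .seq (.assign (2 * r + 1) (.add (.var (2 * r + 1)) (.var (2 * (r + 2) + 1)))) <|
        .assign (2 * v + 2) (.add (.var (2 * v + 2)) (.const 1)))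
      (fun i μ' => Represents L (σ.setVar v i) μ' ∧ μ'.arr = μ.arr ∧
        (∀ x, (∀ s, r ≤ s → x ≠ 2 * s + 1) → x ≠ 2 * v + 2 → μ'.var x = μ.var x) ∧
        μ'.var (2 * r + 1) = ∑ j ∈ Finset.range i, e.eval L (σ.setVar v j) ∧
        μ'.var (2 * (r + 1) + 1) = σ.var v)
      (fun i μ' h' => ⟨by rw [h'.1.var]; simp, h'.1.len⟩)
      (by
        rintro i hi μ' ⟨h1, h2, h3, h4, h5⟩
        obtain ⟨t, μ₁, x₁, c₁, a₁, v₁, w₁⟩ := ih (r + 2) _ μ' h1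
        have hrep := h1.of_odd a₁ v₁
        refine ⟨_, _, .seq x₁ (.seq (.assign_setVar _ _ _) (.assign_setVar _ _ _)), ?_,
          ⟨?_, ?_, ?_⟩, ?_, ?_, ?_, ?_⟩
        · omega
        · rw [Mem.setVar_var, if_neg (by omega), Mem.setVar_var, if_neg (by omega), hrep.len]
        · intro x
          by_cases hx : x = v
          · subst hx
            rw [Mem.setVar_var, if_pos rfl]
            simp only [Expr.eval]
            rw [Mem.setVar_var, if_neg (by omega), hrep.var]
            simp
          · rw [Mem.setVar_var, if_neg (by omega), Mem.setVar_var, if_neg (by omega), hrep.var]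
            simp [hx]
        · intro a
          simp only [Mem.setVar_arr, hrep.arr]
        · simp [a₁, h2]
        · intro x hx hx'
          rw [Mem.setVar_var, if_neg hx', Mem.setVar_var, if_neg (hx r le_rfl),
            v₁ x (fun s hs => hx s (by omega)), h3 x hx hx']
        · rw [Mem.setVar_var, if_neg (by omega), Mem.setVar_var, if_pos rfl]
          simp only [Expr.eval]
          rw [v₁ _ (by omega), h4, w₁, Finset.sum_range_succ]
        · rw [Mem.setVar_var, if_neg (by omega), Mem.setVar_var, if_neg (by omega),
            v₁ _ (by omega), h5])
      (μ := ((μ.setVar (2 * r + 1) 0).setVar (2 * (r + 1) + 1) (σ.var v)).setVar (2 * v + 2) 0)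
      ⟨⟨by simp [h.len], fun x => by
          by_cases hx : x = v
          · simp [hx]
          · rw [Mem.setVar_var, if_neg (by omega), Mem.setVar_var, if_neg (by omega),
              Mem.setVar_var, if_neg (by omega), h.var]
            simp [hx], fun a => by simp [h.arr]⟩, by simp, fun x hx hx' => by
          rw [Mem.setVar_var, if_neg hx', Mem.setVar_var, if_neg (hx (r + 1) (by omega)),
              Mem.setVar_var, if_neg (hx r le_rfl)], by
          rw [Mem.setVar_var, if_neg (by omega), Mem.setVar_var, if_neg (by omega)]
          simp, by
          rw [Mem.setVar_var, if_neg (by omega)]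
          simp⟩
    obtain ⟨t, μ', hx, ht, h1, h2, h3, h4, h5⟩ := loop
    have e1 := Exec.assign_setVar (2 * r + 1) (.const 0) μ
    have e2 := Exec.assign_setVar (2 * (r + 1) + 1) (.var (2 * v + 2)) (μ.setVar (2 * r + 1) 0)
    have e3 := Exec.assign_setVar (2 * v + 2) (.const 0)
      ((μ.setVar (2 * r + 1) 0).setVar (2 * (r + 1) + 1) (σ.var v))
    have hval : (Expr.var (2 * v + 2)).eval (μ.setVar (2 * r + 1) 0) = σ.var v := by
      simp only [Expr.eval]
      rw [Mem.setVar_var, if_neg (by omega), h.var]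
    rw [hval] at e2
    refine ⟨_, _, .seq e1 (.seq e2 (.seq e3 (.seq hx (.assign_setVar _ _ _)))), ?_, by simp [h2],
      ?_, ?_⟩
    · simp [cost]; linarith
    · intro x hx
      by_cases hx' : x = 2 * v + 2
      · subst hx'
        rw [Mem.setVar_var, if_pos rfl]
        simp only [Expr.eval]
        rw [h5, h.var]
      · rw [Mem.setVar_var, if_neg hx', h3 x hx hx']
    · rw [Mem.setVar_var, if_neg (by omega), h4]
      simp [eval]

/-! ### Compilation of statements -/

/-- The compiled statement; its intermediate values are in the odd registers from `2 r + 1` on. -/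
def Stm.compile : Stm → ℕ → Prog
  | assign x e, r => .seq (e.compile r) (.assign (2 * x + 2) (.var (2 * r + 1)))
  | fill a v e, r =>
      .seq (.assign (2 * r + 1) (.var (2 * v + 2))) <|
      .seq (.assign (2 * v + 2) (.const 0)) <|
      .seq (.while (.lt (.var (2 * v + 2)) (.var 0)) <|
        .seq (e.compile (r + 1)) <|
        .seq (.store 1 (.var (2 * v + 2)) (.var (2 * (r + 1) + 1))) <|
        .assign (2 * v + 2) (.add (.var (2 * v + 2)) (.const 1))) <|
      .seq (.assign (2 * v + 2) (.var (2 * r + 1))) <|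
      .seq (.assign (2 * r + 1) (.const 0)) <|
      .while (.lt (.var (2 * r + 1)) (.var 0)) <|
        .seq (.store (2 * a) (.var (2 * r + 1)) (.get 1 (.var (2 * r + 1)))) <|
        .assign (2 * r + 1) (.add (.var (2 * r + 1)) (.const 1))
  | seq s₁ s₂, r => .seq (s₁.compile r) (s₂.compile r)
  | cond c s, r => .seq (c.compile r) (.ite (.var (2 * r + 1)) (s.compile r) .skip)
  | loop s, r =>
      .seq (.assign (2 * r + 1) (.const 0)) <|
      .while (.lt (.var (2 * r + 1)) (.var 0)) <|
        .seq (s.compile (r + 1)) <|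
        .assign (2 * r + 1) (.add (.var (2 * r + 1)) (.const 1))

/-- A bound for the running time. -/
def Stm.cost : Stm → Polynomial ℕ
  | assign _ e => e.cost + 1
  | fill _ _ e => Polynomial.X * (e.cost + 3) + Polynomial.X * 3 + 6
  | seq s₁ s₂ => s₁.cost + s₂.cost
  | cond c s => c.cost + s.cost + 2
  | loop s => Polynomial.X * (s.cost + 2) + 2

/-- That the temporaries below `r` survive is what lets a loop keep its counter in temporary `r`
while its body is compiled with `r + 1`. -/
theorem Stm.exec {L : ℕ} (s : Stm) : ∀ (r : ℕ) (σ μ : Mem), Represents L σ μ →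
    ∃ t μ', Exec (s.compile r) μ t μ' ∧ t ≤ s.cost.eval L ∧ Represents L (s.run L σ) μ' ∧
      ∀ q < r, μ'.var (2 * q + 1) = μ.var (2 * q + 1) := by
  induction s with
  | assign x e =>
    intro r σ μ h
    obtain ⟨t, μ₁, x₁, c₁, a₁, v₁, w₁⟩ := e.exec r σ μ h
    have hrep := h.of_odd a₁ v₁
    refine ⟨_, _, .seq x₁ (.assign_setVar _ _ _), by simp [cost, c₁], ⟨?_, ?_, ?_⟩, ?_⟩
    · rw [Mem.setVar_var, if_neg (by omega), hrep.len]
    · intro y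
      by_cases hy : y = x
      · simp [hy, run, Expr.eval, w₁]
      · rw [Mem.setVar_var, if_neg (by omega), hrep.var]
        simp [run, hy]
    · intro a
      simp [hrep.arr, run]
    · intro q hq
      rw [Mem.setVar_var, if_neg (by omega), v₁ _ (by omega)]
  | fill a v e =>
    intro r σ μ h
    obtain ⟨t, μ', hx, ht, h1, h2, h3, h4⟩ := Exec.countingLoop (v := 2 * v + 2) (L := L)
      (c := e.cost.eval L + 2)
      (p := .seq (e.compile (r + 1)) <|
        .seq (.store 1 (.var (2 * v + 2)) (.var (2 * (r + 1) + 1))) <|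
        .assign (2 * v + 2) (.add (.var (2 * v + 2)) (.const 1)))
      (fun i μ' => Represents L (σ.setVar v i) μ' ∧
        (∀ q < r, μ'.var (2 * q + 1) = μ.var (2 * q + 1)) ∧
        μ'.var (2 * r + 1) = σ.var v ∧
        ∀ j < i, μ'.arr 1 j = e.eval L (σ.setVar v j))
      (fun i μ' h' => ⟨by rw [h'.1.var]; simp, h'.1.len⟩)
      (by
        rintro i hi μ' ⟨h1, h2, h3, h4⟩
        obtain ⟨t, μ₁, x₁, c₁, a₁, v₁, w₁⟩ := e.exec (r + 1) _ μ' h1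
        have hrep := h1.of_odd a₁ v₁
        refine ⟨_, _, .seq x₁ (.seq (.store_setArr _ _ _ _) (.assign_setVar _ _ _)), ?_,
          ⟨?_, ?_, ?_⟩, ?_, ?_, ?_⟩
        · omega
        · rw [Mem.setVar_var, if_neg (by omega), Mem.setArr_var, hrep.len]
        · intro x
          by_cases hx : x = v
          · subst hx
            simp [Expr.eval, hrep.var]
          · rw [Mem.setVar_var, if_neg (by omega), Mem.setArr_var, hrep.var]
            simp [hx]
        · intro b
          rw [Mem.setVar_arr, Mem.setArr_arr, if_neg (by omega), hrep.arr]
          rfl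
        · intro q hq
          rw [Mem.setVar_var, if_neg (by omega), Mem.setArr_var, v₁ _ (by omega), h2 q hq]
        · rw [Mem.setVar_var, if_neg (by omega), Mem.setArr_var, v₁ _ (by omega), h3]
        · intro j hj
          have hi' : (Expr.var (2 * v + 2)).eval μ₁ = i := by
            simp [Expr.eval, hrep.var]
          rw [Mem.setVar_arr, Mem.setArr_arr, if_pos rfl, hi', Function.update_apply]
          split_ifs with hji
          · rw [hji, ← w₁]; rfl
          · rw [a₁, h4 j (by omega)])
      (μ := (μ.setVar (2 * r + 1) (σ.var v)).setVar (2 * v + 2) 0)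
      ⟨⟨by simp [h.len], fun x => by
          by_cases hx : x = v
          · simp [hx]
          · rw [Mem.setVar_var, if_neg (by omega), Mem.setVar_var, if_neg (by omega), h.var]
            simp [hx], fun a => by simp [h.arr]⟩, fun q hq => by
          rw [Mem.setVar_var, if_neg (by omega), Mem.setVar_var, if_neg (by omega)], by
          rw [Mem.setVar_var, if_neg (by omega)]
          simp, by simp⟩
    -- The second loop copies the buffer. Writing to the target at once would be wrong, because `e`
    -- may read the array that is being filled.
    obtain ⟨t', μ'', hx', ht', g1, g2, g3, g4, g5⟩ := Exec.countingLoop (v := 2 * r + 1) (L := L)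
      (c := 2)
      (p := .seq (.store (2 * a) (.var (2 * r + 1)) (.get 1 (.var (2 * r + 1)))) <|
        .assign (2 * r + 1) (.add (.var (2 * r + 1)) (.const 1)))
      (fun i μ'' => μ''.var (2 * r + 1) = i ∧
        (∀ x, x ≠ 2 * r + 1 → x ≠ 2 * v + 2 → μ''.var x = μ'.var x) ∧
        μ''.var (2 * v + 2) = σ.var v ∧
        (∀ b, b ≠ 2 * a → μ''.arr b = μ'.arr b) ∧
        (∀ j, μ''.arr (2 * a) j = if j < i then μ'.arr 1 j else μ'.arr (2 * a) j))
      (fun i μ'' h' => ⟨h'.1, by rw [h'.2.1 0 (by omega) (by omega), h1.len]⟩)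
      (by
        rintro i hi ν ⟨g1, g2, g3, g4, g5⟩
        refine ⟨_, _, .seq (.store_setArr _ _ _ _) (.assign_setVar _ _ _), le_rfl, ?_, ?_, ?_,
          ?_, ?_⟩
        · simp [Expr.eval, g1]
        · intro x hx hx'
          rw [Mem.setVar_var, if_neg hx, Mem.setArr_var, g2 x hx hx']
        · rw [Mem.setVar_var, if_neg (by omega), Mem.setArr_var, g3]
        · intro b hb
          rw [Mem.setVar_arr, Mem.setArr_arr, if_neg hb, g4 b hb]
        · intro j
          rw [Mem.setVar_arr, Mem.setArr_arr, if_pos rfl, Function.update_apply]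
          simp only [Expr.eval, g1, g4 1 (by omega), g5]
          split_ifs <;> first | rfl | omega | (congr 1; omega))
      (μ := (μ'.setVar (2 * v + 2) (σ.var v)).setVar (2 * r + 1) 0)
      ⟨by simp, fun x hx hx' => by
          rw [Mem.setVar_var, if_neg hx, Mem.setVar_var, if_neg hx'], by
          rw [Mem.setVar_var, if_neg (by omega)]
          simp, fun b hb => by simp, fun j => by simp⟩
    have e1 := Exec.assign_setVar (2 * r + 1) (.var (2 * v + 2)) μ
    have e2 := Exec.assign_setVar (2 * v + 2) (.const 0) (μ.setVar (2 * r + 1) (σ.var v))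
    have e3 := Exec.assign_setVar (2 * v + 2) (.var (2 * r + 1)) μ'
    have e4 := Exec.assign_setVar (2 * r + 1) (.const 0) (μ'.setVar (2 * v + 2) (σ.var v))
    have hval : (Expr.var (2 * v + 2)).eval μ = σ.var v := by
      simp only [Expr.eval, h.var]
    have hval' : (Expr.var (2 * r + 1)).eval μ' = σ.var v := by
      simp only [Expr.eval, h3]
    rw [hval] at e1
    rw [hval'] at e3
    refine ⟨_, _, .seq e1 (.seq e2 (.seq hx (.seq e3 (.seq e4 hx')))), ?_, ⟨?_, ?_, ?_⟩, ?_⟩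
    · simp [cost]; linarith
    · rw [g2 0 (by omega) (by omega), h1.len]
    · intro x
      by_cases hxv : x = v
      · rw [hxv, g3]; rfl
      · rw [g2 _ (by omega) (by omega), h1.var]
        simp [run, hxv]
    · intro b
      by_cases hb : b = a
      · subst hb
        funext j
        rw [g5, run, Mem.setArr_arr, if_pos rfl]
        split_ifs with hj
        · exact h4 j hj
        · rw [h1.arr]; rfl
      · rw [g4 _ (by omega), h1.arr]
        simp [run, hb]
    · intro q hq
      rw [g2 _ (by omega) (by omega), h2 q hq]
  | seq s₁ s₂ ih₁ ih₂ =>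
    intro r σ μ h
    obtain ⟨t₁, μ₁, x₁, c₁, h₁, v₁⟩ := ih₁ r σ μ h
    obtain ⟨t₂, μ₂, x₂, c₂, h₂, v₂⟩ := ih₂ r _ μ₁ h₁
    refine ⟨_, _, .seq x₁ x₂, by simp [cost]; omega, h₂, fun q hq => ?_⟩
    rw [v₂ q hq, v₁ q hq]
  | cond c s ih =>
    intro r σ μ h
    obtain ⟨t, μ₁, x₁, c₁, a₁, v₁, w₁⟩ := c.exec r σ μ h
    have hrep := h.of_odd a₁ v₁
    by_cases hc : c.eval L σ = 0
    · refine ⟨_, _, .seq x₁ (.ite_false (by simp [Expr.eval, w₁, hc]) (.skip _)), ?_, ?_, ?_⟩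
      · simp [cost]; omega
      · simpa [run, hc] using hrep
      · exact fun q hq => v₁ _ (by omega)
    · obtain ⟨t₂, μ₂, x₂, c₂, h₂, v₂⟩ := ih r σ μ₁ hrep
      refine ⟨_, _, .seq x₁ (.ite_true (by simp [Expr.eval, w₁, hc]) x₂), ?_, ?_, ?_⟩
      · simp [cost]; omega
      · simpa [run, hc] using h₂
      · intro q hq
        rw [v₂ q hq, v₁ _ (by omega)]
  | loop s ih =>
    intro r σ μ h
    obtain ⟨t, μ', hx, ht, h1, h2, h3⟩ := Exec.countingLoop (v := 2 * r + 1) (L := L)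
      (c := s.cost.eval L + 1)
      (p := .seq (s.compile (r + 1)) <|
        .assign (2 * r + 1) (.add (.var (2 * r + 1)) (.const 1)))
      (fun i μ' => μ'.var (2 * r + 1) = i ∧ Represents L ((s.run L)^[i] σ) μ' ∧
        ∀ q < r, μ'.var (2 * q + 1) = μ.var (2 * q + 1))
      (fun i μ' h' => ⟨h'.1, h'.2.1.len⟩)
      (by
        rintro i hi μ' ⟨h1, h2, h3⟩
        obtain ⟨t, μ₁, x₁, c₁, h₁, v₁⟩ := ih (r + 1) _ μ' h2
        refine ⟨_, _, .seq x₁ (.assign_setVar _ _ _), by omega, ?_, ⟨?_, ?_, ?_⟩, ?_⟩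
        · simp [Expr.eval, v₁ r (by omega), h1]
        · rw [Mem.setVar_var, if_neg (by omega), h₁.len]
        · intro x
          rw [Mem.setVar_var, if_neg (by omega), h₁.var, Function.iterate_succ_apply']
        · intro a
          rw [Mem.setVar_arr, h₁.arr, Function.iterate_succ_apply']
        · intro q hq
          rw [Mem.setVar_var, if_neg (by omega), v₁ q (by omega), h3 q hq])
      (μ := μ.setVar (2 * r + 1) 0)
      ⟨by simp, ⟨by simp [h.len], fun x => by
          rw [Mem.setVar_var, if_neg (by omega), h.var]; rfl, fun a => by simp [h.arr]⟩,
        fun q hq => by rw [Mem.setVar_var, if_neg (by omega)]⟩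
    refine ⟨_, _, .seq (.assign_setVar _ _ _) hx, ?_, h2, h3⟩
    simp [cost]; linarith

/-! ### From structured programs to polynomial time -/

theorem length_le_inputSize (l : List ℕ) : l.length ≤ inputSize l := by
  unfold inputSize
  induction l with
  | nil => simp
  | cons a l ih => simp; omega

/-- The state in which a structured program starts on the input `l`. -/
def startMem (l : List ℕ) : Mem where
  var := fun _ => 0
  arr := Function.update (fun _ _ => 0) 0 (fun i => l.getD i 0)

/-- A function that is computed by a structured program is computable in polynomial time. -/
theorem polyTimeComputable_of_stm {α : Type} {enc : α → List ℕ} {f : α → Bool} (s : Stm) (x : ℕ)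
    (h : ∀ a, (s.run (enc a).length (startMem (enc a))).var x = if f a then 1 else 0) :
    PolyTimeComputable enc f := by
  refine ⟨.seq (s.compile 0) (.assign 0 (.var (2 * x + 2))), s.cost + 1, fun a => ?_⟩
  obtain ⟨t, μ, hx, ht, hr, -⟩ := s.exec (L := (enc a).length) 0 (startMem (enc a))
    (initMem (enc a)) ⟨by simp [initMem], fun x => by simp [initMem, startMem], fun b => by
      by_cases hb : b = 0 <;> simp [initMem, startMem, hb]⟩
  refine ⟨_, _, .seq hx (.assign_setVar _ _ _), ?_, ?_⟩
  · have mono : s.cost.eval (enc a).length ≤ s.cost.eval (inputSize (enc a)) := by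
      generalize s.cost = p
      rw [Polynomial.eval_eq_sum, Polynomial.eval_eq_sum]
      exact Finset.sum_le_sum fun i _ =>
        Nat.mul_le_mul_left _ (Nat.pow_le_pow_left (length_le_inputSize _) _)
    simp; omega
  · simp [Expr.eval, hr.var, h]

/-! ### The combinatorial core

A vote enters only through its first candidate `a i` and its second candidate `b i`. -/

/-! ### Subsets with prescribed fibre sizes -/

section Fibers

variable {ι κ : Type} [DecidableEq ι] [DecidableEq κ]

/-- The fibres of `g` are disjoint, so sets of the right size between `M` and `E` can be chosen in
each fibre independently and glued. -/
theorem exists_fiberwise_subset_superset {M E : Finset ι} (g : ι → κ) (cap : κ → ℕ) (hME : M ⊆ E)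
    (hM : ∀ x, (M.filter fun i => g i = x).card ≤ cap x)
    (hE : ∀ x, cap x ≤ (E.filter fun i => g i = x).card) :
    ∃ F, M ⊆ F ∧ F ⊆ E ∧ ∀ x, (F.filter fun i => g i = x).card = cap x := by
  have h x := Finset.exists_subsuperset_card_eq (Finset.filter_subset_filter (g · = x) hME)
    (hM x) (hE x)
  choose G h1 h2 h3 using h
  refine ⟨E.filter fun i => i ∈ G (g i), ?_, Finset.filter_subset _ _, fun x => ?_⟩
  · intro i hi
    exact Finset.mem_filter.2 ⟨hME hi, h1 _ (Finset.mem_filter.2 ⟨hi, rfl⟩)⟩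
  · rw [← h3 x]
    congr 1
    ext i
    simp only [Finset.mem_filter]
    constructor
    · rintro ⟨⟨_, h⟩, rfl⟩
      exact h
    · intro h
      have := Finset.mem_filter.1 (h2 x h)
      exact ⟨⟨this.1, this.2 ▸ h⟩, this.2⟩

theorem exists_fiberwise_subset (E : Finset ι) (g : ι → κ) (cap : κ → ℕ) :
    ∃ F ⊆ E, ∀ x, (F.filter fun i => g i = x).card =
      min (E.filter fun i => g i = x).card (cap x) := by
  obtain ⟨F, -, h1, h2⟩ := exists_fiberwise_subset_superset g
    (fun x => min (E.filter fun i => g i = x).card (cap x)) (Finset.empty_subset E)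
    (by simp) (fun x => min_le_left _ _)
  exact ⟨F, h1, h2⟩

theorem sum_card_fibers [Fintype κ] (E : Finset ι) (g : ι → κ) :
    ∑ x, (E.filter fun i => g i = x).card = E.card :=
  (Finset.card_eq_sum_card_fiberwise (fun _ _ => Finset.mem_coe.2 (Finset.mem_univ _))).symm

end Fibers

/-! ### The criterion and insertion numbers -/

section Core

variable {ι κ : Type} [Fintype ι] [DecidableEq ι] [DecidableEq κ]

/-- The 2-approval score. -/
def topScore (a b : ι → κ) (x : κ) : ℕ :=
  (Finset.univ.filter fun i => a i = x).card + (Finset.univ.filter fun i => b i = x).card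

/-- By how much `x` beats `xs`. -/
def excess (a b : ι → κ) (xs x : κ) : ℕ := topScore a b x - topScore a b xs

/-- The number of high priority votes of `x`. -/
def highCount (a b : ι → κ) (xs x : κ) : ℕ :=
  (Finset.univ.filter fun i => b i = x ∧ a i ≠ xs).card

/-- `x` beats `xs` and has more high priority votes than needed. -/
def Early (a b : ι → κ) (xs x : κ) : Prop :=
  0 < excess a b xs x ∧ excess a b xs x < highCount a b xs x

/-- `x` beats `xs` and its high priority votes are all needed. -/
def Late (a b : ι → κ) (xs x : κ) : Prop :=
  0 < excess a b xs x ∧ highCount a b xs x ≤ excess a b xs x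

instance (a b : ι → κ) (xs x : κ) : Decidable (Early a b xs x) :=
  inferInstanceAs (Decidable (_ ∧ _))

instance (a b : ι → κ) (xs x : κ) : Decidable (Late a b xs x) :=
  inferInstanceAs (Decidable (_ ∧ _))

/-- The number of low priority votes of `x` that have to be used, if `x` is late. -/
def capTop (a b : ι → κ) (xs x : κ) : ℕ :=
  if Late a b xs x then
    excess a b xs x - ((Finset.univ.filter fun i => b i = x).card +
      (Finset.univ.filter fun i => a i = x ∧ Late a b xs (b i)).card)
  else 0

/-- The number of times that `x` has to be pushed out, if `x` is early. -/
def capSec (a b : ι → κ) (xs x : κ) : ℕ := if Early a b xs x then excess a b xs x else 0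

/-- A set of votes in which no candidate is on top or second more often than allowed. -/
def IsBMatching (a b : ι → κ) (p q : κ → ℕ) (M : Finset ι) : Prop :=
  (∀ x, (M.filter fun i => a i = x).card ≤ p x) ∧ ∀ x, (M.filter fun i => b i = x).card ≤ q x

/-- The numerical criterion for a possible cowinner. -/
def Crit [Fintype κ] (a b : ι → κ) (xs : κ) (k : ℕ) : Prop :=
  ∃ M, IsBMatching a b (capTop a b xs) (capSec a b xs) M ∧
    ∑ x, excess a b xs x + ∑ x, capTop a b xs x ≤ M.card + k * topScore a b xs

/-- The numerical criterion for a possible cowinner if there is one new candidate. -/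
def CritOne [Fintype κ] (a b : ι → κ) (xs : κ) : Prop :=
  (∀ x, excess a b xs x ≤ (Finset.univ.filter fun i => b i = x).card) ∧
    ∑ x, excess a b xs x ≤ topScore a b xs

/-- The number of votes that `x` loses if `c i` new candidates are inserted on vote `i`. -/
def loss (a b : ι → κ) (c : ι → ℕ) (x : κ) : ℕ :=
  (Finset.univ.filter fun i => b i = x ∧ 1 ≤ c i).card +
    (Finset.univ.filter fun i => a i = x ∧ 2 ≤ c i).card

theorem excess_self (a b : ι → κ) (xs : κ) : excess a b xs xs = 0 := by simp [excess]

theorem late_or_early_or_zero (a b : ι → κ) (xs x : κ) :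
    Late a b xs x ∨ Early a b xs x ∨ excess a b xs x = 0 := by
  unfold Late Early; omega

theorem Late.not_early {a b : ι → κ} {xs x : κ} (h : Late a b xs x) : ¬ Early a b xs x :=
  fun h' => absurd h.2 (not_le.2 h'.2)

theorem late_early_zero_split (a b : ι → κ) (xs : κ) (f : κ → ℕ) (x : κ) :
    f x = (if Late a b xs x then f x else 0) + (if Early a b xs x then f x else 0) +
      (if excess a b xs x = 0 then f x else 0) := by
  rcases late_or_early_or_zero a b xs x with h | h | h
  · rw [if_pos h, if_neg h.not_early, if_neg h.1.ne']; omega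
  · rw [if_neg fun h' : Late a b xs x => h'.not_early h, if_pos h, if_neg h.1.ne']; omega
  · rw [if_neg fun h' : Late a b xs x => h'.1.ne' h, if_neg fun h' : Early a b xs x => h'.1.ne' h,
      if_pos h]
    omega

theorem sum_excess_split [Fintype κ] (a b : ι → κ) (xs : κ) :
    ∑ x, excess a b xs x = ∑ x, (if Late a b xs x then excess a b xs x else 0) +
      ∑ x, (if Early a b xs x then excess a b xs x else 0) := by
  rw [← Finset.sum_add_distrib]
  refine Finset.sum_congr rfl fun x _ => ?_
  have := late_early_zero_split a b xs (excess a b xs) x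
  rwa [show (if excess a b xs x = 0 then excess a b xs x else 0) = 0 by
    split_ifs with h <;> simp [h], add_zero] at this

/-- A vote with `c i` insertions takes at most `min 2 (c i)` approvals away. -/
theorem sum_loss_le [Fintype κ] {a b : ι → κ} {c : ι → ℕ} :
    ∑ x, loss a b c x ≤ ∑ i, c i := by
  simp only [loss, Finset.sum_add_distrib, and_comm (a := _ = _)]
  simp only [← Finset.filter_filter, sum_card_fibers]
  simp only [Finset.card_filter]
  rw [← Finset.sum_add_distrib]
  refine Finset.sum_le_sum fun i _ => ?_
  split_ifs <;> omega

/-- Of the votes that `x` loses from the top, those over a late second candidate are already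
subtracted in `capTop`. The others have a second candidate that is early, harmless, or x* itself.
The last kind costs x* approvals, and is paid for by the term `loss a b c xs` of the hypothesis. -/
theorem residual_le {a b : ι → κ} {xs x : κ} {c : ι → ℕ} (hL : Late a b xs x)
    (h : excess a b xs x + loss a b c xs ≤ loss a b c x) :
    capTop a b xs x ≤
      (Finset.univ.filter fun i => a i = x ∧ 2 ≤ c i ∧ Early a b xs (b i)).card +
      (Finset.univ.filter fun i => a i = x ∧ 1 ≤ c i ∧ excess a b xs (b i) = 0 ∧ b i ≠ xs).card := by
  rw [capTop, if_pos hL, Nat.sub_le_iff_le_add]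
  have h1 : (Finset.univ.filter fun i => b i = x ∧ 1 ≤ c i).card ≤
      (Finset.univ.filter fun i => b i = x).card :=
    Finset.card_le_card fun i hi => by
      simp only [Finset.mem_filter] at hi ⊢
      exact ⟨hi.1, hi.2.1⟩
  have h2 : (Finset.univ.filter fun i => a i = x ∧ 2 ≤ c i).card ≤
      (Finset.univ.filter fun i => a i = x ∧ Late a b xs (b i)).card +
      (Finset.univ.filter fun i => a i = x ∧ 2 ≤ c i ∧ Early a b xs (b i)).card +
      (Finset.univ.filter fun i => a i = x ∧ 1 ≤ c i ∧ excess a b xs (b i) = 0 ∧ b i ≠ xs).card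
      + (Finset.univ.filter fun i => b i = xs ∧ 1 ≤ c i).card := by
    simp only [Finset.card_filter, ← Finset.sum_add_distrib]
    refine Finset.sum_le_sum fun i _ => ?_
    by_cases hc : a i = x ∧ 2 ≤ c i
    · have h4 : 1 ≤ c i := by omega
      rw [if_pos hc]
      obtain ⟨h1, h2⟩ := hc
      rcases late_or_early_or_zero a b xs (b i) with h3 | h3 | h3
      · rw [if_pos ⟨h1, h3⟩]; omega
      · rw [if_pos (⟨h1, h2, h3⟩ : a i = x ∧ 2 ≤ c i ∧ Early a b xs (b i))]; omega
      · by_cases h5 : b i = xs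
        · rw [if_pos (⟨h5, h4⟩ : b i = xs ∧ 1 ≤ c i)]; omega
        · rw [if_pos (⟨h1, h4, h3, h5⟩ :
            a i = x ∧ 1 ≤ c i ∧ excess a b xs (b i) = 0 ∧ b i ≠ xs)]; omega
    · rw [if_neg hc]; omega
  have h3 : loss a b c xs = (Finset.univ.filter fun i => b i = xs ∧ 1 ≤ c i).card +
    (Finset.univ.filter fun i => a i = xs ∧ 2 ≤ c i).card := rfl
  have h4 : loss a b c x = (Finset.univ.filter fun i => b i = x ∧ 1 ≤ c i).card +
    (Finset.univ.filter fun i => a i = x ∧ 2 ≤ c i).card := rfl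
  omega

/-- The matching is trimmed from the votes in which two insertions hit a late candidate above an
early one, first to the capacities of the late candidates and then to those of the early ones.
Whatever is trimmed off shows up as loss beyond the excess, so the total bill does not suffer. -/
theorem crit_of_insertions [Fintype κ] {a b : ι → κ} {xs : κ} {k : ℕ} {c : ι → ℕ}
    (h : ∀ x, 0 < excess a b xs x → excess a b xs x + loss a b c xs ≤ loss a b c x)
    (hc : ∑ i, c i ≤ k * topScore a b xs) : Crit a b xs k := by
  set E := Finset.univ.filter fun i => Late a b xs (a i) ∧ 2 ≤ c i ∧ Early a b xs (b i) with hE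
  obtain ⟨F, hFE, hF⟩ := exists_fiberwise_subset E a (capTop a b xs)
  obtain ⟨M, hMF, hM⟩ := exists_fiberwise_subset F b (capSec a b xs)
  refine ⟨M, ⟨fun x => ?_, fun x => ?_⟩, ?_⟩
  · exact (Finset.card_le_card (Finset.filter_subset_filter _ hMF)).trans
      ((hF x).le.trans (min_le_right _ _))
  · exact (hM x).le.trans (min_le_right _ _)
  -- Votes in which the first insertion is wasted on a candidate without excess; they are paid for
  -- by the losses of such candidates.
  set β : κ → ℕ := fun x =>
    (Finset.univ.filter fun i => a i = x ∧ 1 ≤ c i ∧ excess a b xs (b i) = 0 ∧ b i ≠ xs).card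
    with hβ
  have s1 : ∀ x, capTop a b xs x + (if Late a b xs x then excess a b xs x else 0) ≤
      (F.filter fun i => a i = x).card + (if Late a b xs x then loss a b c x else 0) + β x := by
    intro x
    rw [hF]
    by_cases hL : Late a b xs x
    · have h1 := residual_le hL (h x hL.1)
      have h2 := h x hL.1
      have h3 : (E.filter fun i => a i = x) =
          Finset.univ.filter fun i => a i = x ∧ 2 ≤ c i ∧ Early a b xs (b i) := by
        ext i
        simp only [hE, Finset.mem_filter, Finset.mem_univ, true_and]
        constructor
        · rintro ⟨⟨_, h⟩, h'⟩; exact ⟨h', h⟩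
        · rintro ⟨rfl, h⟩; exact ⟨⟨hL, h⟩, rfl⟩
      rw [h3]
      simp only [hL, if_true, hβ]
      omega
    · simp [hL, capTop]
  -- Either nothing is trimmed at `x` and `x` loses at least its excess, or exactly the excess is
  -- kept and every vote of `F` at `x` is a loss of `x`.
  have s2 : ∀ x, (F.filter fun i => b i = x).card +
      (if Early a b xs x then excess a b xs x else 0) ≤
      (M.filter fun i => b i = x).card + (if Early a b xs x then loss a b c x else 0) := by
    intro x
    rw [hM]
    by_cases hL : Early a b xs x
    · have h2 := h x hL.1
      have h1 : (F.filter fun i => b i = x).card ≤ loss a b c x := by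
        refine (Finset.card_le_card ?_).trans (Nat.le_add_right _ _)
        intro i hi
        obtain ⟨hi, hix⟩ := Finset.mem_filter.1 hi
        have := (Finset.mem_filter.1 (hFE hi)).2
        simp only [Finset.mem_filter, Finset.mem_univ, true_and]
        exact ⟨hix, by omega⟩
      simp only [hL, if_true, capSec]
      omega
    · have : (F.filter fun i => b i = x) = ∅ := by
        rw [Finset.filter_eq_empty_iff]
        rintro i hi rfl
        exact hL (Finset.mem_filter.1 (hFE hi)).2.2.2
      simp [this, hL]
  have s3 : ∑ x, β x ≤ ∑ x, if excess a b xs x = 0 then loss a b c x else 0 := by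
    calc ∑ x, β x = (Finset.univ.filter fun i => 1 ≤ c i ∧ excess a b xs (b i) = 0 ∧
          b i ≠ xs).card := by
          rw [← sum_card_fibers _ a]
          simp only [hβ, Finset.filter_filter, and_comm, and_left_comm]
      _ = ∑ x, ((Finset.univ.filter fun i => 1 ≤ c i ∧ excess a b xs (b i) = 0 ∧
          b i ≠ xs).filter fun i => b i = x).card := (sum_card_fibers _ b).symm
      _ ≤ _ := by
        refine Finset.sum_le_sum fun x _ => ?_
        split_ifs with hx
        · refine (Finset.card_le_card ?_).trans (Nat.le_add_right _ _)
          intro i hi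
          simp only [Finset.mem_filter, Finset.mem_univ, true_and] at hi ⊢
          exact ⟨hi.2, hi.1.1⟩
        · rw [Nat.le_zero, Finset.card_eq_zero, Finset.filter_eq_empty_iff]
          rintro i hi rfl
          exact hx (Finset.mem_filter.1 hi).2.2.1
  have t1 := Finset.sum_le_sum fun x (_ : x ∈ Finset.univ) => s1 x
  have t2 := Finset.sum_le_sum fun x (_ : x ∈ Finset.univ) => s2 x
  have t4 := sum_excess_split a b xs
  have t5 : ∑ x, loss a b c x = _ :=
    Finset.sum_congr rfl fun x _ => late_early_zero_split a b xs (loss a b c) x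
  have t6 := sum_loss_le (a := a) (b := b) (c := c)
  simp only [Finset.sum_add_distrib, sum_card_fibers] at t1 t2 t5
  omega

/-- Low priority votes never run out: apart from these, the votes with `x` on top have a late second
candidate or x* as second, and the latter are at most as many as the approvals of x*, which the
excess leaves aside. -/
theorem capTop_le_low (a b : ι → κ) (xs x : κ) :
    capTop a b xs x ≤
      ((Finset.univ.filter fun i => Late a b xs (a i) ∧ ¬ Late a b xs (b i) ∧ b i ≠ xs).filter
        fun i => a i = x).card := by
  rw [Finset.filter_filter, capTop]
  split_ifs with hL
  · have h1 : (Finset.univ.filter fun i => a i = x).card ≤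
        (Finset.univ.filter fun i => a i = x ∧ Late a b xs (b i)).card +
        (Finset.univ.filter fun i => (Late a b xs (a i) ∧ ¬ Late a b xs (b i) ∧ b i ≠ xs) ∧
          a i = x).card + (Finset.univ.filter fun i => b i = xs).card := by
      simp only [Finset.card_filter, ← Finset.sum_add_distrib]
      refine Finset.sum_le_sum fun i _ => ?_
      by_cases h1 : a i = x
      · subst h1
        by_cases h2 : Late a b xs (b i) <;> by_cases h3 : b i = xs <;> simp [h2, h3, hL]
      · simp [h1]
    have h2 : excess a b xs x = topScore a b x - topScore a b xs := rfl
    have h3 : topScore a b x = (Finset.univ.filter fun i => a i = x).card +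
      (Finset.univ.filter fun i => b i = x).card := rfl
    have h4 : (Finset.univ.filter fun i => b i = xs).card ≤ topScore a b xs := Nat.le_add_left _ _
    omega
  · omega

/-- All high priority votes of late candidates receive one insertion, chosen medium ones one more,
chosen low ones two; early candidates are then completed by single insertions on their high priority
votes. x* loses nothing, which is stronger than what `crit_of_insertions` requires. -/
theorem insertions_of_crit [Fintype κ] {a b : ι → κ} {xs : κ} {k : ℕ}
    (H : Crit a b xs k) :
    ∃ c : ι → ℕ, (∀ i, c i ≤ 2) ∧ (∀ i, b i = xs → c i = 0) ∧ (∀ i, a i = xs → c i ≤ 1) ∧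
      (∀ x, excess a b xs x ≤ loss a b c x) ∧ ∑ i, c i ≤ k * topScore a b xs := by
  obtain ⟨M, ⟨hM1, hM2⟩, hM⟩ := H
  have nxs : ¬ Late a b xs xs := fun h => by
    have := h.1
    rw [excess_self] at this
    omega
  have nxs' : ¬ Early a b xs xs := fun h => by
    have := h.1
    rw [excess_self] at this
    omega
  -- the medium priority votes that are used
  obtain ⟨A, hA, hAc⟩ := exists_fiberwise_subset
    (Finset.univ.filter fun i => Late a b xs (b i) ∧ (a i = xs ∨ Late a b xs (a i)))
    (fun i => if a i = xs then b i else a i) (fun x => excess a b xs x - highCount a b xs x)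
  -- the low priority votes that are used
  have hML : M ⊆ Finset.univ.filter
      fun i => Late a b xs (a i) ∧ ¬ Late a b xs (b i) ∧ b i ≠ xs := by
    intro i hi
    have h1 : i ∈ M.filter fun j => a j = a i := Finset.mem_filter.2 ⟨hi, rfl⟩
    have h2 : i ∈ M.filter fun j => b j = b i := Finset.mem_filter.2 ⟨hi, rfl⟩
    replace h1 := (Finset.card_pos.2 ⟨i, h1⟩).trans_le (hM1 (a i))
    replace h2 := (Finset.card_pos.2 ⟨i, h2⟩).trans_le (hM2 (b i))
    have h3 : Late a b xs (a i) := by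
      by_contra h
      simp [capTop, h] at h1
    have h4 : Early a b xs (b i) := by
      by_contra h
      simp [capSec, h] at h2
    refine Finset.mem_filter.2 ⟨Finset.mem_univ _, h3, fun h => h.not_early h4, fun h => ?_⟩
    rw [h] at h4
    exact nxs' h4
  -- The matching need not meet the whole demand of the late candidates. It is filled up to exactly
  -- `capTop` with further low priority votes, whose first insertion may be wasted.
  obtain ⟨L, hL1, hL2, hLc⟩ := exists_fiberwise_subset_superset a (capTop a b xs) hML hM1
    (capTop_le_low a b xs)
  -- the high priority votes of early candidates that are used
  obtain ⟨R, hR, hRc⟩ := exists_fiberwise_subset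
    (Finset.univ.filter fun i => Early a b xs (b i) ∧ a i ≠ xs ∧ i ∉ L)
    b (fun x => excess a b xs x - (L.filter fun i => b i = x).card)
  have hA' : ∀ i ∈ A, Late a b xs (b i) ∧ (a i = xs ∨ Late a b xs (a i)) := fun i hi =>
    (Finset.mem_filter.1 (hA hi)).2
  have hL' : ∀ i ∈ L, Late a b xs (a i) ∧ ¬ Late a b xs (b i) ∧ b i ≠ xs := fun i hi =>
    (Finset.mem_filter.1 (hL2 hi)).2
  have hR' : ∀ i ∈ R, Early a b xs (b i) ∧ a i ≠ xs ∧ i ∉ L := fun i hi =>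
    (Finset.mem_filter.1 (hR hi)).2
  -- High and medium priority votes together are exactly the single insertions that `capTop`
  -- subtracts.
  have cheap : ∀ x, Late a b xs x → ((Finset.univ.filter fun i => Late a b xs (b i) ∧
      (a i = xs ∨ Late a b xs (a i))).filter
        fun i => (if a i = xs then b i else a i) = x).card + highCount a b xs x =
      (Finset.univ.filter fun i => b i = x).card +
      (Finset.univ.filter fun i => a i = x ∧ Late a b xs (b i)).card := by
    intro x hx
    rw [Finset.filter_filter, highCount]
    simp only [Finset.card_filter, ← Finset.sum_add_distrib]
    refine Finset.sum_congr rfl fun i _ => ?_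
    have hxs : xs ≠ x := fun h => nxs (h ▸ hx)
    by_cases h1 : a i = xs
    · by_cases h2 : b i = x
      · simp [h1, h2, hx, hxs]
      · simp [h1, h2, hxs]
    · by_cases h2 : a i = x
      · subst h2
        by_cases h3 : Late a b xs (b i) <;> simp [h1, h3, hx, add_comm]
      · simp [h1, h2]
  refine ⟨fun i => (if Late a b xs (b i) ∧ a i ≠ xs then 1 else 0) + (if i ∈ A then 1 else 0) +
    2 * (if i ∈ L then 1 else 0) + (if i ∈ R then 1 else 0), ?_, ?_, ?_, ?_, ?_⟩
  · intro i
    beta_reduce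
    by_cases h1 : Late a b xs (b i)
    · rw [if_neg fun h => (hL' i h).2.1 h1, if_neg fun h => h1.not_early (hR' i h).1]
      split_ifs <;> omega
    · rw [if_neg fun h : _ ∧ _ => h1 h.1, if_neg fun h => h1 (hA' i h).1]
      by_cases h2 : i ∈ L
      · rw [if_pos h2, if_neg fun h => (hR' i h).2.2 h2]
      · rw [if_neg h2]
        split_ifs <;> omega
  · intro i hi
    have h1 : ¬ Late a b xs (b i) := hi ▸ nxs
    have h2 : ¬ Early a b xs (b i) := hi ▸ nxs'
    beta_reduce
    rw [if_neg fun h : _ ∧ _ => h1 h.1, if_neg fun h => h1 (hA' i h).1,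
      if_neg fun h => (hL' i h).2.2 hi, if_neg fun h => h2 (hR' i h).1]
  · intro i hi
    have h1 : ¬ Late a b xs (a i) := hi ▸ nxs
    beta_reduce
    rw [if_neg fun h : Late a b xs (b i) ∧ a i ≠ xs => h.2 hi, if_neg fun h => h1 (hL' i h).1,
      if_neg fun h => (hR' i h).2.1 hi]
    split_ifs <;> omega
  · intro x
    by_cases hx : 0 < excess a b xs x
    swap
    · omega
    by_cases hL : Late a b xs x
    · have h1 : highCount a b xs x +
          (A.filter fun i => (if a i = xs then b i else a i) = x).card +
          (L.filter fun i => a i = x).card ≤ loss a b (fun i =>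
            (if Late a b xs (b i) ∧ a i ≠ xs then 1 else 0) + (if i ∈ A then 1 else 0) +
            2 * (if i ∈ L then 1 else 0) + (if i ∈ R then 1 else 0)) x := by
        rw [← Finset.filter_univ_mem (s := A), ← Finset.filter_univ_mem (s := L)]
        simp only [loss, highCount, Finset.filter_filter, Finset.card_filter,
          ← Finset.sum_add_distrib]
        refine Finset.sum_le_sum fun i _ => ?_
        have h1 := hA' i
        have h2 := hL' i
        simp only [Finset.mem_filter, Finset.mem_univ, true_and]
        have hxs : xs ≠ x := fun h => nxs (h ▸ hL)
        by_cases hax : a i = xs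
        · have hiL : i ∉ L := fun h => nxs (hax ▸ (h2 h).1)
          by_cases hbx : b i = x <;> by_cases hiA : i ∈ A <;>
            simp [hax, hbx, hiA, hiL, hxs]
        · by_cases hay : a i = x
          · by_cases hiL : i ∈ L
            · have hiA : i ∉ A := fun h => (h2 hiL).2.1 (h1 h).1
              have hbx : b i ≠ x := fun h => (h2 hiL).2.1 (h ▸ hL)
              simp only [hay, hiL, hiA, hbx, false_and, and_true, if_true, if_false, true_and]
              rw [if_pos (by omega)]
            · by_cases hiA : i ∈ A
              · by_cases hbx : b i = x
                · simp [hay, hbx, hiA, hiL, hL, hxs.symm]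
                  rw [if_pos (by omega)]
                · simp [hay, hbx, hiA, hiL, hxs.symm, (h1 hiA).1]
              · by_cases hbx : b i = x
                · simp [hay, hbx, hiA, hiL, hL, hxs.symm]
                · simp [hay, hbx, hiA, hiL]
          · by_cases hbx : b i = x
            · simp [hax, hay, hbx, hL]
              rw [if_pos (by omega)]
            · simp [hax, hay, hbx]
      refine le_trans ?_ h1
      rw [hAc, hLc, capTop, if_pos hL]
      have h2 := cheap x hL
      have h3 := hL.2
      omega
    · have hE : Early a b xs x := by unfold Late Early at *; omega
      have h1 : (L.filter fun i => b i = x).card + (R.filter fun i => b i = x).card ≤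
          loss a b (fun i =>
            (if Late a b xs (b i) ∧ a i ≠ xs then 1 else 0) + (if i ∈ A then 1 else 0) +
            2 * (if i ∈ L then 1 else 0) + (if i ∈ R then 1 else 0)) x := by
        rw [← Finset.filter_univ_mem (s := R), ← Finset.filter_univ_mem (s := L)]
        simp only [loss, Finset.filter_filter, Finset.card_filter, ← Finset.sum_add_distrib]
        refine Finset.sum_le_sum fun i _ => ?_
        have h2 := hR' i
        simp only [Finset.mem_filter, Finset.mem_univ, true_and]
        by_cases hbx : b i = x
        · by_cases hiL : i ∈ L <;> by_cases hiR : i ∈ R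
          · exact absurd hiL (h2 hiR).2.2
          · simp [hbx, hiL, hiR, hL]
          · simp [hbx, hiL, hiR, hL]
          · simp [hbx, hiL, hiR]
        · simp [hbx]
      refine le_trans ?_ h1
      rw [hRc]
      -- A high priority vote of an early candidate is either in `L`, where it is pushed out anyway,
      -- or still available for `R`; having more such votes than the excess therefore suffices.
      have h2 : highCount a b xs x ≤ (L.filter fun i => b i = x).card +
          ((Finset.univ.filter fun i => Early a b xs (b i) ∧ a i ≠ xs ∧ i ∉ L).filter
            fun i => b i = x).card := by
        rw [← Finset.filter_univ_mem (s := L)]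
        simp only [highCount, Finset.filter_filter, Finset.card_filter, ← Finset.sum_add_distrib]
        refine Finset.sum_le_sum fun i _ => ?_
        simp only [Finset.mem_filter, Finset.mem_univ, true_and]
        by_cases hbx : b i = x
        · by_cases hiL : i ∈ L <;> by_cases ha : a i = xs <;> simp [hbx, hiL, ha, hE]
        · simp [hbx]
      have h3 := hE.2
      omega
  · have s1 : ∀ x, (if Late a b xs x then highCount a b xs x else 0) +
        (A.filter fun i => (if a i = xs then b i else a i) = x).card + capTop a b xs x ≤
        if Late a b xs x then excess a b xs x else 0 := by
      intro x
      rw [hAc]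
      split_ifs with hL
      · have h2 := cheap x hL
        have h3 := hL.2
        rw [capTop, if_pos hL]
        omega
      · rw [capTop, if_neg hL, Finset.filter_filter]
        have : (Finset.univ.filter fun i => (Late a b xs (b i) ∧ (a i = xs ∨ Late a b xs (a i))) ∧
            (if a i = xs then b i else a i) = x) = ∅ := by
          rw [Finset.filter_eq_empty_iff]
          rintro i -
          by_cases h : a i = xs
          · simp only [h, if_true]
            rintro ⟨h1, rfl⟩
            exact hL h1.1
          · simp only [h, if_false]
            rintro ⟨h1, rfl⟩
            tauto
        simp [this]
    -- Each matched vote saves a single insertion: as `M ⊆ L`, it reduces what `R` has to supply.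
    -- Summed up, this is the term `M.card` of the criterion.
    have s2 : ∀ x, (R.filter fun i => b i = x).card + (M.filter fun i => b i = x).card ≤
        if Early a b xs x then excess a b xs x else 0 := by
      intro x
      have h1 : (M.filter fun i => b i = x).card ≤ (L.filter fun i => b i = x).card :=
        Finset.card_le_card (Finset.filter_subset_filter _ hL1)
      have h2 := hM2 x
      rw [capSec] at h2
      split_ifs at h2 ⊢ with hE
      · rw [hRc]; omega
      · have : (R.filter fun i => b i = x) = ∅ := by
          rw [Finset.filter_eq_empty_iff]
          rintro i hi rfl
          exact hE (hR' i hi).1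
        rw [this]
        simpa using h2
    have s3 : ∑ x, (if Late a b xs x then highCount a b xs x else 0) =
        (Finset.univ.filter fun i => Late a b xs (b i) ∧ a i ≠ xs).card := by
      rw [← sum_card_fibers _ b]
      refine Finset.sum_congr rfl fun x _ => ?_
      rw [Finset.filter_filter]
      split_ifs with hL
      · unfold highCount
        congr 1
        ext i
        simp only [Finset.mem_filter, Finset.mem_univ, true_and]
        constructor
        · rintro ⟨rfl, h⟩; exact ⟨⟨hL, h⟩, rfl⟩
        · rintro ⟨⟨_, h⟩, rfl⟩; exact ⟨rfl, h⟩
      · symm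
        rw [Finset.card_eq_zero, Finset.filter_eq_empty_iff]
        rintro i - ⟨h, rfl⟩
        exact hL h.1
    have t1 := Finset.sum_le_sum fun x (_ : x ∈ Finset.univ) => s1 x
    have t2 := Finset.sum_le_sum fun x (_ : x ∈ Finset.univ) => s2 x
    have t4 := sum_excess_split a b xs
    have t5 : ∑ x, _ = ∑ x, capTop a b xs x := Finset.sum_congr rfl fun x _ => hLc x
    simp only [Finset.sum_add_distrib, sum_card_fibers, s3] at t1 t2 t5
    simp only [Finset.sum_add_distrib, ← Finset.mul_sum, ← Finset.card_filter,
      Finset.filter_univ_mem]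
    omega

/-! ### The criterion for one new candidate -/

/-- With at most one insertion per vote only second places can be lost. -/
theorem critOne_of_insertions [Fintype κ] {a b : ι → κ} {xs : κ} {c : ι → ℕ}
    (hc1 : ∀ i, c i ≤ 1) (h : ∀ x, 0 < excess a b xs x → excess a b xs x ≤ loss a b c x)
    (hc : ∑ i, c i ≤ topScore a b xs) : CritOne a b xs := by
  refine ⟨fun x => ?_, ?_⟩
  · by_cases hx : 0 < excess a b xs x
    · refine (h x hx).trans ?_
      have : (Finset.univ.filter fun i => a i = x ∧ 2 ≤ c i) = ∅ := by
        rw [Finset.filter_eq_empty_iff]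
        intro i _ h
        have := hc1 i
        omega
      rw [loss, this, Finset.card_empty, add_zero]
      exact Finset.card_le_card fun i hi => by
        simp only [Finset.mem_filter] at hi ⊢
        exact ⟨hi.1, hi.2.1⟩
    · omega
  · refine (Finset.sum_le_sum fun x _ => ?_).trans ((sum_loss_le (a := a) (b := b)).trans hc)
    by_cases hx : 0 < excess a b xs x
    · exact h x hx
    · omega

theorem insertions_of_critOne [Fintype κ] {a b : ι → κ} {xs : κ} (H : CritOne a b xs) :
    ∃ c : ι → ℕ, (∀ i, c i ≤ 1) ∧ (∀ i, b i = xs → c i = 0) ∧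
      (∀ x, excess a b xs x ≤ loss a b c x) ∧ ∑ i, c i ≤ topScore a b xs := by
  obtain ⟨F, -, hF⟩ := exists_fiberwise_subset Finset.univ b (excess a b xs)
  have hF' : ∀ x, (F.filter fun i => b i = x).card = excess a b xs x := fun x => by
    rw [hF, min_eq_right (H.1 x)]
  refine ⟨fun i => if i ∈ F then 1 else 0, fun i => by beta_reduce; split_ifs <;> omega, fun i hi => ?_,
    fun x => ?_, ?_⟩
  · have := hF' xs
    rw [excess_self, Finset.card_eq_zero, Finset.filter_eq_empty_iff] at this
    simp only [ite_eq_right_iff, one_ne_zero, imp_false]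
    exact fun h => this h hi
  · rw [← hF' x]
    refine (Finset.card_le_card ?_).trans (Nat.le_add_right _ _)
    intro i hi
    simp only [Finset.mem_filter, Finset.mem_univ, true_and] at hi ⊢
    simp [hi]
  · rw [← Finset.card_filter, Finset.filter_univ_mem, ← sum_card_fibers F b]
    simpa only [hF'] using H.2

end Core

/-! ### Possible cowinners and numbers of insertions -/

/-- The first candidate of vote `i`. -/
def first (I : Instance) (i : Fin I.n) : Fin I.m := ((I.profile i)[0]?).getD I.xstar

/-- The second candidate of vote `i` (the distinguished candidate if there is no second one). -/
def second (I : Instance) (i : Fin I.n) : Fin I.m := ((I.profile i)[1]?).getD I.xstar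

/-- How often `c` stands in the first two positions. -/
def approvals {C : Type} [DecidableEq C] (W : List C) (c : C) : ℕ :=
  (if W[0]? = some c then 1 else 0) + (if W[1]? = some c then 1 else 0)

theorem approvalScore_two {C : Type} [DecidableEq C] {n : ℕ} (P : Fin n → List C) (c : C) :
    approvalScore 2 P c = ∑ i, approvals (P i) c := by
  simp only [approvalScore, numAt, Finset.sum_range_succ, Finset.sum_range_zero, zero_add,
    Finset.card_filter, approvals, Finset.sum_add_distrib]

theorem length_profile (I : Instance) (i : Fin I.n) : (I.profile i).length = I.m := by
  have h := I.isProfile i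
  have := List.toFinset_card_of_nodup h.1
  rw [← this, Finset.eq_univ_of_forall (fun c => List.mem_toFinset.2 (h.2 c)), Finset.card_univ,
    Fintype.card_fin]

theorem profile_eq (I : Instance) (h2 : 2 ≤ I.m) (i : Fin I.n) :
    ∃ l, I.profile i = first I i :: second I i :: l := by
  have := length_profile I i
  rcases h : I.profile i with _ | ⟨x, _ | ⟨y, l⟩⟩
  · rw [h] at this; simp at this; omega
  · rw [h] at this; simp at this; omega
  · exact ⟨l, by simp [first, second, h]⟩

theorem first_ne_second (I : Instance) (h2 : 2 ≤ I.m) (i : Fin I.n) : first I i ≠ second I i := by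
  obtain ⟨l, hl⟩ := profile_eq I h2 i
  have := (I.isProfile i).1
  rw [hl] at this
  intro h
  simp [h] at this

/-- The number of new candidates in the first two positions. -/
def newCount {X Y : Type} (W : List (X ⊕ Y)) : ℕ := (W.take 2).countP Sum.isRight

/-- If j of the first two places are taken by new candidates, exactly the first 2 − j of `a`, `b`
remain approved. -/
theorem approvals_inl_add {X Y : Type} [DecidableEq X] [DecidableEq Y] {W : List (X ⊕ Y)}
    {a b : X} {l : List X} (h : projection W = a :: b :: l) (x : X) :
    approvals W (Sum.inl x) + ((if b = x ∧ 1 ≤ newCount W then 1 else 0) +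
      (if a = x ∧ 2 ≤ newCount W then 1 else 0)) =
      (if a = x then 1 else 0) + (if b = x then 1 else 0) := by
  rcases W with _ | ⟨u | u, _ | ⟨v | v, W⟩⟩
  · simp [projection] at h
  · simp [projection] at h
  · simp only [projection, List.filterMap_cons, Sum.getLeft?_inl, List.cons.injEq] at h
    obtain ⟨rfl, rfl, -⟩ := h
    simp [approvals, newCount]
  · simp only [projection, List.filterMap_cons, Sum.getLeft?_inl, List.cons.injEq] at h
    obtain ⟨rfl, -⟩ := h
    simp [approvals, newCount, List.countP_cons]
  · simp [projection, List.filterMap_cons] at h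
  · simp only [projection, List.filterMap_cons, Sum.getLeft?_inr, Sum.getLeft?_inl,
      List.cons.injEq] at h
    obtain ⟨rfl, -⟩ := h
    simp [approvals, newCount, List.countP_cons, add_comm]
  · simp [approvals, newCount, List.countP_cons, add_comm]

/-- The two initial candidates after `w` keep the new candidates of `r` out of the first two
positions. -/
theorem approvals_append_inr {X Y : Type} [DecidableEq X] [DecidableEq Y] {w : List Y}
    (hw : w.length ≤ 2) (a b : X) (l : List X) (r : List (X ⊕ Y)) (y : Y) :
    approvals (w.map Sum.inr ++ (a :: b :: l).map Sum.inl ++ r) (Sum.inr y) = approvals w y := by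
  rcases w with _ | ⟨u, _ | ⟨v, w⟩⟩ <;> simp [approvals]

theorem sum_approvals_inr {X Y : Type} [DecidableEq X] [DecidableEq Y] [Fintype Y]
    (W : List (X ⊕ Y)) : ∑ y, approvals W (Sum.inr y) = newCount W := by
  rcases W with _ | ⟨u | u, _ | ⟨v | v, W⟩⟩ <;>
    simp [approvals, newCount, List.countP_cons, Finset.sum_add_distrib]

theorem approvalScore_inl_add_loss {I : Instance} (h2 : 2 ≤ I.m)
    {P' : Fin I.n → List (Fin I.m ⊕ Fin I.k)} (hE : Extends P' I.profile) (x : Fin I.m) :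
    approvalScore 2 P' (Sum.inl x) + loss (first I) (second I) (fun i => newCount (P' i)) x =
      topScore (first I) (second I) x := by
  simp only [approvalScore_two, loss, topScore, Finset.card_filter, ← Finset.sum_add_distrib]
  refine Finset.sum_congr rfl fun i _ => ?_
  obtain ⟨l, hl⟩ := profile_eq I h2 i
  exact approvals_inl_add ((hE i).trans hl) x

theorem sum_approvalScore_inr {I : Instance} (P' : Fin I.n → List (Fin I.m ⊕ Fin I.k)) :
    ∑ y, approvalScore 2 P' (Sum.inr y) = ∑ i, newCount (P' i) := by
  simp only [approvalScore_two]
  rw [Finset.sum_comm]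
  exact Finset.sum_congr rfl fun i _ => sum_approvals_inr _

/-- The numbers are the new candidates among the first two positions. Each new candidate has at most
the final score of x*, which is at most the initial one. With a single new candidate, two in one
vote would be a repetition. -/
theorem insertions_of_possibleCowinner {I : Instance} (h2 : 2 ≤ I.m) (H : PossibleCowinner 2 I) :
    ∃ c : Fin I.n → ℕ, (I.k = 1 → ∀ i, c i ≤ 1) ∧
      (∀ x, 0 < excess (first I) (second I) I.xstar x →
        excess (first I) (second I) I.xstar x + loss (first I) (second I) c I.xstar ≤
          loss (first I) (second I) c x) ∧
      ∑ i, c i ≤ I.k * topScore (first I) (second I) I.xstar := by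
  obtain ⟨P', hP, hE, hW⟩ := H
  refine ⟨fun i => newCount (P' i), fun hk i => ?_, fun x hx => ?_, ?_⟩
  · have hn := (hP i).1
    have sub : ∀ u v : Fin I.k, u = v := fun u v => by
      apply Fin.ext
      have := u.2; have := v.2
      omega
    revert hn
    beta_reduce
    rcases P' i with _ | ⟨u | u, _ | ⟨v | v, W⟩⟩ <;>
      simp [newCount, List.countP_cons]
    rw [sub u v]
    simp
  · have h1 := hW (Sum.inl x)
    have h3 := approvalScore_inl_add_loss h2 hE x
    have h4 := approvalScore_inl_add_loss h2 hE I.xstar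
    unfold excess at hx ⊢
    omega
  · have h4 := approvalScore_inl_add_loss h2 hE I.xstar
    rw [← sum_approvalScore_inr]
    calc ∑ y, approvalScore 2 P' (Sum.inr y)
        ≤ ∑ _y : Fin I.k, topScore (first I) (second I) I.xstar :=
          Finset.sum_le_sum fun y _ => (hW (Sum.inr y)).trans (by omega)
      _ = _ := by simp

/-- Consecutive blocks of lengths `c 0`, `c 1`, … tile an initial segment. -/
theorem sum_count_blocks (c : ℕ → ℕ) (Q : ℕ → Prop) [DecidablePred Q] (n : ℕ) :
    ∑ i ∈ Finset.range n, Nat.count (fun e => Q (∑ j ∈ Finset.range i, c j + e)) (c i) =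
      Nat.count Q (∑ j ∈ Finset.range n, c j) := by
  induction n with
  | zero => simp
  | succ n ih => rw [Finset.sum_range_succ, ih, Finset.sum_range_succ, Nat.count_add]

/-- Among the first `k * S` natural numbers every residue modulo `k` occurs exactly `S` times. -/
theorem count_mod_le {k S N : ℕ} (hk : 0 < k) (hN : N ≤ k * S) (y : Fin k) :
    Nat.count (fun t => t % k = y) N ≤ S := by
  refine (Nat.count_monotone _ hN).trans ?_
  have := Nat.count_modEq_card (b := k * S) (r := k) hk y
  simp only [Nat.ModEq, Nat.mod_eq_of_lt y.2] at this
  rw [this]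
  simp [hk]

/-- New candidates are dealt out in cyclic order through all votes. The hypotheses `hb` and `ha`
keep the score of x*, so each new candidate may receive as many approvals as x* had initially. -/
theorem possibleCowinner_of_insertions {I : Instance} (h2 : 2 ≤ I.m) (c : Fin I.n → ℕ)
    (hc2 : ∀ i, c i ≤ 2) (hck : ∀ i, c i ≤ I.k) (hb : ∀ i, second I i = I.xstar → c i = 0)
    (ha : ∀ i, first I i = I.xstar → c i ≤ 1)
    (hl : ∀ x, excess (first I) (second I) I.xstar x ≤ loss (first I) (second I) c x)
    (hs : ∑ i, c i ≤ I.k * topScore (first I) (second I) I.xstar) : PossibleCowinner 2 I := by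
  set c' : ℕ → ℕ := fun j => if h : j < I.n then c ⟨j, h⟩ else 0 with hc'
  have hcc : ∀ i : Fin I.n, c' i = c i := fun i => by simp [hc']
  -- Vote `i` continues where the previous votes stopped. Its at most `I.k` consecutive residues are
  -- distinct.
  set w : Fin I.n → List (Fin I.k) := fun i => (List.range (c i)).map fun e =>
    ⟨(∑ j ∈ Finset.range i, c' j + e) % I.k, Nat.mod_lt _ I.k_pos⟩ with hw
  have hwl : ∀ i, (w i).length = c i := fun i => by simp [hw]
  have hwn : ∀ i, (w i).Nodup := fun i => by
    refine List.Nodup.map_on ?_ List.nodup_range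
    intro e he e' he' hee
    rw [List.mem_range] at he he'
    have h1 : (∑ j ∈ Finset.range i, c' j + e) ≡ (∑ j ∈ Finset.range i, c' j + e') [MOD I.k] :=
      congrArg Fin.val hee
    exact (Nat.ModEq.add_left_cancel' _ h1).eq_of_lt_of_lt (he.trans_le (hck i))
      (he'.trans_le (hck i))
  set P' : Fin I.n → List (Fin I.m ⊕ Fin I.k) := fun i => (w i).map Sum.inr ++
    (I.profile i).map Sum.inl ++ ((List.finRange I.k).filter (· ∉ w i)).map Sum.inr with hP'
  have hE : Extends P' I.profile := fun i => by
    simp only [projection, hP', List.filterMap_append, List.filterMap_map]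
    have h1 : ∀ l : List (Fin I.k),
        l.filterMap ((Sum.getLeft? : Fin I.m ⊕ Fin I.k → _) ∘ Sum.inr) = [] := fun l => by
      simp [List.filterMap_eq_nil_iff]
    rw [h1, h1]
    simp only [List.nil_append, List.append_nil]
    exact List.filterMap_some
  have hnew : ∀ i, newCount (P' i) = c i := fun i => by
    obtain ⟨l, hl⟩ := profile_eq I h2 i
    have h3 := hwl i
    have h4 := hc2 i
    simp only [hP', newCount, hl]
    revert h3
    rcases w i with _ | ⟨u, _ | ⟨v, W⟩⟩ <;> intro h3 <;>
      simp [List.countP_cons] at h3 ⊢ <;> omega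
  have hscore := approvalScore_inl_add_loss h2 hE
  rw [show (fun i => newCount (P' i)) = c from funext hnew] at hscore
  have hxs : loss (first I) (second I) c I.xstar = 0 := by
    simp only [loss, Nat.add_eq_zero_iff, Finset.card_eq_zero, Finset.filter_eq_empty_iff]
    refine ⟨fun i _ h => ?_, fun i _ h => ?_⟩
    · have := hb i h.1; omega
    · have := ha i h.1; omega
  refine ⟨P', fun i => ⟨?_, ?_⟩, hE, ?_⟩
  · have hinl : Function.Injective (Sum.inl : Fin I.m → Fin I.m ⊕ Fin I.k) := Sum.inl_injective
    have hinr : Function.Injective (Sum.inr : Fin I.k → Fin I.m ⊕ Fin I.k) := Sum.inr_injective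
    refine List.Nodup.append (List.Nodup.append ((hwn i).map hinr) ((I.isProfile i).1.map hinl)
      ?_) (((List.nodup_finRange _).filter _).map hinr) ?_
    · intro z hz hz'
      simp only [List.mem_map] at hz hz'
      obtain ⟨y, _, rfl⟩ := hz
      obtain ⟨x, _, h⟩ := hz'
      cases h
    · intro z hz hz'
      simp only [List.mem_append, List.mem_map, List.mem_filter, List.mem_finRange, true_and,
        decide_eq_true_eq] at hz hz'
      obtain ⟨y, hy, rfl⟩ := hz'
      rcases hz with ⟨y', hy', h⟩ | ⟨x, _, h⟩
      · cases h
        exact hy hy'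
      · cases h
  · rintro (x | y)
    · simp [hP', (I.isProfile i).2 x]
    · by_cases hy : y ∈ w i <;> simp [hP', hy]
  · have h5 := hscore I.xstar
    rintro (x | y)
    · have h3 := hscore x
      have h4 := hl x
      unfold excess at h4
      omega
    · rw [hxs, add_zero] at h5
      rw [h5, approvalScore_two]
      have h6 : ∀ i, approvals (P' i) (Sum.inr y) =
          Nat.count (fun e => (∑ j ∈ Finset.range i, c' j + e) % I.k = y) (c' i) := by
        intro i
        obtain ⟨l, hl⟩ := profile_eq I h2 i
        have h4 := hc2 i
        rw [hcc i]
        simp only [hP', hl]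
        rw [approvals_append_inr ((hwl i).trans_le h4)]
        simp only [hw]
        obtain h | h | h : c i = 0 ∨ c i = 1 ∨ c i = 2 := by omega
        · rw [h]; simp [approvals]
        · rw [h]; simp [approvals, Nat.count_succ, Fin.ext_iff]
        · rw [h]; simp [approvals, Nat.count_succ, List.range_succ, Fin.ext_iff]
      simp only [h6]
      rw [Fin.sum_univ_eq_sum_range (fun i => Nat.count
        (fun e => (∑ j ∈ Finset.range i, c' j + e) % I.k = y) (c' i)),
        sum_count_blocks c' (fun t => t % I.k = y)]
      refine count_mod_le I.k_pos ?_ y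
      rw [← Fin.sum_univ_eq_sum_range]
      simpa only [hcc] using hs

/-- The only initial candidate is put on top of every vote; nobody can have more than one approval
per vote. -/
theorem possibleCowinner_of_one {I : Instance} (h1 : I.m < 2) : PossibleCowinner 2 I := by
  have hm : I.m = 1 := by have := I.xstar.2; omega
  have hsub : ∀ x y : Fin I.m, x = y := fun x y => by
    apply Fin.ext
    have := x.2; have := y.2
    omega
  have hp : ∀ i, I.profile i = [I.xstar] := fun i => by
    have := length_profile I i
    replace this := List.length_eq_one_iff.1 (this.trans hm)
    obtain ⟨a, ha⟩ := this
    rw [ha, hsub a I.xstar]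
  have happ : ∀ d : Fin I.m ⊕ Fin I.k,
      approvals (Sum.inl I.xstar :: (List.finRange I.k).map Sum.inr) d ≤ 1 := by
    have h := List.nodup_finRange I.k
    rcases List.finRange I.k with _ | ⟨y, l⟩
    · rintro (d | d) <;> simp [approvals]
      split_ifs <;> omega
    · rintro (d | d) <;> simp [approvals] <;> split_ifs <;> omega
  refine ⟨fun _ => Sum.inl I.xstar :: (List.finRange I.k).map Sum.inr, fun i => ⟨?_, ?_⟩,
    fun i => ?_, fun d => ?_⟩
  · rw [List.nodup_cons]
    exact ⟨by simp, (List.nodup_finRange _).map Sum.inr_injective⟩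
  · rintro (x | y)
    · simp [hsub x I.xstar]
    · simp
  · rw [hp]
    simp [projection]
  · simp only [approvalScore_two]
    refine Finset.sum_le_sum fun i _ => (happ d).trans ?_
    simp [approvals]

theorem excess_of_one {I : Instance} (h1 : I.m < 2) (x : Fin I.m) :
    excess (first I) (second I) I.xstar x = 0 := by
  have : x = I.xstar := by
    apply Fin.ext
    have := x.2; have := I.xstar.2
    omega
  rw [this, excess_self]

theorem crit_of_excess_zero {ι κ : Type} [Fintype ι] [DecidableEq ι] [DecidableEq κ] [Fintype κ]
    {a b : ι → κ} {xs : κ} (h : ∀ x, excess a b xs x = 0) (k : ℕ) : Crit a b xs k := by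
  refine ⟨∅, ⟨by simp, by simp⟩, ?_⟩
  simp [capTop, h]

/-- The bound on `k` enters only to fit up to two different new candidates into one vote. -/
theorem possibleCowinner_iff_crit (I : Instance) (hk : 2 ≤ I.k) :
    PossibleCowinner 2 I ↔ Crit (first I) (second I) I.xstar I.k := by
  by_cases h2 : 2 ≤ I.m
  · constructor
    · intro h
      obtain ⟨c, -, h3, h4⟩ := insertions_of_possibleCowinner h2 h
      exact crit_of_insertions h3 h4
    · intro h
      obtain ⟨c, h3, h4, h5, h6, h7⟩ := insertions_of_crit h
      exact possibleCowinner_of_insertions h2 c h3 (fun i => (h3 i).trans hk) h4 h5 h6 h7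
  · rw [not_le] at h2
    exact ⟨fun _ => crit_of_excess_zero (excess_of_one h2) _, fun _ => possibleCowinner_of_one h2⟩

theorem possibleCowinner_iff_critOne (I : Instance) (hk : I.k = 1) :
    PossibleCowinner 2 I ↔ CritOne (first I) (second I) I.xstar := by
  by_cases h2 : 2 ≤ I.m
  · constructor
    · intro h
      obtain ⟨c, h1, h3, h4⟩ := insertions_of_possibleCowinner h2 h
      rw [hk, one_mul] at h4
      exact critOne_of_insertions (h1 hk) (fun x hx => (Nat.le_add_right _ _).trans (h3 x hx)) h4
    · intro h
      obtain ⟨c, h3, h4, h5, h6⟩ := insertions_of_critOne h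
      refine possibleCowinner_of_insertions h2 c (fun i => (h3 i).trans one_le_two)
        (fun i => hk ▸ h3 i) h4 (fun i _ => h3 i) h5 ?_
      rwa [hk, one_mul]
  · rw [not_le] at h2
    refine ⟨fun _ => ⟨fun x => ?_, ?_⟩, fun _ => possibleCowinner_of_one h2⟩
    · rw [excess_of_one h2]; exact Nat.zero_le _
    · simp [excess_of_one h2]

/-! ### The sets of the algorithm -/

section Sets

variable {I : Instance}

theorem initWork_eq (h2 : 2 ≤ I.m) (i : Fin I.n) :
    ∃ l, initWork I i = Sum.inl (first I i) :: Sum.inl (second I i) :: l := by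
  obtain ⟨l, hl⟩ := profile_eq I h2 i
  exact ⟨l.map Sum.inl, by simp [initWork, hl]⟩

theorem initWork_zero (h2 : 2 ≤ I.m) (i : Fin I.n) :
    (initWork I i)[0]? = some (Sum.inl (first I i)) := by
  obtain ⟨l, hl⟩ := initWork_eq h2 i
  simp [hl]

theorem initWork_one (h2 : 2 ≤ I.m) (i : Fin I.n) :
    (initWork I i)[1]? = some (Sum.inl (second I i)) := by
  obtain ⟨l, hl⟩ := initWork_eq h2 i
  simp [hl]

theorem approvalScore_initWork_inl (h2 : 2 ≤ I.m) (x : Fin I.m) :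
    approvalScore 2 (initWork I) (Sum.inl x) = topScore (first I) (second I) x := by
  simp only [approvalScore_two, approvals, initWork_zero h2, initWork_one h2, topScore,
    Finset.card_filter, Finset.sum_add_distrib, Option.some.injEq, Sum.inl.injEq]

theorem approvalScore_initWork_inr (y : Fin I.k) :
    approvalScore 2 (initWork I) (Sum.inr y) = 0 := by
  simp [approvalScore_two, approvals, initWork]

theorem delta_initWork (h2 : 2 ≤ I.m) (x : Fin I.m) :
    delta I (initWork I) (Sum.inl x) =
      (topScore (first I) (second I) x : ℤ) - topScore (first I) (second I) I.xstar := by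
  simp only [delta, approvalScore_initWork_inl h2]

theorem inHP_initWork (h2 : 2 ≤ I.m) (x : Fin I.m) (i : Fin I.n) :
    InHP I (initWork I) x i ↔ second I i = x ∧ first I i ≠ I.xstar := by
  simp [InHP, initWork_zero h2, initWork_one h2]

theorem length_filter_finRange {n : ℕ} (Q : Fin n → Prop) [DecidablePred Q] :
    ((List.finRange n).filter fun i => decide (Q i)).length =
      (Finset.univ.filter Q).card := by
  rw [← List.toFinset_card_of_nodup ((List.nodup_finRange n).filter _)]
  congr 1
  ext i
  simp

theorem length_HP_initWork (h2 : 2 ≤ I.m) (x : Fin I.m) :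
    (HP I (initWork I) x).length = highCount (first I) (second I) I.xstar x := by
  rw [HP, length_filter_finRange, highCount]
  simp only [inHP_initWork h2]

theorem mem_Xbullet (h2 : 2 ≤ I.m) (x : Fin I.m) :
    x ∈ Xbullet I ↔ 0 < excess (first I) (second I) I.xstar x := by
  rw [Xbullet, Finset.mem_filter, delta_initWork h2]
  simp only [Finset.mem_univ, true_and, excess]
  omega

theorem mem_X₁ (h2 : 2 ≤ I.m) (x : Fin I.m) :
    x ∈ X₁ I ↔ Early (first I) (second I) I.xstar x := by
  rw [X₁, Finset.mem_filter, mem_Xbullet h2, length_HP_initWork h2, delta_initWork h2, Early]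
  simp only [excess]
  omega

theorem mem_X₂ (h2 : 2 ≤ I.m) (x : Fin I.m) :
    x ∈ X₂ I ↔ Late (first I) (second I) I.xstar x := by
  rw [X₂, Finset.mem_filter, mem_Xbullet h2, length_HP_initWork h2, delta_initWork h2, Late]
  simp only [excess]
  omega

theorem not_late_xstar : ¬ Late (first I) (second I) I.xstar I.xstar := fun h => by
  have := h.1
  rw [excess_self] at this
  omega

theorem not_early_xstar : ¬ Early (first I) (second I) I.xstar I.xstar := fun h => by
  have := h.1
  rw [excess_self] at this
  omega

theorem mem_X₂list (h2 : 2 ≤ I.m) (x : Fin I.m) :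
    x ∈ X₂list I ↔ Late (first I) (second I) I.xstar x := by
  simp [X₂list, mem_X₂ h2]

theorem nodup_X₂list : (X₂list I).Nodup := (List.nodup_finRange _).filter _

end Sets

/-! ### Insertions into the working profile -/

section Insertions

variable {I : Instance}

/-- As `k ≥ 1`, a new candidate of least score exists, so the default branch of the insertion never
occurs. -/
theorem addNewOnTop_spec (P : Work I) (i : Fin I.n) :
    ∃ y, (∀ y', approvalScore 2 P (Sum.inr y) ≤ approvalScore 2 P (Sum.inr y')) ∧
      addNewOnTop I P i = Function.update P i (Sum.inr y :: P i) := by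
  have hne : (Finset.univ : Finset (Fin I.k)).Nonempty := ⟨⟨0, I.k_pos⟩, Finset.mem_univ _⟩
  obtain ⟨y₀, -, hy₀⟩ := Finset.exists_min_image Finset.univ
    (fun y => approvalScore 2 P (Sum.inr y)) hne
  have : (lowestNew I P).isSome := by
    rw [lowestNew, List.find?_isSome]
    refine ⟨y₀, List.mem_finRange _, ?_⟩
    refine decide_eq_true fun y' => ?_
    have := hy₀ y' (Finset.mem_univ _)
    unfold delta
    omega
  obtain ⟨y, hy⟩ := Option.isSome_iff_exists.1 this
  refine ⟨y, fun y' => ?_, by rw [addNewOnTop, hy]⟩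
  unfold lowestNew at hy
  have h := List.find?_some hy
  have := of_decide_eq_true h y'
  unfold delta at this
  omega

/-- The old first candidate slides to second place and stays approved; only the old second candidate
loses. -/
theorem approvalScore_update_cons {C : Type} [DecidableEq C] {n : ℕ} (P : Fin n → List C)
    (i : Fin n) (z c : C) :
    approvalScore 2 (Function.update P i (z :: P i)) c +
      (if (P i)[1]? = some c then 1 else 0) =
    approvalScore 2 P c + (if z = c then 1 else 0) := by
  simp only [approvalScore_two]
  rw [← Finset.add_sum_erase _ _ (Finset.mem_univ i), ← Finset.add_sum_erase (a := i) _
    (fun i => approvals (P i) c) (Finset.mem_univ i)]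
  rw [Finset.sum_congr rfl (g := fun j => approvals (P j) c) fun j hj => by
    rw [Function.update_of_ne (Finset.ne_of_mem_erase hj)]]
  simp only [Function.update_self, approvals, List.getElem?_cons_zero, List.getElem?_cons_succ,
    Option.some.injEq]
  omega

/-- What holds throughout phases 1 and 2. -/
structure Inv (S : Vars I) : Prop where
  sum_new : ∑ y, approvalScore 2 S.P (Sum.inr y) = S.T
  balanced : ∀ y y', approvalScore 2 S.P (Sum.inr y) ≤ approvalScore 2 S.P (Sum.inr y') + 1
  fixed : ∀ z, ¬ Late (first I) (second I) I.xstar z →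
    approvalScore 2 S.P (Sum.inl z) = topScore (first I) (second I) z
  total : S.T + ∑ x ∈ X₂ I, approvalScore 2 S.P (Sum.inl x) =
    ∑ x ∈ X₂ I, topScore (first I) (second I) x

theorem Inv.delta_inl {S : Vars I} (h : Inv S) (x : Fin I.m) :
    delta I S.P (Sum.inl x) = (approvalScore 2 S.P (Sum.inl x) : ℤ) -
      topScore (first I) (second I) I.xstar := by
  rw [delta, h.fixed _ not_late_xstar]

theorem inv_init (h2 : 2 ≤ I.m) : Inv (⟨initWork I, 0, ∅⟩ : Vars I) where
  sum_new := by simp [approvalScore_initWork_inr]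
  balanced := by simp [approvalScore_initWork_inr]
  fixed := fun z _ => approvalScore_initWork_inl h2 z
  total := by simp [approvalScore_initWork_inl h2]

/-- Raising a new candidate of least score keeps the new scores within one of each other. The sum
over `X₂` drops by exactly the one counted in `T`. -/
theorem insertStep_spec (h2 : 2 ≤ I.m) {S : Vars I} (h : Inv S) {x : Fin I.m} {i : Fin I.n}
    (hx : Late (first I) (second I) I.xstar x) (hi : (S.P i)[1]? = some (Sum.inl x)) :
    Inv (insertStep I S i) ∧
      approvalScore 2 (insertStep I S i).P (Sum.inl x) + 1 = approvalScore 2 S.P (Sum.inl x) ∧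
      (∀ z, z ≠ x →
        approvalScore 2 (insertStep I S i).P (Sum.inl z) = approvalScore 2 S.P (Sum.inl z)) ∧
      (∃ y, (insertStep I S i).P i = Sum.inr y :: S.P i) ∧
      ∀ j, j ≠ i → (insertStep I S i).P j = S.P j := by
  obtain ⟨y, hy, hP⟩ := addNewOnTop_spec S.P i
  have key := approvalScore_update_cons S.P i (Sum.inr y)
  rw [← hP, hi] at key
  have hP' : (insertStep I S i).P = addNewOnTop I S.P i := rfl
  have hT : (insertStep I S i).T = S.T + 1 := rfl
  have kx := key (Sum.inl x)
  simp only [if_true, reduceCtorEq, if_false] at kx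
  have kz : ∀ z, z ≠ x → approvalScore 2 (addNewOnTop I S.P i) (Sum.inl z) =
      approvalScore 2 S.P (Sum.inl z) := fun z hz => by
    have := key (Sum.inl z)
    simp only [Option.some.injEq, Sum.inl.injEq, hz.symm, if_false, reduceCtorEq] at this
    exact this
  have ky : ∀ y', approvalScore 2 (addNewOnTop I S.P i) (Sum.inr y') =
      approvalScore 2 S.P (Sum.inr y') + if y = y' then 1 else 0 := fun y' => by
    have := key (Sum.inr y')
    simp only [Option.some.injEq, Sum.inr.injEq, reduceCtorEq, if_false] at this
    exact this
  rw [hP']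
  refine ⟨⟨?_, ?_, ?_, ?_⟩, kx, kz, ⟨y, ?_⟩, fun j hj => ?_⟩
  · rw [hP', hT, ← h.sum_new]
    simp only [ky, Finset.sum_add_distrib]
    simp
  · intro u v
    rw [hP', ky, ky]
    have h1 := h.balanced u v
    have h3 := hy v
    by_cases hu : y = u
    · subst hu
      split_ifs <;> omega
    · rw [if_neg hu]
      split_ifs <;> omega
  · intro z hz
    rw [hP', kz z (fun h => hz (h ▸ hx)), h.fixed z hz]
  · rw [hP', hT, ← h.total]
    have hxm : x ∈ X₂ I := (mem_X₂ h2 x).2 hx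
    rw [← Finset.add_sum_erase _ _ hxm, ← Finset.add_sum_erase (a := x) _
      (fun z => approvalScore 2 S.P (Sum.inl z)) hxm,
      Finset.sum_congr rfl fun z hz => kz z (Finset.ne_of_mem_erase hz)]
    omega
  · rw [hP, Function.update_self]
  · rw [hP, Function.update_of_ne hj]

theorem foldl_insertStep_spec (h2 : 2 ≤ I.m) {x : Fin I.m}
    (hx : Late (first I) (second I) I.xstar x) (l : List (Fin I.n)) :
    ∀ (S : Vars I), Inv S → l.Nodup → (∀ i ∈ l, (S.P i)[1]? = some (Sum.inl x)) →
    Inv (l.foldl (insertStep I) S) ∧ (l.foldl (insertStep I) S).REM = S.REM ∧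
      approvalScore 2 (l.foldl (insertStep I) S).P (Sum.inl x) + l.length =
        approvalScore 2 S.P (Sum.inl x) ∧
      (∀ z, z ≠ x → approvalScore 2 (l.foldl (insertStep I) S).P (Sum.inl z) =
        approvalScore 2 S.P (Sum.inl z)) ∧
      ∀ i, (i ∉ l → (l.foldl (insertStep I) S).P i = S.P i) ∧
        (i ∈ l → ∃ y, (l.foldl (insertStep I) S).P i = Sum.inr y :: S.P i) := by
  induction l with
  | nil => intro S h _ _; simp [h]
  | cons j l ih =>
    intro S h hn hl
    rw [List.nodup_cons] at hn
    obtain ⟨h1, h3, h4, ⟨y, h5⟩, h6⟩ := insertStep_spec h2 h hx (hl j (by simp))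
    have hne : ∀ i ∈ l, i ≠ j := fun i hi hij => hn.1 (hij ▸ hi)
    obtain ⟨g1, g2, g3, g4, g5⟩ := ih _ h1 hn.2 (fun i hi => by
      rw [h6 i (hne i hi)]
      exact hl i (by simp [hi]))
    simp only [List.foldl_cons]
    refine ⟨g1, g2, ?_, fun z hz => (g4 z hz).trans (h4 z hz), fun i => ⟨fun hi => ?_, fun hi => ?_⟩⟩
    · simp only [List.length_cons]; omega
    · rw [List.mem_cons, not_or] at hi
      rw [(g5 i).1 hi.2, h6 i hi.1]
    · by_cases hij : i = j
      · subst hij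
        exact ⟨y, by rw [(g5 i).1 hn.1, h5]⟩
      · obtain ⟨y', hy'⟩ := (g5 i).2 ((List.mem_cons.1 hi).resolve_left hij)
        exact ⟨y', by rw [hy', h6 i hij]⟩

/-! ### Phase 1: high priority votes -/

/-- The state of phase 1 when the candidates of `l` have been treated. -/
structure AfterHigh (l : List (Fin I.m)) (S : Vars I) : Prop where
  inv : Inv S
  rem : S.REM = ∅
  score : ∀ x ∈ l, approvalScore 2 S.P (Sum.inl x) + highCount (first I) (second I) I.xstar x =
    topScore (first I) (second I) x
  score' : ∀ x ∉ l, approvalScore 2 S.P (Sum.inl x) = topScore (first I) (second I) x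
  vote : ∀ i, second I i ∈ l → first I i ≠ I.xstar → ∃ y, S.P i = Sum.inr y :: initWork I i
  vote' : ∀ i, ¬ (second I i ∈ l ∧ first I i ≠ I.xstar) → S.P i = initWork I i

/-- The order of treatment is irrelevant: a vote that has received an insertion has a new candidate
on top, so it is nobody's high priority vote any more, and it was not one of `x` before. -/
theorem afterHigh_foldl (h2 : 2 ≤ I.m) (l : List (Fin I.m)) (hn : l.Nodup)
    (hl : ∀ x ∈ l, Late (first I) (second I) I.xstar x) :
    AfterHigh l (l.foldl (fun S x => (HP I S.P x).foldl (fun S' i => insertStep I S' i) S)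
      (⟨initWork I, 0, ∅⟩ : Vars I)) := by
  induction l using List.reverseRecOn with
  | nil =>
    exact ⟨inv_init h2, rfl, by simp, fun x _ => approvalScore_initWork_inl h2 x, by simp,
      fun _ _ => rfl⟩
  | append_singleton l x ih =>
    rw [List.nodup_append] at hn
    have hxl : x ∉ l := fun h => hn.2.2 x h x (by simp) rfl
    have ih := ih hn.1 (fun z hz => hl z (by simp [hz]))
    have hx := hl x (by simp)
    rw [List.foldl_append, List.foldl_cons, List.foldl_nil]
    set S := l.foldl (fun S x => (HP I S.P x).foldl (fun S' i => insertStep I S' i) S)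
      (⟨initWork I, 0, ∅⟩ : Vars I) with hS
    have hHP : ∀ i, InHP I S.P x i ↔ second I i = x ∧ first I i ≠ I.xstar := by
      intro i
      by_cases hi : second I i ∈ l ∧ first I i ≠ I.xstar
      · obtain ⟨y, hy⟩ := ih.vote i hi.1 hi.2
        simp only [InHP, hy, List.getElem?_cons_zero, Option.some.injEq, reduceCtorEq, and_false,
          exists_false, false_iff, not_and]
        rintro rfl
        exact absurd hi.1 hxl
      · rw [← inHP_initWork h2, InHP, InHP, ih.vote' i hi]
    have hmem : ∀ i, i ∈ HP I S.P x ↔ second I i = x ∧ first I i ≠ I.xstar := fun i => by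
      simp [HP, hHP]
    have hlen : (HP I S.P x).length = highCount (first I) (second I) I.xstar x := by
      rw [HP, length_filter_finRange, highCount]
      simp only [hHP]
    obtain ⟨g1, g2, g3, g4, g5⟩ := foldl_insertStep_spec h2 hx (HP I S.P x) S ih.inv
      ((List.nodup_finRange _).filter _) (fun i hi => by
        have := List.mem_filter.1 hi
        simp only [decide_eq_true_eq] at this
        exact this.2.1)
    refine ⟨g1, g2.trans ih.rem, fun z hz => ?_, fun z hz => ?_, fun i hi hi' => ?_,
      fun i hi => ?_⟩
    · by_cases hzx : z = x
      · rw [hzx, ← hlen, g3, ih.score' x hxl]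
      · rw [g4 z hzx]
        exact ih.score z (by simpa [hzx] using hz)
    · rw [List.mem_append, not_or, List.mem_singleton] at hz
      rw [g4 z hz.2, ih.score' z hz.1]
    · by_cases hix : second I i = x
      · obtain ⟨y, hy⟩ := (g5 i).2 ((hmem i).2 ⟨hix, hi'⟩)
        refine ⟨y, hy.trans ?_⟩
        rw [ih.vote' i fun h => hxl (hix ▸ h.1)]
      · rw [(g5 i).1 fun h => hix ((hmem i).1 h).1]
        exact ih.vote i (by simpa [hix] using hi) hi'
    · rw [(g5 i).1 fun h => hi ⟨by simp [((hmem i).1 h).1], ((hmem i).1 h).2⟩]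
      exact ih.vote' i fun h => hi ⟨by simp [h.1], h.2⟩

theorem afterHigh_phase1 (h2 : 2 ≤ I.m) : AfterHigh (X₂list I) (phase1 I) :=
  afterHigh_foldl h2 _ nodup_X₂list fun x hx => (mem_X₂list h2 x).1 hx

/-- Besides the original votes under x*, `x` gains the votes in which it stood above a late
candidate, since phase 1 has put a new candidate on top of all of these. -/
theorem inMP_phase1 (h2 : 2 ≤ I.m) {x : Fin I.m} (hx : Late (first I) (second I) I.xstar x)
    (i : Fin I.n) : InMP I (phase1 I).P x i ↔
      (second I i = x ∧ first I i = I.xstar) ∨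
      (first I i = x ∧ Late (first I) (second I) I.xstar (second I i)) := by
  have H := afterHigh_phase1 h2
  have hxs : x ≠ I.xstar := fun h => not_late_xstar (h ▸ hx)
  by_cases hi : second I i ∈ X₂list I ∧ first I i ≠ I.xstar
  · obtain ⟨y, hy⟩ := H.vote i hi.1 hi.2
    have := (mem_X₂list h2 _).1 hi.1
    simp [InMP, hy, initWork_zero h2, hi.2, this]
  · rw [InMP, H.vote' i hi, initWork_zero h2, initWork_one h2]
    rw [mem_X₂list h2] at hi
    simp only [Option.some.injEq, Sum.inl.injEq, reduceCtorEq, exists_false, or_false]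
    constructor
    · exact Or.inl
    · rintro (h | ⟨h1, h3⟩)
      · exact h
      · exact absurd ⟨h3, fun h => hxs (h1.symm.trans h)⟩ hi

theorem length_MP_phase1 (h2 : 2 ≤ I.m) {x : Fin I.m}
    (hx : Late (first I) (second I) I.xstar x) :
    (MP I (phase1 I).P x).length + highCount (first I) (second I) I.xstar x =
      (Finset.univ.filter fun i => second I i = x).card +
      (Finset.univ.filter fun i => first I i = x ∧
        Late (first I) (second I) I.xstar (second I i)).card := by
  rw [MP, length_filter_finRange]
  simp only [inMP_phase1 h2 hx]
  simp only [highCount, Finset.card_filter, ← Finset.sum_add_distrib]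
  refine Finset.sum_congr rfl fun i _ => ?_
  have hxs : x ≠ I.xstar := fun h => not_late_xstar (h ▸ hx)
  by_cases h1 : first I i = I.xstar
  · by_cases h3 : second I i = x <;> simp [h1, h3, hxs.symm]
  · by_cases h3 : first I i = x
    · have h4 : second I i ≠ x := fun h => first_ne_second I h2 i (h3.trans h.symm)
      simp [h3, h4]
    · by_cases h4 : second I i = x <;> simp [h1, h3, h4]

/-! ### Phase 2: medium priority votes -/

/-- The body of phase 2. -/
def mediumStep (x : Fin I.m) (S : Vars I) (i : Fin I.n) : Vars I :=
  if 0 < delta I S.P (Sum.inl x) then insertStep I S i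
  else { S with REM := insert x S.REM }

/-- Each vote lowers Δ by one until it is zero and nothing changes afterwards, whence the maximum. A
candidate is marked only when its Δ is zero. -/
theorem foldl_mediumStep_spec (h2 : 2 ≤ I.m) {x : Fin I.m}
    (hx : Late (first I) (second I) I.xstar x) (l : List (Fin I.n)) :
    ∀ (S : Vars I), Inv S → l.Nodup → (∀ i ∈ l, (S.P i)[1]? = some (Sum.inl x)) →
      0 ≤ delta I S.P (Sum.inl x) →
    Inv (l.foldl (mediumStep x) S) ∧
      ((l.foldl (mediumStep x) S).REM = S.REM ∨ (l.foldl (mediumStep x) S).REM = insert x S.REM ∧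
        delta I (l.foldl (mediumStep x) S).P (Sum.inl x) = 0) ∧
      delta I (l.foldl (mediumStep x) S).P (Sum.inl x) =
        max 0 (delta I S.P (Sum.inl x) - l.length) ∧
      (∀ z, z ≠ x → approvalScore 2 (l.foldl (mediumStep x) S).P (Sum.inl z) =
        approvalScore 2 S.P (Sum.inl z)) ∧
      ∀ i, (l.foldl (mediumStep x) S).P i = S.P i ∨
        i ∈ l ∧ ∃ y, (l.foldl (mediumStep x) S).P i = Sum.inr y :: S.P i := by
  induction l with
  | nil => intro S h _ _ h0; simp [h, h0]
  | cons j l ih =>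
    intro S h hn hl h0
    rw [List.nodup_cons] at hn
    have hne : ∀ i ∈ l, i ≠ j := fun i hi hij => hn.1 (hij ▸ hi)
    rw [List.foldl_cons]
    by_cases hd : 0 < delta I S.P (Sum.inl x)
    · obtain ⟨h1, h3, h4, ⟨y, h5⟩, h6⟩ := insertStep_spec h2 h hx (hl j (by simp))
      have hdelta : delta I (insertStep I S j).P (Sum.inl x) = delta I S.P (Sum.inl x) - 1 := by
        rw [h1.delta_inl, h.delta_inl]; omega
      rw [mediumStep, if_pos hd]
      obtain ⟨g1, g2, g3, g4, g5⟩ := ih _ h1 hn.2 (fun i hi => by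
        rw [h6 i (hne i hi)]
        exact hl i (by simp [hi])) (by omega)
      refine ⟨g1, g2, ?_, fun z hz => (g4 z hz).trans (h4 z hz), fun i => ?_⟩
      · rw [g3, hdelta, List.length_cons]; push_cast; congr 1; ring
      · by_cases hij : i = j
        · subst hij
          right
          refine ⟨by simp, y, ?_⟩
          rcases g5 i with g | g
          · rw [g, h5]
          · exact absurd g.1 hn.1
        · have h7 := g5 i
          rw [h6 i hij] at h7
          rcases h7 with g | g
          · exact Or.inl g
          · exact Or.inr ⟨by simp [g.1], g.2⟩
    · rw [mediumStep, if_neg hd]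
      have hS : Inv ({ S with REM := insert x S.REM } : Vars I) := ⟨h.1, h.2, h.3, h.4⟩
      obtain ⟨g1, g2, g3, g4, g5⟩ := ih _ hS hn.2 (fun i hi => hl i (by simp [hi])) h0
      have g3' : delta I (l.foldl (mediumStep x)
          ({ S with REM := insert x S.REM } : Vars I)).P (Sum.inl x) = 0 := by
        rw [g3]
        exact max_eq_left (by change delta I S.P (Sum.inl x) - _ ≤ 0; omega)
      refine ⟨g1, Or.inr ⟨?_, g3'⟩, ?_, g4, fun i => ?_⟩
      · rcases g2 with g | g
        · exact g
        · rw [g.1]; exact Finset.insert_eq_of_mem (Finset.mem_insert_self _ _)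
      · rw [g3']
        exact (max_eq_left (by simp only [List.length_cons]; push_cast; omega)).symm
      · rcases g5 i with g | g
        · exact Or.inl g
        · exact Or.inr ⟨by simp [g.1], g.2⟩

/-- The state of phase 2 when the candidates of `l` have been treated. -/
structure AfterMedium (l : List (Fin I.m)) (S : Vars I) : Prop where
  inv : Inv S
  rem : ∀ x ∈ S.REM, capTop (first I) (second I) I.xstar x = 0
  score : ∀ x ∈ l, delta I S.P (Sum.inl x) = capTop (first I) (second I) I.xstar x
  score' : ∀ x ∉ l, approvalScore 2 S.P (Sum.inl x) = approvalScore 2 (phase1 I).P (Sum.inl x)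
  vote : ∀ i, S.P i = (phase1 I).P i ∨
    ∃ x ∈ l, InMP I (phase1 I).P x i ∧ ∃ y, S.P i = Sum.inr y :: (phase1 I).P i

/-- A vote treated for an earlier candidate was not a medium priority vote of `x`, and now has x* or
a new candidate in second place, so it is not one either. Hence the medium votes of `x` are still
those after phase 1. -/
theorem afterMedium_foldl (h2 : 2 ≤ I.m) (l : List (Fin I.m)) (hn : l.Nodup)
    (hl : ∀ x ∈ l, Late (first I) (second I) I.xstar x) :
    AfterMedium l (l.foldl (fun S x => (MP I S.P x).foldl (mediumStep x) S) (phase1 I)) := by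
  have H := afterHigh_phase1 h2
  induction l using List.reverseRecOn with
  | nil =>
    exact ⟨H.inv, by simp [H.rem], by simp, fun _ _ => rfl, fun _ => Or.inl rfl⟩
  | append_singleton l x ih =>
    rw [List.nodup_append] at hn
    have hxl : x ∉ l := fun h => hn.2.2 x h x (by simp) rfl
    have ih := ih hn.1 (fun z hz => hl z (by simp [hz]))
    have hx := hl x (by simp)
    have hxs : x ≠ I.xstar := fun h => not_late_xstar (h ▸ hx)
    rw [List.foldl_append, List.foldl_cons, List.foldl_nil]
    set S := l.foldl (fun S x => (MP I S.P x).foldl (mediumStep x) S) (phase1 I) with hS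
    have hMP : ∀ i, InMP I S.P x i ↔ InMP I (phase1 I).P x i := by
      intro i
      rcases ih.vote i with h | ⟨z, hz, hzi, y, hy⟩
      · rw [InMP, InMP, h]
      · constructor
        · rintro ⟨h1, -⟩
          rw [hy, List.getElem?_cons_succ] at h1
          rcases hzi.2 with h3 | ⟨y', h3⟩
          · rw [h3] at h1
            simp only [Option.some.injEq, Sum.inl.injEq] at h1
            exact absurd h1.symm hxs
          · rw [h3] at h1
            simp at h1
        · rintro ⟨h1, -⟩
          rw [hzi.1] at h1
          simp only [Option.some.injEq, Sum.inl.injEq] at h1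
          exact absurd (h1 ▸ hz) hxl
    have hMP' : MP I S.P x = MP I (phase1 I).P x := by
      simp only [MP, hMP]
    have hmem : ∀ i ∈ MP I S.P x, InMP I S.P x i := fun i hi => by
      have := List.mem_filter.1 hi
      simpa using this.2
    have hlen := length_MP_phase1 h2 hx
    have hsc := H.score x ((mem_X₂list h2 x).2 hx)
    have hd : delta I S.P (Sum.inl x) = (excess (first I) (second I) I.xstar x : ℤ) -
        highCount (first I) (second I) I.xstar x := by
      have := hx.1
      rw [ih.inv.delta_inl, ih.score' x hxl]
      unfold excess at this ⊢
      omega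
    have hx2 := hx.2
    obtain ⟨g1, g2, g3, g4, g5⟩ := foldl_mediumStep_spec h2 hx (MP I S.P x) S ih.inv
      ((List.nodup_finRange _).filter _) (fun i hi => (hmem i hi).1) (by omega)
    -- The maximum with zero is the truncated subtraction in `capTop`.
    have g3' : delta I ((MP I S.P x).foldl (mediumStep x) S).P (Sum.inl x) =
        capTop (first I) (second I) I.xstar x := by
      rw [g3, hd, hMP', capTop, if_pos hx]
      omega
    refine ⟨g1, fun z hz => ?_, fun z hz => ?_, fun z hz => ?_, fun i => ?_⟩
    · rcases g2 with g | g
      · exact ih.rem z (g ▸ hz)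
      · rw [g.1, Finset.mem_insert] at hz
        rcases hz with rfl | hz
        · have := g.2
          rw [g3'] at this
          exact_mod_cast this
        · exact ih.rem z hz
    · by_cases hzx : z = x
      · rw [hzx, g3']
      · rw [← ih.score z (by simpa [hzx] using hz), g1.delta_inl, ih.inv.delta_inl, g4 z hzx]
    · rw [List.mem_append, not_or, List.mem_singleton] at hz
      rw [g4 z hz.2, ih.score' z hz.1]
    · rcases g5 i with g | ⟨gi, y, hy⟩
      · rw [g]
        rcases ih.vote i with h | ⟨z, hz, h⟩
        · exact Or.inl h
        · exact Or.inr ⟨z, by simp [hz], h⟩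
      · have hi := (hMP i).1 (hmem i gi)
        refine Or.inr ⟨x, by simp, hi, y, ?_⟩
        rw [hy]
        rcases ih.vote i with h | ⟨z, hz, hzi, -⟩
        · rw [h]
        · have := hzi.1.symm.trans hi.1
          simp only [Option.some.injEq, Sum.inl.injEq] at this
          exact absurd (this ▸ hz) hxl

theorem afterMedium_phase2 (h2 : 2 ≤ I.m) : AfterMedium (X₂list I) (phase2 I) :=
  afterMedium_foldl h2 _ nodup_X₂list fun x hx => (mem_X₂list h2 x).1 hx

/-- Every changed vote has a new candidate on top and so is nobody's low priority vote; votes over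
an early second candidate are unchanged. -/
theorem phase2_vote (h2 : 2 ≤ I.m) (i : Fin I.n) :
    (phase2 I).P i = initWork I i ∨ Late (first I) (second I) I.xstar (second I i) ∧
      ∃ y l, (phase2 I).P i = Sum.inr y :: l := by
  have H1 := afterHigh_phase1 h2
  have H2 := afterMedium_phase2 h2
  have h1 : (phase1 I).P i = initWork I i ∨ Late (first I) (second I) I.xstar (second I i) ∧
      ∃ y l, (phase1 I).P i = Sum.inr y :: l := by
    by_cases hi : second I i ∈ X₂list I ∧ first I i ≠ I.xstar
    · obtain ⟨y, hy⟩ := H1.vote i hi.1 hi.2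
      exact Or.inr ⟨(mem_X₂list h2 _).1 hi.1, y, _, hy⟩
    · exact Or.inl (H1.vote' i hi)
  rcases H2.vote i with h | ⟨x, hx, hxi, y, hy⟩
  · rwa [h]
  · refine Or.inr ⟨?_, y, _, hy⟩
    have hxL := (mem_X₂list h2 x).1 hx
    rcases (inMP_phase1 h2 hxL i).1 hxi with h | h
    · rw [h.1]; exact hxL
    · exact h.2

theorem delta_phase2_early (h2 : 2 ≤ I.m) {x : Fin I.m}
    (hx : Early (first I) (second I) I.xstar x) :
    delta I (phase2 I).P (Sum.inl x) = capSec (first I) (second I) I.xstar x := by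
  have H := (afterMedium_phase2 h2).inv
  rw [H.delta_inl, H.fixed x fun h => h.not_early hx, capSec, if_pos hx]
  have := hx.1
  unfold excess at this ⊢
  omega

theorem delta_phase2_late (h2 : 2 ≤ I.m) {x : Fin I.m}
    (hx : Late (first I) (second I) I.xstar x) :
    delta I (phase2 I).P (Sum.inl x) = capTop (first I) (second I) I.xstar x :=
  (afterMedium_phase2 h2).score x ((mem_X₂list h2 x).2 hx)

end Insertions

/-! ### Maximum flows and matchings -/

section Flow

theorem flowValue_le {W : Type} [Fintype W] {cap : W → W → ℕ} {s t : W} {f : W → W → ℕ}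
    (hf : IsFlow cap s t f) : flowValue s f ≤ ∑ v, (cap s v : ℤ) := by
  have h1 : ∑ v, (f s v : ℤ) ≤ ∑ v, (cap s v : ℤ) :=
    Finset.sum_le_sum fun v _ => by exact_mod_cast hf.le_cap s v
  have h2 : (0 : ℤ) ≤ ∑ v, (f v s : ℤ) := Finset.sum_nonneg fun v _ => by positivity
  unfold flowValue
  omega

/-- A nonempty set of integers that is bounded above contains its supremum. -/
theorem le_maxFlow_iff {W : Type} [Fintype W] (cap : W → W → ℕ) (s t : W) (z : ℤ) :
    z ≤ maxFlow cap s t ↔ ∃ f, IsFlow cap s t f ∧ z ≤ flowValue s f := by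
  have hne : {z | ∃ f, IsFlow cap s t f ∧ z = flowValue s f}.Nonempty :=
    ⟨_, fun _ _ => 0, ⟨by simp, by simp⟩, rfl⟩
  have hbdd : BddAbove {z | ∃ f, IsFlow cap s t f ∧ z = flowValue s f} := by
    refine ⟨∑ v, (cap s v : ℤ), ?_⟩
    rintro _ ⟨f, hf, rfl⟩
    exact flowValue_le hf
  constructor
  · intro h
    obtain ⟨f, hf, hfz⟩ := Int.csSup_mem hne hbdd
    exact ⟨f, hf, by rw [← hfz]; exact h⟩
  · rintro ⟨f, hf, hz⟩
    exact hz.trans (le_csSup hbdd ⟨f, hf, rfl⟩)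

variable {I : Instance}

theorem sum_node {N : Type} [AddCommMonoid N] (g : Node I → N) :
    ∑ u, g u = g (source I) + g (sink I) +
      (∑ x, g (Sum.inr (Sum.inl x)) + ∑ i, g (Sum.inr (Sum.inr i))) := by
  rw [Fintype.sum_sum_type, Fintype.sum_sum_type, Fintype.sum_bool, add_comm (g _) (g _)]
  rfl

/-- The network of the algorithm. -/
abbrev finalCap (I : Instance) : Node I → Node I → ℕ :=
  flowCap I (phase2 I).P (X₁ I) (X₂' I)

theorem late_of_mem_X₂' (h2 : 2 ≤ I.m) {x : Fin I.m} (hx : x ∈ X₂' I) :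
    Late (first I) (second I) I.xstar x :=
  (mem_X₂ h2 x).1 (Finset.mem_sdiff.1 hx).1

/-- Marked candidates have no demand left, so their removal affects neither the matchings nor the
sums. -/
theorem mem_X₂'_of_capTop_pos (h2 : 2 ≤ I.m) {x : Fin I.m}
    (hx : 0 < capTop (first I) (second I) I.xstar x) : x ∈ X₂' I := by
  refine Finset.mem_sdiff.2 ⟨(mem_X₂ h2 x).2 ?_, fun h => ?_⟩
  · by_contra h
    simp [capTop, h] at hx
  · exact hx.ne' ((afterMedium_phase2 h2).rem x h)

theorem eq_first_of_inLP (h2 : 2 ≤ I.m) {x : Fin I.m} {i : Fin I.n}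
    (h : InLP I (phase2 I).P x i) :
    first I i = x ∧ (phase2 I).P i = initWork I i := by
  rcases phase2_vote h2 i with hi | ⟨-, y, l, hi⟩
  · have := h.1
    rw [hi, initWork_zero h2] at this
    simp only [Option.some.injEq, Sum.inl.injEq] at this
    exact ⟨this, hi⟩
  · have := h.1
    rw [hi] at this
    simp at this

/-- A unit of flow runs from the source through an early candidate, a low priority vote below a late
candidate, and that candidate to the sink. The votes that carry flow form the matching. -/
theorem matching_of_flow (h2 : 2 ≤ I.m) {f : Node I → Node I → ℕ}
    (hf : IsFlow (finalCap I) (source I) (sink I) f) :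
    ∃ M, IsBMatching (first I) (second I) (capTop (first I) (second I) I.xstar)
      (capSec (first I) (second I) I.xstar) M ∧ flowValue (source I) f = M.card := by
  have z1 : ∀ u, f u (source I) = 0 := fun u => by
    have := hf.le_cap u (source I)
    rcases u with (_ | _) | _ | _ <;> simpa [finalCap, flowCap, source] using this
  have z2 : ∀ u, f (sink I) u = 0 := fun u => by
    have := hf.le_cap (sink I) u
    rcases u with (_ | _) | _ | _ <;> simpa [finalCap, flowCap, sink] using this
  have z3 : ∀ x x', f (Sum.inr (Sum.inl x)) (Sum.inr (Sum.inl x')) = 0 := fun x x' => by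
    simpa [finalCap, flowCap] using hf.le_cap (Sum.inr (Sum.inl x)) (Sum.inr (Sum.inl x'))
  have z4 : ∀ i i', f (Sum.inr (Sum.inr i)) (Sum.inr (Sum.inr i')) = 0 := fun i i' => by
    simpa [finalCap, flowCap] using hf.le_cap (Sum.inr (Sum.inr i)) (Sum.inr (Sum.inr i'))
  have z5 : ∀ i, f (Sum.inr (Sum.inr i)) (sink I) = 0 := fun i => by
    simpa [finalCap, flowCap, sink] using hf.le_cap (Sum.inr (Sum.inr i)) (sink I)
  have z6 : ∀ i, f (source I) (Sum.inr (Sum.inr i)) = 0 := fun i => by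
    simpa [finalCap, flowCap, source] using hf.le_cap (source I) (Sum.inr (Sum.inr i))
  have z7 : f (source I) (sink I) = 0 := by
    simpa [finalCap, flowCap, source, sink] using hf.le_cap (source I) (sink I)
  have c1 : ∀ x, f (source I) (Sum.inr (Sum.inl x)) ≤
      capSec (first I) (second I) I.xstar x := fun x => by
    have := hf.le_cap (source I) (Sum.inr (Sum.inl x))
    simp only [finalCap, flowCap, source, mem_X₁ h2] at this
    by_cases hx : Early (first I) (second I) I.xstar x
    · rw [if_pos hx, delta_phase2_early h2 hx] at this
      exact this
    · rw [if_neg hx] at this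
      exact this.trans (Nat.zero_le _)
  have c2 : ∀ x, f (Sum.inr (Sum.inl x)) (sink I) ≤
      if x ∈ X₂' I then capTop (first I) (second I) I.xstar x else 0 := fun x => by
    have := hf.le_cap (Sum.inr (Sum.inl x)) (sink I)
    simp only [finalCap, flowCap, sink] at this
    by_cases hx : x ∈ X₂' I
    · rw [if_pos hx, delta_phase2_late h2 (late_of_mem_X₂' h2 hx)] at this
      rw [if_pos hx]
      exact this
    · rw [if_neg hx] at this ⊢
      exact this
  have c3 : ∀ x i, f (Sum.inr (Sum.inl x)) (Sum.inr (Sum.inr i)) ≤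
      if Early (first I) (second I) I.xstar x ∧ second I i = x then 1 else 0 := fun x i => by
    have := hf.le_cap (Sum.inr (Sum.inl x)) (Sum.inr (Sum.inr i))
    simp only [finalCap, flowCap, mem_X₁ h2] at this
    refine this.trans ?_
    split_ifs with h1 h3 h3
    · exact le_rfl
    · obtain ⟨h4, h5, x', -, h6⟩ := h1
      rw [(eq_first_of_inLP h2 h6).2, initWork_one h2] at h5
      simp only [Option.some.injEq, Sum.inl.injEq] at h5
      exact absurd ⟨h4, h5⟩ h3
    · exact Nat.zero_le _
    · exact le_rfl
  have c4 : ∀ x i, f (Sum.inr (Sum.inr i)) (Sum.inr (Sum.inl x)) ≤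
      if x ∈ X₂' I ∧ first I i = x then 1 else 0 := fun x i => by
    have := hf.le_cap (Sum.inr (Sum.inr i)) (Sum.inr (Sum.inl x))
    simp only [finalCap, flowCap] at this
    refine this.trans ?_
    split_ifs with h1 h3 h3
    · exact le_rfl
    · exact absurd ⟨h1.1, (eq_first_of_inLP h2 h1.2).1⟩ h3
    · exact Nat.zero_le _
    · exact le_rfl
  -- Flow can enter a vote only from its second candidate and leave it only to its first, so one
  -- number, 0 or 1, describes the vote.
  set g : Fin I.n → ℕ := fun i => f (Sum.inr (Sum.inl (second I i))) (Sum.inr (Sum.inr i)) with hg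
  have g1 : ∀ i, g i ≤ 1 := fun i => (c3 _ i).trans (by split_ifs <;> omega)
  have gin : ∀ x i, f (Sum.inr (Sum.inl x)) (Sum.inr (Sum.inr i)) =
      if second I i = x then g i else 0 := fun x i => by
    split_ifs with h
    · rw [hg, ← h]
    · have := c3 x i
      rw [if_neg fun h' => h h'.2] at this
      omega
  have gmid : ∀ i, g i = f (Sum.inr (Sum.inr i)) (Sum.inr (Sum.inl (first I i))) := fun i => by
    have := hf.conserve (Sum.inr (Sum.inr i)) (by simp [source]) (by simp [sink])
    rw [sum_node, sum_node] at this
    simp only [z1, z2, z4, z5, z6, gin, Finset.sum_ite_eq, Finset.mem_univ, if_true,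
      Finset.sum_const_zero, add_zero, zero_add] at this
    rw [this, Finset.sum_eq_single (first I i) (fun x _ hx => by
      have := c4 x i
      rw [if_neg fun h => hx h.2.symm] at this
      omega) (by simp)]
  have gout : ∀ x i, f (Sum.inr (Sum.inr i)) (Sum.inr (Sum.inl x)) =
      if first I i = x then g i else 0 := fun x i => by
    split_ifs with h
    · rw [gmid, ← h]
    · have := c4 x i
      rw [if_neg fun h' => h h'.2] at this
      omega
  set M := Finset.univ.filter fun i => g i = 1 with hM
  have hgM : ∀ i, g i = if i ∈ M then 1 else 0 := fun i => by
    have := g1 i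
    simp only [hM, Finset.mem_filter, Finset.mem_univ, true_and]
    split_ifs <;> omega
  have sM : ∀ (h : Fin I.n → Fin I.m) x, ∑ i, (if h i = x then g i else 0) =
      (M.filter fun i => h i = x).card := fun h x => by
    rw [Finset.card_filter, ← Finset.sum_filter, ← Finset.sum_filter]
    rw [Finset.sum_congr rfl fun i _ => hgM i, ← Finset.sum_filter, Finset.filter_filter,
      Finset.sum_filter, Finset.sum_filter, ← Finset.sum_filter_add_sum_filter_not Finset.univ
        (· ∈ M)]
    simp only [Finset.sum_filter]
    rw [← Finset.sum_add_distrib, ← Finset.sum_subset (Finset.subset_univ M)]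
    · refine Finset.sum_congr rfl fun i hi => ?_
      simp [hi]
    · intro i _ hi
      simp [hi]
  have cons : ∀ x, f (source I) (Sum.inr (Sum.inl x)) + (M.filter fun i => first I i = x).card =
      f (Sum.inr (Sum.inl x)) (sink I) + (M.filter fun i => second I i = x).card := fun x => by
    have := hf.conserve (Sum.inr (Sum.inl x)) (by simp [source]) (by simp [sink])
    rw [sum_node, sum_node] at this
    simp only [z1, z2, z3, gin, gout, sM, Finset.sum_const_zero, add_zero, zero_add] at this
    exact this
  have early : ∀ x, ¬ Early (first I) (second I) I.xstar x →
      (M.filter fun i => second I i = x).card = 0 := fun x hx => by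
    rw [Finset.card_eq_zero, Finset.filter_eq_empty_iff]
    rintro i hi rfl
    have h1 := c3 (second I i) i
    rw [if_neg fun h => hx h.1] at h1
    have h3 := hgM i
    rw [if_pos hi] at h3
    have h4 : g i ≤ 0 := h1
    omega
  have late : ∀ x, x ∉ X₂' I → (M.filter fun i => first I i = x).card = 0 := fun x hx => by
    rw [Finset.card_eq_zero, Finset.filter_eq_empty_iff]
    rintro i hi rfl
    have h1 := c4 (first I i) i
    rw [if_neg fun h => hx h.1, ← gmid] at h1
    have h3 := hgM i
    rw [if_pos hi] at h3
    omega
  -- No candidate is on both sides: an early one has no edges from votes or to the sink, any other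
  -- none from the source or to votes. Conservation thus splits into two equations.
  have deg : ∀ x, f (source I) (Sum.inr (Sum.inl x)) = (M.filter fun i => second I i = x).card ∧
      f (Sum.inr (Sum.inl x)) (sink I) = (M.filter fun i => first I i = x).card := fun x => by
    have h1 := cons x
    by_cases hx : Early (first I) (second I) I.xstar x
    · have h3 : x ∉ X₂' I := fun h => (late_of_mem_X₂' h2 h).not_early hx
      have h4 := c2 x
      rw [if_neg h3] at h4
      have h5 := late x h3
      omega
    · have h3 := c1 x
      rw [capSec, if_neg hx] at h3
      have h5 := early x hx
      omega
  refine ⟨M, ⟨fun x => ?_, fun x => ?_⟩, ?_⟩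
  · rw [← (deg x).2]
    refine (c2 x).trans ?_
    split_ifs
    · exact le_rfl
    · exact Nat.zero_le _
  · rw [← (deg x).1]
    exact c1 x
  · rw [flowValue, sum_node, sum_node]
    simp only [z1, z6, z7, deg]
    rw [← sum_card_fibers M (second I)]
    simp

/-- Positive capacities force every matched vote to have a late top and an early second candidate,
so it was not touched by the insertions and all edges of its path exist. -/
theorem flow_of_matching (h2 : 2 ≤ I.m) {M : Finset (Fin I.n)}
    (hM : IsBMatching (first I) (second I) (capTop (first I) (second I) I.xstar)
      (capSec (first I) (second I) I.xstar) M) :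
    ∃ f, IsFlow (finalCap I) (source I) (sink I) f ∧ flowValue (source I) f = M.card := by
  set f : Node I → Node I → ℕ := fun u v => match u, v with
    | Sum.inl false, Sum.inr (Sum.inl x) => (M.filter fun i => second I i = x).card
    | Sum.inr (Sum.inr i), Sum.inr (Sum.inl x) => if i ∈ M ∧ first I i = x then 1 else 0
    | Sum.inr (Sum.inl x), Sum.inr (Sum.inr i) => if i ∈ M ∧ second I i = x then 1 else 0
    | Sum.inr (Sum.inl x), Sum.inl true => (M.filter fun i => first I i = x).card
    | _, _ => 0 with hf
  have hin : ∀ i ∈ M, 0 < capTop (first I) (second I) I.xstar (first I i) ∧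
      Early (first I) (second I) I.xstar (second I i) := fun i hi => by
    have h1 : i ∈ M.filter fun j => first I j = first I i := Finset.mem_filter.2 ⟨hi, rfl⟩
    have h3 : i ∈ M.filter fun j => second I j = second I i := Finset.mem_filter.2 ⟨hi, rfl⟩
    replace h1 := (Finset.card_pos.2 ⟨i, h1⟩).trans_le (hM.1 _)
    replace h3 := (Finset.card_pos.2 ⟨i, h3⟩).trans_le (hM.2 _)
    refine ⟨h1, ?_⟩
    by_contra h
    simp [capSec, h] at h3
  have hvote : ∀ i ∈ M, (phase2 I).P i = initWork I i := fun i hi => by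
    rcases phase2_vote h2 i with h | h
    · exact h
    · exact absurd (hin i hi).2 h.1.not_early
  have hLP : ∀ i ∈ M, InLP I (phase2 I).P (first I i) i := fun i hi => by
    rw [InLP, hvote i hi, initWork_zero h2, initWork_one h2]
    exact ⟨rfl, second I i, fun h => not_early_xstar (h ▸ (hin i hi).2), rfl⟩
  have scard : ∀ (h : Fin I.n → Fin I.m) x, ∑ i, (if i ∈ M ∧ h i = x then 1 else 0) =
      (M.filter fun i => h i = x).card := fun h x => by
    rw [← Finset.card_filter]
    congr 1
    ext i
    simp
  refine ⟨f, ⟨?_, ?_⟩, ?_⟩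
  · rintro ((_ | _) | x | i) ((_ | _) | x' | i')
    all_goals try exact Nat.zero_le _
    · simp only [hf, finalCap, flowCap, mem_X₁ h2]
      by_cases hx : Early (first I) (second I) I.xstar x'
      · rw [if_pos hx, delta_phase2_early h2 hx]
        exact hM.2 x'
      · have := hM.2 x'
        rw [capSec, if_neg hx] at this
        rw [if_neg hx]
        exact this
    · simp only [hf, finalCap, flowCap]
      by_cases hx : x ∈ X₂' I
      · rw [if_pos hx, delta_phase2_late h2 (late_of_mem_X₂' h2 hx)]
        exact hM.1 x
      · rw [if_neg hx]
        by_contra h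
        exact hx (mem_X₂'_of_capTop_pos h2 ((by omega : 0 < _).trans_le (hM.1 x)))
    · simp only [hf, finalCap, flowCap]
      by_cases hi : i' ∈ M ∧ second I i' = x
      · rw [if_pos hi, if_pos]
        refine ⟨(mem_X₁ h2 x).2 (hi.2 ▸ (hin i' hi.1).2), ?_, first I i',
          mem_X₂'_of_capTop_pos h2 (hin i' hi.1).1, hLP i' hi.1⟩
        rw [hvote i' hi.1, initWork_one h2, hi.2]
      · rw [if_neg hi]
        exact Nat.zero_le _
    · simp only [hf, finalCap, flowCap]
      by_cases hi : i ∈ M ∧ first I i = x'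
      · rw [if_pos hi, if_pos]
        exact hi.2 ▸ ⟨mem_X₂'_of_capTop_pos h2 (hin i hi.1).1, hLP i hi.1⟩
      · rw [if_neg hi]
        exact Nat.zero_le _
  · rintro ((_ | _) | x | i) h1 h3
    · exact absurd rfl h1
    · exact absurd rfl h3
    · rw [sum_node, sum_node]
      simp only [hf, source, sink, scard, Finset.sum_const_zero, add_zero, zero_add]
      exact add_comm _ _
    · rw [sum_node, sum_node]
      simp only [hf, source, sink, Finset.sum_const_zero, add_zero, zero_add]
      by_cases hi : i ∈ M <;> simp [hi]
  · rw [flowValue, sum_node, sum_node]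
    simp only [hf, source, sink]
    rw [← sum_card_fibers M (second I)]
    simp

theorem le_maxFlow_finalCap_iff (h2 : 2 ≤ I.m) (z : ℤ) :
    z ≤ maxFlow (finalCap I) (source I) (sink I) ↔
      ∃ M : Finset (Fin I.n), IsBMatching (first I) (second I)
        (capTop (first I) (second I) I.xstar) (capSec (first I) (second I) I.xstar) M ∧
        z ≤ M.card := by
  rw [le_maxFlow_iff]
  constructor
  · rintro ⟨f, hf, hz⟩
    obtain ⟨M, hM, hv⟩ := matching_of_flow h2 hf
    exact ⟨M, hM, hv ▸ hz⟩
  · rintro ⟨M, hM, hz⟩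
    obtain ⟨f, hf, hv⟩ := flow_of_matching h2 hM
    exact ⟨f, hf, hv ▸ hz⟩

end Flow

/-! ### The answer of the algorithm -/

section Answer

variable {I : Instance}

theorem sum_X₂'_delta (h2 : 2 ≤ I.m) : ∑ x ∈ X₂' I, delta I (phase2 I).P (Sum.inl x) =
    ∑ x, (capTop (first I) (second I) I.xstar x : ℤ) := by
  rw [← Finset.sum_subset (Finset.subset_univ (X₂' I))]
  · exact Finset.sum_congr rfl fun x hx => delta_phase2_late h2 (late_of_mem_X₂' h2 hx)
  · intro x _ hx
    by_contra h
    exact hx (mem_X₂'_of_capTop_pos h2 (by omega))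

/-- Each insertion takes exactly one approval from a late candidate and none from early ones or x*.
-/
theorem sum_Xbullet_delta_add (h2 : 2 ≤ I.m) :
    ∑ x ∈ Xbullet I, delta I (phase2 I).P (Sum.inl x) + (phase2 I).T =
      ∑ x, (excess (first I) (second I) I.xstar x : ℤ) := by
  have H := (afterMedium_phase2 h2).inv
  have hU : Xbullet I = X₁ I ∪ X₂ I := by
    ext x
    rw [Finset.mem_union, mem_Xbullet h2, mem_X₁ h2, mem_X₂ h2, Early, Late]
    omega
  have hD : Disjoint (X₁ I) (X₂ I) := Finset.disjoint_left.2 fun x h1 h3 =>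
    ((mem_X₂ h2 x).1 h3).not_early ((mem_X₁ h2 x).1 h1)
  have hT : ((phase2 I).T : ℤ) + ∑ x ∈ X₂ I, (approvalScore 2 (phase2 I).P (Sum.inl x) : ℤ) =
      ∑ x ∈ X₂ I, (topScore (first I) (second I) x : ℤ) := by
    exact_mod_cast H.total
  have h3 : ∑ x ∈ X₂ I, delta I (phase2 I).P (Sum.inl x) + (phase2 I).T =
      ∑ x ∈ X₂ I, (excess (first I) (second I) I.xstar x : ℤ) := by
    have h4 : ∑ x ∈ X₂ I, (excess (first I) (second I) I.xstar x : ℤ) = ∑ x ∈ X₂ I,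
        ((topScore (first I) (second I) x : ℤ) - topScore (first I) (second I) I.xstar) := by
      refine Finset.sum_congr rfl fun x hx => ?_
      have := ((mem_X₂ h2 x).1 hx).1
      unfold excess at this ⊢
      omega
    rw [h4, Finset.sum_congr rfl fun x _ => H.delta_inl x, Finset.sum_sub_distrib,
      Finset.sum_sub_distrib]
    omega
  have h5 : ∑ x ∈ X₁ I, delta I (phase2 I).P (Sum.inl x) =
      ∑ x ∈ X₁ I, (excess (first I) (second I) I.xstar x : ℤ) :=
    Finset.sum_congr rfl fun x hx => by
      have hE := (mem_X₁ h2 x).1 hx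
      rw [delta_phase2_early h2 hE, capSec, if_pos hE]
  have h6 : ∑ x, (excess (first I) (second I) I.xstar x : ℤ) =
      ∑ x ∈ Xbullet I, (excess (first I) (second I) I.xstar x : ℤ) := by
    symm
    refine Finset.sum_subset (Finset.subset_univ _) fun x _ hx => ?_
    rw [mem_Xbullet h2] at hx
    omega
  rw [h6, hU, Finset.sum_union hD, Finset.sum_union hD]
  omega

/-- A matching has at most ∑ capTop votes and the remaining Δ are nonnegative, so the criterion
leaves room for the insertions already made. -/
theorem insertions_le_of_crit (h2 : 2 ≤ I.m)
    (H : Crit (first I) (second I) I.xstar I.k) :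
    (phase2 I).T ≤ I.k * topScore (first I) (second I) I.xstar := by
  obtain ⟨M, hM, hle⟩ := H
  have h1 := sum_Xbullet_delta_add h2
  have h3 : M.card ≤ ∑ x, capTop (first I) (second I) I.xstar x := by
    rw [← sum_card_fibers M (first I)]
    exact Finset.sum_le_sum fun x _ => hM.1 x
  have h4 : 0 ≤ ∑ x ∈ Xbullet I, delta I (phase2 I).P (Sum.inl x) := by
    refine Finset.sum_nonneg fun x hx => ?_
    rw [mem_Xbullet h2] at hx
    rcases late_or_early_or_zero (first I) (second I) I.xstar x with h | h | h
    · rw [delta_phase2_late h2 h]; positivity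
    · rw [delta_phase2_early h2 h]; positivity
    · omega
  have h5 : (∑ x, excess (first I) (second I) I.xstar x : ℕ) =
    ∑ x, (excess (first I) (second I) I.xstar x : ℤ) := by push_cast; rfl
  omega

/-- By balance, if one new candidate exceeds the score of x*, all others have at least that score;
summing gives the strict bound. -/
theorem lt_insertions_of_new (h2 : 2 ≤ I.m)
    (h : ∃ y : Fin I.k, 0 < delta I (phase2 I).P (Sum.inr y)) :
    I.k * topScore (first I) (second I) I.xstar < (phase2 I).T := by
  have H := (afterMedium_phase2 h2).inv
  obtain ⟨y, hy⟩ := h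
  rw [delta, H.fixed _ not_late_xstar] at hy
  rw [← H.sum_new]
  calc I.k * topScore (first I) (second I) I.xstar
      = ∑ _y : Fin I.k, topScore (first I) (second I) I.xstar := by simp
    _ < _ := Finset.sum_lt_sum (fun y' _ => ?_) ⟨y, Finset.mem_univ _, by omega⟩
  have := H.balanced y y'
  omega

theorem checkCowinner_of_one (h1 : I.m < 2) : checkCowinner I = true := by
  have hsub : ∀ x : Fin I.m, x = I.xstar := fun x => by
    apply Fin.ext
    have := x.2; have := I.xstar.2
    omega
  have hX : Xbullet I = ∅ := by
    refine Finset.filter_eq_empty_iff.2 fun x _ => ?_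
    rw [hsub x, delta]
    omega
  have hX2 : X₂ I = ∅ := by rw [X₂, hX, Finset.filter_empty]
  have hl : X₂list I = [] := by simp [X₂list, hX2]
  have hp : phase2 I = ⟨initWork I, 0, ∅⟩ := by rw [phase2, hl, phase1, hl]; rfl
  have hX2' : X₂' I = ∅ := by rw [X₂', hX2, Finset.empty_sdiff]
  unfold checkCowinner
  rw [hp, hX, hX2']
  simp only [Finset.sum_empty]
  rw [if_neg]
  · refine decide_eq_true ?_
    have : (0 : ℤ) ≤ maxFlow (flowCap I (initWork I) (X₁ I) ∅) (source I) (sink I) :=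
      (le_maxFlow_iff _ _ _ _).2 ⟨fun _ _ => 0, ⟨by simp, by simp⟩, by simp [flowValue]⟩
    refine le_trans ?_ this
    push_cast
    have : (0 : ℤ) ≤ (I.k : ℤ) * (approvalScore 2 (initWork I) (Sum.inl I.xstar) : ℤ) := by
      positivity
    omega
  · rintro ⟨y, hy⟩
    rw [delta, approvalScore_initWork_inr] at hy
    omega

/-- The answer of the algorithm in terms of the given profile. -/
theorem checkCowinner_iff_crit (I : Instance) :
    checkCowinner I = true ↔ Crit (first I) (second I) I.xstar I.k := by
  by_cases h2 : 2 ≤ I.m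
  · have h1 : (∑ x ∈ Xbullet I, delta I (phase2 I).P (Sum.inl x) +
        ∑ x ∈ X₂' I, delta I (phase2 I).P (Sum.inl x) -
        ((I.k : ℤ) * approvalScore 2 (initWork I) (Sum.inl I.xstar) - (phase2 I).T) ≤
        maxFlow (flowCap I (phase2 I).P (X₁ I) (X₂' I)) (source I) (sink I)) ↔
        Crit (first I) (second I) I.xstar I.k := by
      rw [le_maxFlow_finalCap_iff h2, Crit, sum_X₂'_delta h2, approvalScore_initWork_inl h2]
      refine exists_congr fun M => and_congr_right fun _ => ?_
      have h3 := sum_Xbullet_delta_add h2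
      zify
      constructor <;> intro h <;> linarith
    by_cases h3 : ∃ y : Fin I.k, 0 < delta I (phase2 I).P (Sum.inr y)
    · have : checkCowinner I = false := by
        unfold checkCowinner
        exact if_pos h3
      rw [this]
      simp only [Bool.false_eq_true, false_iff]
      intro h
      exact absurd (insertions_le_of_crit h2 h) (not_le.2 (lt_insertions_of_new h2 h3))
    · unfold checkCowinner
      dsimp only
      rw [if_neg h3, decide_eq_true_eq]
      exact h1
  · rw [not_le] at h2
    exact iff_of_true (checkCowinner_of_one h2) (crit_of_excess_zero (excess_of_one h2) _)

end Answer

/-! ### Maximum matchings by augmentation -/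

section Augment

variable {n L : ℕ} {a b p q : ℕ → ℕ}

/-- In the presence of the matching `M`, an edge at `x` can be exchanged for an edge at `y`. -/
def Link (n : ℕ) (a b : ℕ → ℕ) (M : Finset ℕ) (x y : ℕ) : Prop :=
  ∃ i ∈ M, ∃ j < n, j ∉ M ∧ a i = x ∧ b j = b i ∧ a j = y

open Classical in
/-- Breadth first search from the unsaturated nodes: the number of rounds since `x` was found. -/
def age (n : ℕ) (a b p : ℕ → ℕ) (M : Finset ℕ) : ℕ → ℕ → ℕ
  | 0, x => if (M.filter fun i => a i = x).card < p x then 1 else 0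
  | t + 1, x => if age n a b p M t x ≠ 0 then age n a b p M t x + 1
      else if ∃ y, Link n a b M x y ∧ age n a b p M t y ≠ 0 then 1 else 0

theorem age_succ_of_ne {M : Finset ℕ} {t x : ℕ} (h : age n a b p M t x ≠ 0) :
    age n a b p M (t + 1) x = age n a b p M t x + 1 := by
  rw [age, if_pos h]

theorem age_succ_of_link {M : Finset ℕ} {t x y : ℕ} (h : Link n a b M x y)
    (hy : age n a b p M t y ≠ 0) : age n a b p M (t + 1) x ≠ 0 := by
  rw [age]
  split_ifs with h1 h2
  · omega
  · omega
  · exact absurd ⟨y, h, hy⟩ h2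

theorem age_le (M : Finset ℕ) (t x : ℕ) : age n a b p M t x ≤ t + 1 := by
  induction t with
  | zero => rw [age]; split_ifs <;> omega
  | succ t ih => rw [age]; split_ifs <;> omega

/-- A saturated node was found through a node found in an earlier round, which is therefore older.
Following older nodes leads back to an unsaturated one. -/
theorem age_descent {M : Finset ℕ} {t x : ℕ} (h : age n a b p M t x ≠ 0) :
    (M.filter fun i => a i = x).card < p x ∨
      ∃ y, Link n a b M x y ∧ age n a b p M t x < age n a b p M t y := by
  induction t generalizing x with
  | zero =>
    rw [age] at h
    split_ifs at h with h1
    · exact Or.inl h1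
    · exact absurd rfl h
  | succ t ih =>
    by_cases h1 : age n a b p M t x = 0
    · rw [age, if_neg (not_not.2 h1)] at h
      split_ifs at h with h2
      · obtain ⟨y, hxy, hy⟩ := h2
        refine Or.inr ⟨y, hxy, ?_⟩
        rw [age_succ_of_ne hy, age, if_neg (not_not.2 h1), if_pos ⟨y, hxy, hy⟩]
        omega
      · exact absurd rfl h
    · rcases ih h1 with h2 | ⟨y, hxy, hy⟩
      · exact Or.inl h2
      · refine Or.inr ⟨y, hxy, ?_⟩
        rw [age_succ_of_ne h1, age_succ_of_ne (x := y) (by omega)]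
        omega

theorem age_mono {M : Finset ℕ} {x : ℕ} (h : age n a b p M 0 x ≠ 0) (t : ℕ) :
    age n a b p M t x ≠ 0 := by
  induction t with
  | zero => exact h
  | succ t ih => rw [age_succ_of_ne ih]; omega

/-- After as many rounds as there are nodes, the set of nodes that have been found is closed. -/
theorem age_closed {M : Finset ℕ} (ha : ∀ i ∈ M, a i < L) {x y : ℕ} (h : Link n a b M x y)
    (hy : age n a b p M L y ≠ 0) : age n a b p M L x ≠ 0 := by
  -- As long as the found set is not closed, a round adds a node. A new node carries an edge of `M`,
  -- so it is below `L`, and after `L` rounds there is nothing left to find.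
  have key : ∀ t, (∀ x y, Link n a b M x y → age n a b p M t y ≠ 0 → age n a b p M t x ≠ 0) ∨
      t ≤ ((Finset.range L).filter fun x => age n a b p M t x ≠ 0).card := by
    intro t
    induction t with
    | zero => exact Or.inr (Nat.zero_le _)
    | succ t ih =>
      by_cases hc : ∀ x y, Link n a b M x y → age n a b p M t y ≠ 0 → age n a b p M t x ≠ 0
      · left
        intro x y hxy hy
        by_cases hy' : age n a b p M t y = 0
        · rw [age, if_neg (not_not.2 hy')] at hy
          split_ifs at hy with h1
          · obtain ⟨z, hz, hz'⟩ := h1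
            exact absurd hy' (hc y z hz hz')
          · exact absurd rfl hy
        · exact age_succ_of_link hxy hy'
      · right
        have ih := ih.resolve_left hc
        push Not at hc
        obtain ⟨x, y, hxy, hy, hx⟩ := hc
        have hxL : x < L := by
          obtain ⟨i, hi, j, hj, hj', rfl, h⟩ := hxy
          exact ha i hi
        refine Nat.succ_le_of_lt (lt_of_le_of_lt ih (Finset.card_lt_card ?_))
        refine (Finset.ssubset_iff_of_subset ?_).2 ⟨x, ?_, ?_⟩
        · intro z hz
          rw [Finset.mem_filter] at hz ⊢
          refine ⟨hz.1, ?_⟩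
          rw [age_succ_of_ne hz.2]
          omega
        · exact Finset.mem_filter.2 ⟨Finset.mem_range.2 hxL, age_succ_of_link hxy hy⟩
        · simp [hx]
  rcases key L with h1 | h1
  · exact h1 x y h hy
  · have h2 : (Finset.range L).filter (fun x => age n a b p M L x ≠ 0) = Finset.range L :=
      Finset.eq_of_subset_of_card_le (Finset.filter_subset _ _) (by simpa using h1)
    obtain ⟨i, hi, j, hj, hj', rfl, -⟩ := h
    have := h2.symm ▸ Finset.mem_range.2 (ha i hi)
    exact (Finset.mem_filter.1 this).2

/-- There is no edge with which an augmenting path could start. -/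
def Stuck (n L : ℕ) (a b p q : ℕ → ℕ) (M : Finset ℕ) : Prop :=
  ∀ j < n, j ∉ M → age n a b p M L (a j) ≠ 0 → q (b j) ≤ (M.filter fun i => b i = b j).card

/-- A vertex cover argument. With Z the found nodes and Y the second ends of unmatched edges at Z,
the nodes outside Z and those in Y are saturated, and an edge of `M` at Y has its first end in Z by
closedness. So `M` is optimal on each of the three classes of edges below. -/
theorem card_le_of_stuck {M M' : Finset ℕ} (ha : ∀ i < n, a i < L) (hM : M ⊆ Finset.range n)
    (hs : Stuck n L a b p q M) (hM' : M' ⊆ Finset.range n) (h' : IsBMatching a b p q M') :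
    M'.card ≤ M.card := by
  classical
  have haM : ∀ i ∈ M, a i < L := fun i hi => ha i (Finset.mem_range.1 (hM hi))
  set Z : ℕ → Prop := fun x => age n a b p M L x ≠ 0 with hZ
  set Y : ℕ → Prop := fun y => ∃ j < n, j ∉ M ∧ b j = y ∧ Z (a j) with hY
  have hcl : ∀ i ∈ M, Y (b i) → Z (a i) := by
    rintro i hi ⟨j, hj, hjM, hb, hz⟩
    exact age_closed haM ⟨i, hi, j, hj, hjM, rfl, hb, rfl⟩ hz
  have split : ∀ N : Finset ℕ, N.card = (N.filter fun i => Y (b i)).card +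
      ((N.filter fun i => ¬ Y (b i) ∧ ¬ Z (a i)).card +
        (N.filter fun i => ¬ Y (b i) ∧ Z (a i)).card) := by
    intro N
    rw [← Finset.card_filter_add_card_filter_not (s := N) fun i => Y (b i)]
    rw [← Finset.card_filter_add_card_filter_not (s := N.filter fun i => ¬ Y (b i)) fun i => ¬ Z (a i),
      Finset.filter_filter, Finset.filter_filter]
    simp only [not_not]
  have e1 : (M'.filter fun i => Y (b i)).card ≤ (M.filter fun i => Y (b i)).card := by
    set B := ((Finset.range n).image b).filter Y with hB
    have hmap : ∀ N : Finset ℕ, N ⊆ Finset.range n →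
        (N.filter fun i => Y (b i)).card = ∑ y ∈ B, (N.filter fun i => b i = y).card := by
      intro N hN
      rw [Finset.card_eq_sum_card_fiberwise (f := b) (t := B)]
      · refine Finset.sum_congr rfl fun y hy => ?_
        rw [Finset.filter_filter]
        congr 1
        refine Finset.filter_congr fun i _ => ⟨fun h => h.2, ?_⟩
        rintro rfl
        exact ⟨(Finset.mem_filter.1 hy).2, rfl⟩
      · intro i hi
        rw [Finset.mem_coe, Finset.mem_filter] at hi
        exact Finset.mem_coe.2 (Finset.mem_filter.2 ⟨Finset.mem_image_of_mem _ (hN hi.1), hi.2⟩)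
    rw [hmap _ hM', hmap _ hM]
    refine Finset.sum_le_sum fun y hy => (h'.2 y).trans ?_
    obtain ⟨j, hj, hjM, rfl, hz⟩ := (Finset.mem_filter.1 hy).2
    exact hs j hj hjM hz
  have e2 : (M'.filter fun i => ¬ Y (b i) ∧ ¬ Z (a i)).card ≤
      (M.filter fun i => ¬ Y (b i) ∧ ¬ Z (a i)).card := by
    have h1 : (M.filter fun i => ¬ Y (b i) ∧ ¬ Z (a i)) = M.filter fun i => ¬ Z (a i) :=
      Finset.filter_congr fun i hi => ⟨fun h => h.2, fun h => ⟨fun h' => h (hcl i hi h'), h⟩⟩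
    have h2 : (M'.filter fun i => ¬ Y (b i) ∧ ¬ Z (a i)).card ≤
        (M'.filter fun i => ¬ Z (a i)).card :=
      Finset.card_le_card fun i hi => by
        rw [Finset.mem_filter] at hi ⊢
        exact ⟨hi.1, hi.2.2⟩
    rw [h1]
    refine h2.trans ?_
    set A := ((Finset.range n).image a).filter fun x => ¬ Z x with hA
    have hmap : ∀ N : Finset ℕ, N ⊆ Finset.range n →
        (N.filter fun i => ¬ Z (a i)).card = ∑ x ∈ A, (N.filter fun i => a i = x).card := by
      intro N hN
      rw [Finset.card_eq_sum_card_fiberwise (f := a) (t := A)]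
      · refine Finset.sum_congr rfl fun y hy => ?_
        rw [Finset.filter_filter]
        congr 1
        refine Finset.filter_congr fun i _ => ⟨fun h => h.2, ?_⟩
        rintro rfl
        exact ⟨(Finset.mem_filter.1 hy).2, rfl⟩
      · intro i hi
        rw [Finset.mem_coe, Finset.mem_filter] at hi
        exact Finset.mem_coe.2 (Finset.mem_filter.2 ⟨Finset.mem_image_of_mem _ (hN hi.1), hi.2⟩)
    rw [hmap _ hM', hmap _ hM]
    refine Finset.sum_le_sum fun x hx => (h'.1 x).trans ?_
    by_contra h
    refine (Finset.mem_filter.1 hx).2 (age_mono ?_ L)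
    rw [age, if_pos (by omega)]
    omega
  -- An unmatched edge with first end in Z would put its second end into Y, so this class lies in
  -- `M` entirely.
  have e3 : (M'.filter fun i => ¬ Y (b i) ∧ Z (a i)).card ≤
      (M.filter fun i => ¬ Y (b i) ∧ Z (a i)).card := by
    refine Finset.card_le_card fun i hi => ?_
    rw [Finset.mem_filter] at hi ⊢
    refine ⟨?_, hi.2⟩
    by_contra h
    exact hi.2.1 ⟨i, Finset.mem_range.1 (hM' hi.1), h, rfl, hi.2.2⟩
  rw [split M, split M']
  omega

/-! ### Augmenting walks -/

/-- The state of an augmentation of `M₀`, with a possible surplus at `cur`. -/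
structure Walk (n L : ℕ) (a b p q : ℕ → ℕ) (M₀ M : Finset ℕ) (cur : ℕ) : Prop where
  subset : M ⊆ Finset.range n
  card : M.card = M₀.card + 1
  top : ∀ x, (M.filter fun i => a i = x).card ≤ p x + if x = cur then 1 else 0
  sec : ∀ y, (M.filter fun i => b i = y).card ≤ q y
  cur_age : age n a b p M₀ L cur ≠ 0
  degree : ∀ x, age n a b p M₀ L cur ≤ age n a b p M₀ L x →
    (M.filter fun i => a i = x).card = (M₀.filter fun i => a i = x).card + if x = cur then 1 else 0
  link : ∀ x, age n a b p M₀ L cur ≤ age n a b p M₀ L x →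
    (M₀.filter fun i => a i = x).card < p x ∨
      ∃ y, Link n a b M x y ∧ age n a b p M₀ L x < age n a b p M₀ L y

theorem card_filter_insert_of_notMem {M : Finset ℕ} {j : ℕ} (hj : j ∉ M) (g : ℕ → ℕ) (x : ℕ) :
    ((insert j M).filter fun i => g i = x).card =
      (M.filter fun i => g i = x).card + if x = g j then 1 else 0 := by
  rw [Finset.filter_insert]
  split_ifs with h1 h2 h2
  · exact Finset.card_insert_of_notMem fun h => hj (Finset.mem_filter.1 h).1
  · exact absurd h1.symm h2
  · exact absurd h2.symm h1
  · rfl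

theorem card_filter_erase_of_mem {M : Finset ℕ} {i : ℕ} (hi : i ∈ M) (g : ℕ → ℕ) (x : ℕ) :
    ((M.erase i).filter fun i => g i = x).card + (if x = g i then 1 else 0) =
      (M.filter fun i => g i = x).card := by
  conv_rhs => rw [← Finset.insert_erase hi]
  rw [card_filter_insert_of_notMem (Finset.notMem_erase i M)]

/-- The replacement edge of a link leads to a node strictly older than `a j`, so it is not the
inserted edge `j` and the link survives. -/
theorem Walk.start {M : Finset ℕ} (hM : M ⊆ Finset.range n) (hB : IsBMatching a b p q M) {j : ℕ}
    (hj : j < n) (hjM : j ∉ M) (hage : age n a b p M L (a j) ≠ 0)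
    (hq : (M.filter fun i => b i = b j).card < q (b j)) :
    Walk n L a b p q M (insert j M) (a j) where
  subset := Finset.insert_subset (Finset.mem_range.2 hj) hM
  card := Finset.card_insert_of_notMem hjM
  top x := by
    rw [card_filter_insert_of_notMem hjM]
    exact Nat.add_le_add_right (hB.1 x) _
  sec y := by
    rw [card_filter_insert_of_notMem hjM]
    have := hB.2 y
    split_ifs with h
    · subst h; omega
    · omega
  cur_age := hage
  degree x _ := card_filter_insert_of_notMem hjM a x
  link x hx := by
    have hx0 : age n a b p M L x ≠ 0 := by omega
    rcases age_descent hx0 with h | ⟨y, ⟨i, hi, l, hl, hlM, h1, h2, h3⟩, hy⟩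
    · exact Or.inl h
    · refine Or.inr ⟨y, ⟨i, Finset.mem_insert_of_mem hi, l, hl, ?_, h1, h2, h3⟩, hy⟩
      rw [Finset.mem_insert, not_or]
      refine ⟨?_, hlM⟩
      rintro rfl
      rw [h3] at hx
      omega

/-- The exchange preserves degrees at second ends and moves the surplus to `a j`. Nodes at least as
old as `a j` are older than `cur`, so their links use neither the removed edge `i` nor the inserted
edge `j`. -/
theorem Walk.step {M₀ M : Finset ℕ} {cur i j : ℕ} (h : Walk n L a b p q M₀ M cur)
    (hi : i ∈ M) (hj : j < n) (hjM : j ∉ M) (hic : a i = cur) (hb : b j = b i)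
    (hage : age n a b p M₀ L cur < age n a b p M₀ L (a j)) :
    Walk n L a b p q M₀ (insert j (M.erase i)) (a j) := by
  have hjM' : j ∉ M.erase i := fun h => hjM (Finset.mem_of_mem_erase h)
  have hne : a j ≠ cur := fun h => by rw [h] at hage; omega
  have hdeg : ∀ x, ((insert j (M.erase i)).filter fun i => a i = x).card +
      (if x = cur then 1 else 0) =
      (M.filter fun i => a i = x).card + if x = a j then 1 else 0 := fun x => by
    rw [card_filter_insert_of_notMem hjM', ← card_filter_erase_of_mem hi, hic]
    omega
  refine ⟨?_, ?_, fun x => ?_, fun y => ?_, by omega, fun x hx => ?_, fun x hx => ?_⟩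
  · exact Finset.insert_subset (Finset.mem_range.2 hj) ((Finset.erase_subset _ _).trans h.subset)
  · rw [Finset.card_insert_of_notMem hjM', Finset.card_erase_of_mem hi, ← h.card]
    have := Finset.card_pos.2 ⟨i, hi⟩
    omega
  · have h1 := hdeg x
    have h2 := h.top x
    omega
  · rw [card_filter_insert_of_notMem hjM', hb, card_filter_erase_of_mem hi]
    exact h.sec y
  · have h1 := hdeg x
    have h2 := h.degree x (by omega)
    have h3 : x ≠ cur := fun h => by rw [h] at hx; omega
    rw [if_neg h3] at h1 h2
    omega
  · have h3 : x ≠ cur := fun h => by rw [h] at hx; omega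
    rcases h.link x (by omega) with h1 | ⟨y, ⟨i', hi', l, hl, hlM, h4, h5, h6⟩, hy⟩
    · exact Or.inl h1
    · refine Or.inr ⟨y, ⟨i', ?_, l, hl, ?_, h4, h5, h6⟩, hy⟩
      · refine Finset.mem_insert_of_mem (Finset.mem_erase.2 ⟨?_, hi'⟩)
        rintro rfl
        exact h3 (h4.symm.trans hic)
      · rw [Finset.mem_insert, not_or]
        refine ⟨?_, fun h => hlM (Finset.mem_of_mem_erase h)⟩
        rintro rfl
        rw [h6] at hx
        omega

/-- If `cur` is overloaded, it was saturated in `M₀`, so its link to an older node is available. -/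
theorem Walk.exists_step {M₀ M : Finset ℕ} {cur : ℕ} (h : Walk n L a b p q M₀ M cur)
    (hc : p cur < (M.filter fun i => a i = cur).card) :
    ∃ i ∈ M, ∃ j < n, j ∉ M ∧ a i = cur ∧ b j = b i ∧
      age n a b p M₀ L cur < age n a b p M₀ L (a j) := by
  have h1 := h.degree cur le_rfl
  rw [if_pos rfl] at h1
  rcases h.link cur le_rfl with h2 | ⟨y, ⟨i, hi, j, hj, hjM, h4, h5, h6⟩, hy⟩
  · omega
  · exact ⟨i, hi, j, hj, hjM, h4, h5, h6 ▸ hy⟩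

theorem Walk.isBMatching {M₀ M : Finset ℕ} {cur : ℕ} (h : Walk n L a b p q M₀ M cur)
    (hc : (M.filter fun i => a i = cur).card ≤ p cur) : IsBMatching a b p q M := by
  refine ⟨fun x => ?_, h.sec⟩
  have := h.top x
  split_ifs at this with h1
  · rw [h1]; exact hc
  · exact this

/-- Ages are at most `L + 1`, so a node older than `L` cannot pass its surplus on and hence has
none. -/
theorem Walk.card_le_of_age {M₀ M : Finset ℕ} {cur : ℕ} (h : Walk n L a b p q M₀ M cur)
    (hc : L < age n a b p M₀ L cur) : (M.filter fun i => a i = cur).card ≤ p cur := by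
  by_contra hlt
  obtain ⟨i, -, j, -, -, -, -, hj⟩ := h.exists_step (not_le.1 hlt)
  have := age_le (n := n) (a := a) (b := b) (p := p) M₀ L (a j)
  omega

end Augment

/-! ### Derived expressions -/

namespace Tm

/-- Conjunction. -/
def both (e₁ e₂ : Tm) : Tm := cond e₁ e₂ (const 0)

/-- Negation. -/
def neg (e : Tm) : Tm := eq e (const 0)

/-- The sum of `e` over the values of the register `v` below the value of the register `w`. -/
def sumTo (v w : ℕ) (e : Tm) : Tm := sum v (cond (lt (var v) (var w)) e (const 0))

/-- Whether `e ≠ 0` for a value of the register `v` below the value of the register `w`. -/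
def anyTo (v w : ℕ) (e : Tm) : Tm := lt (const 0) (sumTo v w e)

/-- The least value of the register `v`, below the value of the register `w`, with `e ≠ 0`. The
register `u` must not occur in `e`. -/
def find (u v w : ℕ) (e : Tm) : Tm :=
  sum u (neg (sumTo v w (both (lt (var v) (add (var u) (const 1))) e)))

variable {L : ℕ} {σ : Mem}

theorem eval_lt_ne {e₁ e₂ : Tm} : (lt e₁ e₂).eval L σ ≠ 0 ↔ e₁.eval L σ < e₂.eval L σ := by
  simp only [eval]; split_ifs with h <;> simp [h]

theorem eval_eq_ne {e₁ e₂ : Tm} : (eq e₁ e₂).eval L σ ≠ 0 ↔ e₁.eval L σ = e₂.eval L σ := by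
  simp only [eval]; split_ifs with h <;> simp [h]

theorem eval_both_ne {e₁ e₂ : Tm} :
    (both e₁ e₂).eval L σ ≠ 0 ↔ e₁.eval L σ ≠ 0 ∧ e₂.eval L σ ≠ 0 := by
  simp only [both, eval]; split_ifs with h <;> simp [h]

theorem eval_neg_ne {e : Tm} : (neg e).eval L σ ≠ 0 ↔ e.eval L σ = 0 := by
  simp only [neg, eval]; split_ifs with h <;> simp [h]

theorem eval_sumTo {v w : ℕ} (e : Tm) (hvw : w ≠ v) (hw : σ.var w ≤ L) :
    (sumTo v w e).eval L σ = ∑ i ∈ Finset.range (σ.var w), e.eval L (σ.setVar v i) := by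
  simp only [sumTo, eval, Mem.setVar_var, if_true, if_neg hvw]
  rw [← Finset.sum_subset (Finset.range_subset_range.2 hw)]
  · refine Finset.sum_congr rfl fun i hi => ?_
    simp [Finset.mem_range.1 hi]
  · intro i _ hi
    simp [Finset.mem_range.not.1 hi]

theorem eval_anyTo_ne {v w : ℕ} {e : Tm} (hvw : w ≠ v) (hw : σ.var w ≤ L) :
    (anyTo v w e).eval L σ ≠ 0 ↔ ∃ i < σ.var w, e.eval L (σ.setVar v i) ≠ 0 := by
  rw [anyTo, eval_lt_ne, eval_sumTo e hvw hw]
  simp only [eval]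
  rw [Finset.sum_pos_iff]
  simp [pos_iff_ne_zero]

theorem eval_find {u v w : ℕ} {e : Tm} {Q : ℕ → Prop} (hvw : w ≠ v) (huw : w ≠ u) (huv : u ≠ v)
    (hw : σ.var w ≤ L)
    (hQ : ∀ z i, e.eval L ((σ.setVar u z).setVar v i) ≠ 0 ↔ Q i)
    (h : ∃ i < σ.var w, Q i) :
    (find u v w e).eval L σ < σ.var w ∧ Q ((find u v w e).eval L σ) := by
  classical
  have h0 := Nat.find_spec h
  have hmin : ∀ j < Nat.find h, ¬ Q j := fun j hj hq =>
    Nat.find_min h hj ⟨hj.trans h0.1, hq⟩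
  -- The outer sum counts the `u` for which no witness is at most `u`, and these are exactly the
  -- numbers below the least witness.
  have key : (find u v w e).eval L σ = Nat.find h := by
    have h1 : ∀ z, (neg (sumTo v w (both (lt (var v) (add (var u) (const 1))) e))).eval L
        (σ.setVar u z) = if z < Nat.find h then 1 else 0 := by
      intro z
      have h2 : (neg (sumTo v w (both (lt (var v) (add (var u) (const 1))) e))).eval L
          (σ.setVar u z) ≠ 0 ↔ z < Nat.find h := by
        rw [eval_neg_ne, eval_sumTo _ hvw (by simpa [huw] using hw), Finset.sum_eq_zero_iff]
        simp only [Mem.setVar_var, if_neg huw, Finset.mem_range]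
        constructor
        · intro h3
          by_contra h4
          have := h3 _ h0.1
          refine absurd this (eval_both_ne.2 ⟨eval_lt_ne.2 ?_, (hQ _ _).2 h0.2⟩)
          simp only [eval, Mem.setVar_var, if_true, if_neg huv]
          omega
        · intro h3 i hi
          by_contra h4
          obtain ⟨h5, h6⟩ := eval_both_ne.1 h4
          rw [eval_lt_ne] at h5
          simp only [eval, Mem.setVar_var, if_true, if_neg huv] at h5
          exact hmin i (by omega) ((hQ _ _).1 h6)
      simp only [neg, eval] at h2 ⊢
      split_ifs at h2 ⊢ <;> simp_all
    simp only [find]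
    rw [eval, Finset.sum_congr rfl fun z _ => h1 z, ← Finset.sum_filter]
    simp only [Finset.sum_const, smul_eq_mul, mul_one]
    rw [show (Finset.range L).filter (fun z => z < Nat.find h) = Finset.range (Nat.find h) by
      ext z
      simp only [Finset.mem_filter, Finset.mem_range]
      omega, Finset.card_range]
  rw [key]
  exact h0

end Tm

/-! ### A program for maximum matchings

Register `0` holds the number of edges, the arrays `1` and `2` hold their ends, and the arrays `3`
and `4` the capacities. The arrays `5` and `6` hold the matching and the ages; the registers `4`,
`5`, `6` hold the current node and the two edges of an exchange. -/

namespace Tm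

/-- The degree of a node of the first kind. -/
def degTop (x : Tm) : Tm := sumTo 10 0 (both (get 5 (var 10)) (eq (get 1 (var 10)) x))

/-- The degree of a node of the second kind. -/
def degSec (y : Tm) : Tm := sumTo 10 0 (both (get 5 (var 10)) (eq (get 2 (var 10)) y))

/-- Whether edge `l` can replace edge `i`. -/
def canReplace (i l : ℕ) : Tm := both (neg (get 5 (var l))) (eq (get 2 (var l)) (get 2 (var i)))

/-- Whether the node in register `13` is linked to a node that has been found. -/
def linked : Tm :=
  anyTo 11 0 (both (both (get 5 (var 11)) (eq (get 1 (var 11)) (var 13)))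
    (anyTo 12 0 (both (canReplace 11 12) (get 6 (get 1 (var 12))))))

/-- Whether an augmentation can start with the edge in register `15`. -/
def canStart : Tm :=
  both (both (neg (get 5 (var 15))) (get 6 (get 1 (var 15))))
    (lt (degSec (get 2 (var 15))) (get 4 (get 2 (var 15))))

/-- Whether edge `l` can replace edge `i` and leads to an older node. -/
def leads (i l : ℕ) : Tm :=
  both (canReplace i l) (lt (get 6 (var 4)) (get 6 (get 1 (var l))))

/-- Whether the edge in register `15` is at the current node and can be replaced. -/
def canStep : Tm :=
  both (both (get 5 (var 15)) (eq (get 1 (var 15)) (var 4))) (anyTo 12 0 (leads 15 12))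

end Tm

namespace Stm

open Tm in
/-- The ages. -/
def search : Stm :=
  .seq (.fill 6 13 (.lt (degTop (.var 13)) (.get 3 (.var 13))))
    (.loop (.fill 6 13 (.cond (.get 6 (.var 13)) (.add (.get 6 (.var 13)) (.const 1)) linked)))

open Tm in
/-- The first edge of an augmentation. -/
def start : Stm :=
  .seq (.assign 6 (.find 14 15 0 canStart)) <|
  .seq (.fill 5 13 (.cond (.eq (.var 13) (.var 6)) (.const 1) (.get 5 (.var 13)))) <|
  .assign 4 (.get 1 (.var 6))

open Tm in
/-- One exchange. -/
def exchange : Stm :=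
  .seq (.assign 5 (.find 14 15 0 canStep)) <|
  .seq (.assign 6 (.find 14 15 0 (leads 5 15))) <|
  .seq (.fill 5 13 (.cond (.eq (.var 13) (.var 6)) (.const 1)
    (.cond (.eq (.var 13) (.var 5)) (.const 0) (.get 5 (.var 13))))) <|
  .assign 4 (.get 1 (.var 6))

open Tm in
/-- Exchanges until there is no surplus. -/
def walk : Stm := .loop (.cond (.lt (.get 3 (.var 4)) (degTop (.var 4))) exchange)

open Tm in
/-- One augmentation, if possible. -/
def augment : Stm := .seq search (.cond (anyTo 15 0 canStart) (.seq start walk))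

/-- A maximum matching. -/
def matching : Stm := .loop augment

end Stm

/-- The matching that is stored in an array. -/
def edges (n : ℕ) (f : ℕ → ℕ) : Finset ℕ := (Finset.range n).filter fun i => f i ≠ 0

theorem mem_edges {n : ℕ} {f : ℕ → ℕ} {i : ℕ} : i ∈ edges n f ↔ i < n ∧ f i ≠ 0 := by
  simp [edges]

theorem edges_subset (n : ℕ) (f : ℕ → ℕ) : edges n f ⊆ Finset.range n := Finset.filter_subset _ _

/-- The input of the matching program is as described; the registers and arrays that it does not
change are those of `σ₀`. -/
structure Ready (σ₀ : Mem) (n : ℕ) (a b p q : ℕ → ℕ) (σ : Mem) : Prop where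
  var : ∀ x, x ≠ 4 → x ≠ 5 → x ≠ 6 → σ.var x = σ₀.var x
  arr : ∀ c, c ≠ 5 → c ≠ 6 → σ.arr c = σ₀.arr c
  var_n : σ.var 0 = n
  arr_a : σ.arr 1 = a
  arr_b : σ.arr 2 = b
  arr_p : σ.arr 3 = p
  arr_q : σ.arr 4 = q

section Matching

variable {L n : ℕ} {a b p q : ℕ → ℕ} {σ₀ σ : Mem}

theorem Ready.setVar (h : Ready σ₀ n a b p q σ) {x : ℕ} (hx : x = 4 ∨ x = 5 ∨ x = 6) (v : ℕ) :
    Ready σ₀ n a b p q (σ.setVar x v) where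
  var y h4 h5 h6 := by
    rw [Mem.setVar_var, if_neg (by omega), h.var y h4 h5 h6]
  arr := h.arr
  var_n := by rw [Mem.setVar_var, if_neg (by omega), h.var_n]
  arr_a := h.arr_a
  arr_b := h.arr_b
  arr_p := h.arr_p
  arr_q := h.arr_q

theorem Ready.setArr (h : Ready σ₀ n a b p q σ) {c : ℕ} (hc : c = 5 ∨ c = 6) (g : ℕ → ℕ) :
    Ready σ₀ n a b p q (σ.setArr c g) where
  var := h.var
  arr d h5 h6 := by rw [Mem.setArr_arr, if_neg (by omega), h.arr d h5 h6]
  var_n := h.var_n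
  arr_a := by rw [Mem.setArr_arr, if_neg (by omega), h.arr_a]
  arr_b := by rw [Mem.setArr_arr, if_neg (by omega), h.arr_b]
  arr_p := by rw [Mem.setArr_arr, if_neg (by omega), h.arr_p]
  arr_q := by rw [Mem.setArr_arr, if_neg (by omega), h.arr_q]

theorem eval_degree {c : ℕ} {x : Tm} {X : ℕ} (hn : σ.var 0 ≤ L)
    (hx : ∀ i, x.eval L (σ.setVar 10 i) = X) :
    (Tm.sumTo 10 0 (.both (.get 5 (.var 10)) (.eq (.get c (.var 10)) x))).eval L σ =
      ((edges (σ.var 0) (σ.arr 5)).filter fun i => σ.arr c i = X).card := by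
  rw [Tm.eval_sumTo _ (by omega) hn, edges, Finset.filter_filter, Finset.card_filter]
  refine Finset.sum_congr rfl fun i _ => ?_
  simp only [Tm.both, Tm.eval, hx, Mem.setVar_arr, Mem.setVar_var, if_true]
  by_cases h1 : σ.arr 5 i = 0 <;> by_cases h2 : σ.arr c i = X <;> simp [h1, h2]

theorem Ready.eval_degTop (h : Ready σ₀ n a b p q σ) (hn : n ≤ L) {x : Tm} {X : ℕ}
    (hx : ∀ i, x.eval L (σ.setVar 10 i) = X) :
    (Tm.degTop x).eval L σ = ((edges n (σ.arr 5)).filter fun i => a i = X).card := by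
  rw [Tm.degTop, eval_degree (by rw [h.var_n]; exact hn) hx, h.arr_a, h.var_n]

theorem linked_ne (hn : n ≤ L) (h0 : σ.var 0 = n) (ha : σ.arr 1 = a) (hb : σ.arr 2 = b) :
    Tm.linked.eval L σ ≠ 0 ↔
      ∃ y, Link n a b (edges n (σ.arr 5)) (σ.var 13) y ∧ σ.arr 6 y ≠ 0 := by
  rw [Tm.linked, Tm.eval_anyTo_ne (by omega) (by omega), h0]
  constructor
  · rintro ⟨i, hi, h⟩
    rw [Tm.eval_both_ne, Tm.eval_both_ne, Tm.eval_eq_ne, Tm.eval_anyTo_ne (by omega)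
      (by simp; omega)] at h
    obtain ⟨⟨h1, h2⟩, j, hj, h3⟩ := h
    rw [Tm.eval_both_ne, Tm.canReplace, Tm.eval_both_ne, Tm.eval_neg_ne, Tm.eval_eq_ne] at h3
    simp [Tm.eval, ha, hb, h0] at h1 h2 h3 hj
    exact ⟨a j, ⟨i, mem_edges.2 ⟨hi, h1⟩, j, hj, fun h => (mem_edges.1 h).2 h3.1.1, h2, h3.1.2,
      rfl⟩, h3.2⟩
  · rintro ⟨y, ⟨i, hi, j, hj, hjM, h2, h3, rfl⟩, hy⟩
    rw [mem_edges] at hi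
    refine ⟨i, hi.1, ?_⟩
    rw [Tm.eval_both_ne, Tm.eval_both_ne, Tm.eval_eq_ne, Tm.eval_anyTo_ne (by omega)
      (by simp; omega)]
    have hj0 : σ.arr 5 j = 0 := by
      by_contra h
      exact hjM (mem_edges.2 ⟨hj, h⟩)
    refine ⟨⟨by simpa [Tm.eval] using hi.2, by simpa [Tm.eval, ha] using h2⟩, j,
      by simpa [h0] using hj, ?_⟩
    rw [Tm.eval_both_ne, Tm.canReplace, Tm.eval_both_ne, Tm.eval_neg_ne, Tm.eval_eq_ne]
    simp [Tm.eval, ha, hb, hj0, h3, hy]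

/-- The array agrees with the ages only below `L`, which suffices because every first end of an edge
is below `L`. -/
theorem run_search (hn : n ≤ L) (ha : ∀ i < n, a i < L) (h : Ready σ₀ n a b p q σ) :
    ∃ R, Stm.search.run L σ = σ.setArr 6 R ∧
      ∀ x < L, R x = age n a b p (edges n (σ.arr 5)) L x := by
  classical
  simp only [Stm.search, Stm.run]
  set F : Mem → Mem := fun σ => σ.setArr 6 fun i => if i < L then
    (Tm.cond (.get 6 (.var 13)) (.add (.get 6 (.var 13)) (.const 1)) Tm.linked).eval L
      (σ.setVar 13 i) else σ.arr 6 i with hF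
  suffices H : ∀ t, ∃ R, F^[t] (σ.setArr 6 fun i => if i < L then
      (Tm.lt (Tm.degTop (.var 13)) (.get 3 (.var 13))).eval L (σ.setVar 13 i) else σ.arr 6 i) =
      σ.setArr 6 R ∧ ∀ x < L, R x = age n a b p (edges n (σ.arr 5)) t x from H L
  intro t
  induction t with
  | zero =>
    refine ⟨_, rfl, fun x hx => ?_⟩
    simp only [if_pos hx, age]
    have hd : (Tm.degTop (.var 13)).eval L (σ.setVar 13 x) =
        ((edges n (σ.arr 5)).filter fun i => a i = x).card := by
      rw [Tm.degTop, eval_degree (X := x) (by simpa [h.var_n] using hn) (fun i => by simp [Tm.eval])]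
      simp [h.arr_a, h.var_n]
    rw [Tm.eval, hd]
    simp [Tm.eval, h.arr_p]
  | succ t ih =>
    obtain ⟨R, hR, hRx⟩ := ih
    rw [Function.iterate_succ_apply', hR]
    refine ⟨fun i => if i < L then
      (Tm.cond (.get 6 (.var 13)) (.add (.get 6 (.var 13)) (.const 1)) Tm.linked).eval L
      ((σ.setArr 6 R).setVar 13 i) else R i, ?_, fun x hx => ?_⟩
    · simp only [hF, Mem.setArr, Function.update_idem, Function.update_self]
    · have hl := linked_ne (σ := (σ.setArr 6 R).setVar 13 x) (L := L) hn
        (by simp [h.var_n]) (by simp; exact h.arr_a) (by simp; exact h.arr_b)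
      have hlv : Tm.linked.eval L ((σ.setArr 6 R).setVar 13 x) =
          if Tm.linked.eval L ((σ.setArr 6 R).setVar 13 x) ≠ 0 then 1 else 0 := by
        simp only [Tm.linked, Tm.anyTo, Tm.eval]
        split_ifs <;> simp_all
      simp only [if_pos hx, age]
      rw [Tm.eval, hlv, if_congr hl rfl rfl]
      simp only [Tm.eval, Mem.setVar_var, Mem.setVar_arr, Mem.setArr_arr, if_true, Mem.setArr_var]
      rw [hRx x hx]
      have : (∃ y, Link n a b (edges n ((if 5 = 6 then R else σ.arr 5))) x y ∧ R y ≠ 0) ↔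
          ∃ y, Link n a b (edges n (σ.arr 5)) x y ∧
            age n a b p (edges n (σ.arr 5)) t y ≠ 0 := by
        refine exists_congr fun y => ?_
        rw [if_neg (by omega)]
        refine and_congr_right fun hy => ?_
        obtain ⟨i, _, j, hj, _, _, _, rfl⟩ := hy
        rw [hRx _ (ha j hj)]
      simp only [this]

end Matching

/-! ### Correctness of the matching program -/

section Matching

variable {L n : ℕ} {a b p q : ℕ → ℕ} {σ₀ σ : Mem}

theorem canStart_ne (hn : n ≤ L) (h0 : σ.var 0 = n) (ha : σ.arr 1 = a) (hb : σ.arr 2 = b)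
    (hq : σ.arr 4 = q) : Tm.canStart.eval L σ ≠ 0 ↔
      σ.arr 5 (σ.var 15) = 0 ∧ σ.arr 6 (a (σ.var 15)) ≠ 0 ∧
      ((edges n (σ.arr 5)).filter fun i => b i = b (σ.var 15)).card < q (b (σ.var 15)) := by
  rw [Tm.canStart, Tm.eval_both_ne, Tm.eval_both_ne, Tm.eval_neg_ne, Tm.eval_lt_ne, Tm.degSec,
    eval_degree (X := b (σ.var 15)) (by omega) (fun i => by simp [Tm.eval, hb]), h0, hb]
  simp only [Tm.eval, ha, hb, hq, and_assoc]

theorem leads_ne {i l : ℕ} (ha : σ.arr 1 = a) (hb : σ.arr 2 = b) :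
    (Tm.leads i l).eval L σ ≠ 0 ↔ σ.arr 5 (σ.var l) = 0 ∧ b (σ.var l) = b (σ.var i) ∧
      σ.arr 6 (σ.var 4) < σ.arr 6 (a (σ.var l)) := by
  rw [Tm.leads, Tm.eval_both_ne, Tm.canReplace, Tm.eval_both_ne, Tm.eval_neg_ne, Tm.eval_eq_ne,
    Tm.eval_lt_ne]
  simp only [Tm.eval, ha, hb, and_assoc]

theorem canStep_ne (hn : n ≤ L) (h0 : σ.var 0 = n) (ha : σ.arr 1 = a) (hb : σ.arr 2 = b) :
    Tm.canStep.eval L σ ≠ 0 ↔ σ.arr 5 (σ.var 15) ≠ 0 ∧ a (σ.var 15) = σ.var 4 ∧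
      ∃ l < n, σ.arr 5 l = 0 ∧ b l = b (σ.var 15) ∧ σ.arr 6 (σ.var 4) < σ.arr 6 (a l) := by
  rw [Tm.canStep, Tm.eval_both_ne, Tm.eval_both_ne, Tm.eval_eq_ne,
    Tm.eval_anyTo_ne (by omega) (by omega), h0]
  simp only [leads_ne (a := a) (b := b) (σ := σ.setVar 12 _) ha hb]
  simp [Tm.eval, ha, and_assoc]

theorem notMem_edges {f : ℕ → ℕ} {j : ℕ} (hj : j < n) : j ∉ edges n f ↔ f j = 0 := by
  rw [mem_edges]
  constructor
  · intro h
    by_contra h'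
    exact h ⟨hj, h'⟩
  · exact fun h h' => h'.2 h

theorem edges_insert {f : ℕ → ℕ} {j : ℕ} (hn : n ≤ L) (hj : j < n) :
    edges n (fun i => if i < L then (if i = j then 1 else f i) else f i) =
      insert j (edges n f) := by
  ext i
  rw [Finset.mem_insert, mem_edges, mem_edges]
  by_cases hij : i = j
  · subst hij
    simp [hj, hj.trans_le hn]
  · simp [hij]

theorem edges_exchange {f : ℕ → ℕ} {i j : ℕ} (hn : n ≤ L) (hj : j < n) (hi : i < n) :
    edges n (fun l => if l < L then (if l = j then 1 else if l = i then 0 else f l) else f l) =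
      insert j ((edges n f).erase i) := by
  ext l
  rw [Finset.mem_insert, Finset.mem_erase, mem_edges, mem_edges]
  by_cases hij : l = j
  · subst hij
    simp [hj, hj.trans_le hn]
  · by_cases hl : l = i
    · subst hl
      simp [hij, hi.trans_le hn]
    · simp [hij, hl]

theorem run_start (hn : n ≤ L) (h : Ready σ₀ n a b p q σ)
    (hex : ∃ j < n, σ.arr 5 j = 0 ∧ σ.arr 6 (a j) ≠ 0 ∧
      ((edges n (σ.arr 5)).filter fun i => b i = b j).card < q (b j)) :
    Ready σ₀ n a b p q (Stm.start.run L σ) ∧ (Stm.start.run L σ).arr 6 = σ.arr 6 ∧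
      ∃ j < n, (σ.arr 5 j = 0 ∧ σ.arr 6 (a j) ≠ 0 ∧
        ((edges n (σ.arr 5)).filter fun i => b i = b j).card < q (b j)) ∧
        (Stm.start.run L σ).var 4 = a j ∧
        edges n ((Stm.start.run L σ).arr 5) = insert j (edges n (σ.arr 5)) := by
  have hfind := Tm.eval_find (L := L) (σ := σ) (u := 14) (v := 15) (w := 0) (e := Tm.canStart)
    (Q := fun j => σ.arr 5 j = 0 ∧ σ.arr 6 (a j) ≠ 0 ∧
      ((edges n (σ.arr 5)).filter fun i => b i = b j).card < q (b j)) (by omega) (by omega)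
    (by omega) (by rw [h.var_n]; exact hn) (fun z i => by
      rw [canStart_ne (σ := (σ.setVar 14 z).setVar 15 i) (a := a) (b := b) (q := q) hn
        (by simp [h.var_n]) h.arr_a h.arr_b h.arr_q]
      simp) (by rw [h.var_n]; exact hex)
  rw [h.var_n] at hfind
  simp only [Stm.start, Stm.run]
  generalize (Tm.find 14 15 0 Tm.canStart).eval L σ = j at hfind
  obtain ⟨hj, hQ⟩ := hfind
  refine ⟨((h.setVar (by omega) _).setArr (by omega) _).setVar (by omega) _, by simp, j, hj, hQ,
    ?_, ?_⟩
  · simp [Tm.eval, h.arr_a]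
  · rw [← edges_insert hn hj]
    congr 1
    funext i
    simp [Tm.eval]

theorem run_exchange (hn : n ≤ L) (h : Ready σ₀ n a b p q σ)
    (hex : ∃ i < n, σ.arr 5 i ≠ 0 ∧ a i = σ.var 4 ∧ ∃ j < n, σ.arr 5 j = 0 ∧ b j = b i ∧
      σ.arr 6 (σ.var 4) < σ.arr 6 (a j)) :
    Ready σ₀ n a b p q (Stm.exchange.run L σ) ∧ (Stm.exchange.run L σ).arr 6 = σ.arr 6 ∧
      ∃ i < n, ∃ j < n, σ.arr 5 i ≠ 0 ∧ a i = σ.var 4 ∧ σ.arr 5 j = 0 ∧ b j = b i ∧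
        σ.arr 6 (σ.var 4) < σ.arr 6 (a j) ∧ (Stm.exchange.run L σ).var 4 = a j ∧
        edges n ((Stm.exchange.run L σ).arr 5) = insert j ((edges n (σ.arr 5)).erase i) := by
  have hfind := Tm.eval_find (L := L) (σ := σ) (u := 14) (v := 15) (w := 0) (e := Tm.canStep)
    (Q := fun i => σ.arr 5 i ≠ 0 ∧ a i = σ.var 4 ∧ ∃ j < n, σ.arr 5 j = 0 ∧ b j = b i ∧
      σ.arr 6 (σ.var 4) < σ.arr 6 (a j)) (by omega) (by omega)
    (by omega) (by rw [h.var_n]; exact hn) (fun z i => by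
      rw [canStep_ne (σ := (σ.setVar 14 z).setVar 15 i) (a := a) (b := b) hn
        (by simp [h.var_n]) h.arr_a h.arr_b]
      simp) (by rw [h.var_n]; exact hex)
  rw [h.var_n] at hfind
  simp only [Stm.exchange, Stm.run]
  generalize (Tm.find 14 15 0 Tm.canStep).eval L σ = i at hfind
  obtain ⟨hi, hi1, hi2, hj⟩ := hfind
  have h' := h.setVar (x := 5) (by omega) i
  have hfind := Tm.eval_find (L := L) (σ := σ.setVar 5 i) (u := 14) (v := 15) (w := 0)
    (e := Tm.leads 5 15)
    (Q := fun j => σ.arr 5 j = 0 ∧ b j = b i ∧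
      σ.arr 6 (σ.var 4) < σ.arr 6 (a j)) (by omega) (by omega)
    (by omega) (by rw [h'.var_n]; exact hn) (fun z i' => by
      rw [leads_ne (σ := ((σ.setVar 5 i).setVar 14 z).setVar 15 i') (a := a) (b := b) h.arr_a
        h.arr_b]
      simp) (by rw [h'.var_n]; exact hj)
  rw [h'.var_n] at hfind
  generalize (Tm.find 14 15 0 (Tm.leads 5 15)).eval L (σ.setVar 5 i) = j at hfind
  obtain ⟨hj, hj1, hj2, hj3⟩ := hfind
  refine ⟨((h'.setVar (by omega) _).setArr (by omega) _).setVar (by omega) _, by simp, i, hi, j,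
    hj, hi1, hi2, hj1, hj2, hj3, ?_, ?_⟩
  · simp [Tm.eval, h.arr_a]
  · rw [← edges_exchange hn hj hi]
    congr 1
    funext l
    simp [Tm.eval]

/-- The fixed number of rounds suffices: every exchange strictly increases the age of the current
node. -/
theorem run_walk (hn : n ≤ L) (ha : ∀ i < n, a i < L) (M₀ : Finset ℕ) (h : Ready σ₀ n a b p q σ)
    (hR : ∀ x < L, σ.arr 6 x = age n a b p M₀ L x) (hcur : σ.var 4 < L)
    (hw : Walk n L a b p q M₀ (edges n (σ.arr 5)) (σ.var 4)) :
    Ready σ₀ n a b p q (Stm.walk.run L σ) ∧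
      IsBMatching a b p q (edges n ((Stm.walk.run L σ).arr 5)) ∧
      (edges n ((Stm.walk.run L σ).arr 5)).card = M₀.card + 1 := by
  simp only [Stm.walk]
  rw [Stm.run]
  set G := (Stm.cond (.lt (.get 3 (.var 4)) (Tm.degTop (.var 4))) Stm.exchange).run L with hG
  -- After `t` rounds the surplus is gone or the age exceeds `t`; for `t = L` the latter also rules
  -- out a surplus.
  have key : ∀ t, Ready σ₀ n a b p q (G^[t] σ) ∧
      (∀ x < L, (G^[t] σ).arr 6 x = age n a b p M₀ L x) ∧ (G^[t] σ).var 4 < L ∧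
      Walk n L a b p q M₀ (edges n ((G^[t] σ).arr 5)) ((G^[t] σ).var 4) ∧
      (((edges n ((G^[t] σ).arr 5)).filter fun i => a i = (G^[t] σ).var 4).card ≤
        p ((G^[t] σ).var 4) ∨ t < age n a b p M₀ L ((G^[t] σ).var 4)) := by
    intro t
    induction t with
    | zero => exact ⟨h, hR, hcur, hw, Or.inr (pos_iff_ne_zero.2 hw.cur_age)⟩
    | succ t ih =>
      rw [Function.iterate_succ_apply']
      generalize G^[t] σ = τ at ih
      obtain ⟨h1, h2, h3, h4, h5⟩ := ih
      have hc : (Tm.lt (.get 3 (.var 4)) (Tm.degTop (.var 4))).eval L τ ≠ 0 ↔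
          p (τ.var 4) < ((edges n (τ.arr 5)).filter fun i => a i = τ.var 4).card := by
        rw [Tm.eval_lt_ne, h1.eval_degTop hn (X := τ.var 4) (fun i => by simp [Tm.eval])]
        simp [Tm.eval, h1.arr_p]
      by_cases hlt : p (τ.var 4) < ((edges n (τ.arr 5)).filter fun i => a i = τ.var 4).card
      · obtain ⟨i, hi, j, hj, hjM, e1, e2, e3⟩ := h4.exists_step hlt
        rw [mem_edges] at hi
        rw [notMem_edges hj] at hjM
        rw [← h2 _ h3, ← h2 _ (ha j hj)] at e3
        have hrun : G τ = Stm.exchange.run L τ := by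
          rw [hG, Stm.run, if_pos (hc.2 hlt)]
        obtain ⟨g1, g2, i, hi, j, hj, k1, k2, k3, k4, k5, k6, k7⟩ := run_exchange hn h1
          ⟨i, hi.1, hi.2, e1, j, hj, hjM, e2, e3⟩
        rw [hrun, k6, k7]
        rw [h2 _ h3, h2 _ (ha j hj)] at k5
        refine ⟨g1, fun x hx => by rw [g2, h2 x hx], ha j hj,
          h4.step (mem_edges.2 ⟨hi, k1⟩) hj ((notMem_edges hj).2 k3) k2 k4 k5, Or.inr ?_⟩
        have := h5.resolve_left (not_le.2 hlt)
        omega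
      · have hrun : G τ = τ := by
          rw [hG, Stm.run, if_neg fun h => hlt (hc.1 h)]
        rw [hrun]
        exact ⟨h1, h2, h3, h4, Or.inl (not_lt.1 hlt)⟩
  obtain ⟨h1, h2, h3, h4, h5⟩ := key L
  refine ⟨h1, h4.isBMatching ?_, h4.card⟩
  rcases h5 with h5 | h5
  · exact h5
  · exact h4.card_le_of_age h5

theorem run_augment (hn : n ≤ L) (ha : ∀ i < n, a i < L) (h : Ready σ₀ n a b p q σ)
    (hM : IsBMatching a b p q (edges n (σ.arr 5))) :
    Ready σ₀ n a b p q (Stm.augment.run L σ) ∧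
      IsBMatching a b p q (edges n ((Stm.augment.run L σ).arr 5)) ∧
      (edges n ((Stm.augment.run L σ).arr 5) = edges n (σ.arr 5) ∧
        Stuck n L a b p q (edges n (σ.arr 5)) ∨
        (edges n ((Stm.augment.run L σ).arr 5)).card = (edges n (σ.arr 5)).card + 1) := by
  obtain ⟨R, hR, hRx⟩ := run_search hn ha h
  simp only [Stm.augment, Stm.run, hR]
  have h1 := h.setArr (c := 6) (by omega) R
  have h5 : (σ.setArr 6 R).arr 5 = σ.arr 5 := by simp
  have h6 : (σ.setArr 6 R).arr 6 = R := by simp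
  have hc : (Tm.anyTo 15 0 Tm.canStart).eval L (σ.setArr 6 R) ≠ 0 ↔
      ∃ j < n, (σ.setArr 6 R).arr 5 j = 0 ∧ (σ.setArr 6 R).arr 6 (a j) ≠ 0 ∧
      ((edges n ((σ.setArr 6 R).arr 5)).filter fun i => b i = b j).card < q (b j) := by
    rw [Tm.eval_anyTo_ne (by omega) (by rw [h1.var_n]; exact hn), h1.var_n]
    refine exists_congr fun j => and_congr_right fun hj => ?_
    rw [canStart_ne (σ := (σ.setArr 6 R).setVar 15 j) (a := a) (b := b) (q := q) hn
      (by simp [h.var_n]) h1.arr_a h1.arr_b h1.arr_q]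
    simp
  by_cases hex : ∃ j < n, (σ.setArr 6 R).arr 5 j = 0 ∧ (σ.setArr 6 R).arr 6 (a j) ≠ 0 ∧
      ((edges n ((σ.setArr 6 R).arr 5)).filter fun i => b i = b j).card < q (b j)
  · rw [if_pos (hc.2 hex)]
    obtain ⟨g1, g2, j, hj, ⟨k1, k2, k3⟩, k4, k5⟩ := run_start hn h1 hex
    rw [h5] at k1 k3 k5
    rw [h6] at k2 g2
    rw [hRx _ (ha j hj)] at k2
    obtain ⟨w1, w2, w3⟩ := run_walk hn ha (edges n (σ.arr 5)) g1 (fun x hx => by rw [g2, hRx x hx])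
      (by rw [k4]; exact ha j hj) (by
        rw [k4, k5]
        exact Walk.start (edges_subset _ _) hM hj ((notMem_edges hj).2 k1) k2 k3)
    exact ⟨w1, w2, Or.inr w3⟩
  · rw [if_neg fun h => hex (hc.1 h), h5]
    refine ⟨h1, hM, Or.inl ⟨rfl, fun j hj hjM hage => ?_⟩⟩
    rw [h5, h6] at hex
    by_contra hlt
    rw [not_le] at hlt
    exact hex ⟨j, hj, (notMem_edges hj).1 hjM, by rwa [hRx _ (ha j hj)], hlt⟩

/-- The matching program computes a maximum matching. -/
theorem run_matching (hn : n ≤ L) (ha : ∀ i < n, a i < L) (h : Ready σ₀ n a b p q σ)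
    (h0 : ∀ i, σ.arr 5 i = 0) :
    Ready σ₀ n a b p q (Stm.matching.run L σ) ∧
      IsBMatching a b p q (edges n ((Stm.matching.run L σ).arr 5)) ∧
      ∀ M ⊆ Finset.range n, IsBMatching a b p q M →
        M.card ≤ (edges n ((Stm.matching.run L σ).arr 5)).card := by
  simp only [Stm.matching]
  rw [Stm.run]
  -- Each round finds the matching stuck, hence maximum, or enlarges it. After `L ≥ n` rounds
  -- without getting stuck it contains all edges.
  have key : ∀ t, Ready σ₀ n a b p q ((Stm.augment.run L)^[t] σ) ∧
      IsBMatching a b p q (edges n (((Stm.augment.run L)^[t] σ).arr 5)) ∧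
      (Stuck n L a b p q (edges n (((Stm.augment.run L)^[t] σ).arr 5)) ∨
        t ≤ (edges n (((Stm.augment.run L)^[t] σ).arr 5)).card) := by
    intro t
    induction t with
    | zero =>
      refine ⟨h, ?_, Or.inr (Nat.zero_le _)⟩
      have : edges n (σ.arr 5) = ∅ := by simp [edges, h0]
      simp only [Function.iterate_zero, id, this]
      exact ⟨by simp, by simp⟩
    | succ t ih =>
      rw [Function.iterate_succ_apply']
      generalize (Stm.augment.run L)^[t] σ = τ at ih
      obtain ⟨h1, h2, h3⟩ := ih
      obtain ⟨g1, g2, g3⟩ := run_augment hn ha h1 h2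
      refine ⟨g1, g2, ?_⟩
      rcases g3 with ⟨g3, g4⟩ | g3
      · rw [g3]; exact Or.inl g4
      · by_cases hs : Stuck n L a b p q (edges n ((Stm.augment.run L τ).arr 5))
        · exact Or.inl hs
        · right
          rcases h3 with h3 | h3
          · exfalso
            have := card_le_of_stuck ha (edges_subset _ _) h3 (edges_subset _ _) g2
            omega
          · omega
  obtain ⟨h1, h2, h3⟩ := key L
  refine ⟨h1, h2, fun M hM hM' => ?_⟩
  rcases h3 with h3 | h3
  · exact card_le_of_stuck ha (edges_subset _ _) h3 hM hM'
  · have := Finset.card_le_card hM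
    rw [Finset.card_range] at this
    omega

end Matching

/-! ### The program for the criterion -/

theorem getElem?_flatten_of_length_eq {α : Type} {m : ℕ} {ll : List (List α)}
    (h : ∀ l ∈ ll, l.length = m) (i j : ℕ) (hj : j < m) :
    ll.flatten[i * m + j]? = (ll[i]?).bind fun l => l[j]? := by
  induction ll generalizing i with
  | nil => simp
  | cons l ll ih =>
    have hl : l.length = m := h l (by simp)
    rw [List.flatten_cons]
    cases i with
    | zero => rw [List.getElem?_append_left (by omega)]; simp
    | succ i =>
      have e : (i + 1) * m + j = l.length + (i * m + j) := by rw [hl]; ring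
      rw [e, List.getElem?_append_right (by omega), Nat.add_sub_cancel_left,
        ih (fun l' hl' => h l' (by simp [hl']))]
      simp

theorem length_flatten_votes (I : Instance) :
    (List.ofFn fun i => (I.profile i).map fun c => (c : ℕ)).flatten.length = I.n * I.m := by
  rw [List.length_flatten, List.map_ofFn, List.sum_ofFn]
  simp [length_profile]

theorem length_encode (I : Instance) : (encode I).length = 3 + I.n * I.m + I.k := by
  simp only [encode, List.length_append, length_flatten_votes, List.length_replicate,
    List.length_cons, List.length_nil]

theorem getD_encode (I : Instance) (i : Fin I.n) {j : ℕ} (hj : j < I.m) :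
    (encode I).getD (3 + i * I.m + j) 0 = ((I.profile i)[j]?).getD I.xstar := by
  have hlt : i * I.m + j < I.n * I.m := by
    have : (i + 1) * I.m ≤ I.n * I.m := Nat.mul_le_mul_right _ i.2
    rw [Nat.succ_mul] at this
    omega
  rw [List.getD_eq_getElem?_getD, encode, List.append_assoc,
    List.getElem?_append_right (by simp; omega),
    List.getElem?_append_left (by rw [length_flatten_votes]; simp; omega)]
  rw [show 3 + i * I.m + j - [I.m, I.n, (I.xstar : ℕ)].length = i * I.m + j by simp; omega,
    getElem?_flatten_of_length_eq (m := I.m) (by simp [List.mem_ofFn, length_profile]) _ _ hj]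
  have hj' : j < (I.profile i).length := by rw [length_profile]; exact hj
  simp [hj', ← List.map_eq_flatMap]

theorem n_le_length (I : Instance) : I.n ≤ (encode I).length := by
  rw [length_encode]
  have : I.n * 1 ≤ I.n * I.m := Nat.mul_le_mul_left _ (Nat.succ_le_of_lt (I.xstar.pos))
  omega

theorem m_le_length (I : Instance) : I.m ≤ (encode I).length := by
  rw [length_encode]
  have : 1 * I.m ≤ I.n * I.m := Nat.mul_le_mul_right _ I.n_pos
  omega

namespace Tm

/-- The number of votes, in register `10`, with a certain property. -/
def count (e : Tm) : Tm := sumTo 10 0 e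

end Tm

namespace Stm

/-- The numbers of votes, of candidates and of new candidates, the distinguished candidate, and
the first two candidates of every vote. -/
def load : Stm :=
  .seq (.assign 0 (.get 0 (.const 1))) <|
  .seq (.assign 1 (.get 0 (.const 0))) <|
  .seq (.assign 2 (.get 0 (.const 2))) <|
  .seq (.assign 3 (.sub .len (.add (.const 3) (.sumTo 10 0 (.var 1))))) <|
  .seq (.fill 1 13 (.get 0 (.add (.const 3) (.sumTo 10 13 (.var 1))))) <|
  .fill 2 13 (.cond (.lt (.const 1) (.var 1))
    (.get 0 (.add (.const 4) (.sumTo 10 13 (.var 1)))) (.var 2))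

/-- The scores. -/
def scores : Stm :=
  .fill 7 13 (.add (.count (.eq (.get 1 (.var 10)) (.var 13)))
    (.count (.eq (.get 2 (.var 10)) (.var 13))))

/-- By how much the candidates beat the distinguished one. -/
def excesses : Stm := .fill 8 13 (.sub (.get 7 (.var 13)) (.get 7 (.var 2)))

/-- The numbers of high priority votes. -/
def highCounts : Stm :=
  .fill 9 13 (.count (.both (.neg (.eq (.get 1 (.var 10)) (.var 2)))
    (.eq (.get 2 (.var 10)) (.var 13))))

/-- Which candidates are late. -/
def lates : Stm :=
  .fill 10 13 (.both (.lt (.const 0) (.get 8 (.var 13)))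
    (.lt (.get 9 (.var 13)) (.add (.get 8 (.var 13)) (.const 1))))

/-- The capacities of the late candidates. -/
def capTops : Stm :=
  .fill 3 13 (.cond (.get 10 (.var 13))
    (.sub (.get 8 (.var 13)) (.add (.count (.eq (.get 2 (.var 10)) (.var 13)))
      (.count (.both (.get 10 (.get 2 (.var 10))) (.eq (.get 1 (.var 10)) (.var 13))))))
    (.const 0))

/-- The capacities of the early candidates. -/
def capSecs : Stm :=
  .fill 4 13 (.cond (.lt (.get 8 (.var 13)) (.get 9 (.var 13))) (.get 8 (.var 13)) (.const 0))

/-- The input of the matching program. -/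
def prepare : Stm :=
  .seq load <| .seq scores <| .seq excesses <| .seq highCounts <| .seq lates <| .seq capTops capSecs

end Stm

/-- The votes have been loaded. -/
structure Loaded (I : Instance) (σ : Mem) : Prop where
  var_n : σ.var 0 = I.n
  var_m : σ.var 1 = I.m
  var_xstar : σ.var 2 = I.xstar
  var_k : σ.var 3 = I.k
  arr_first : ∀ i : Fin I.n, σ.arr 1 i = first I i
  arr_second : ∀ i : Fin I.n, σ.arr 2 i = second I i
  arr_matching : ∀ i, σ.arr 5 i = 0

section Prepare

variable {I : Instance} {σ : Mem}

theorem Loaded.setArr (h : Loaded I σ) {c : ℕ} (h1 : 1 ≠ c) (h2 : 2 ≠ c) (h5 : 5 ≠ c)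
    (g : ℕ → ℕ) : Loaded I (σ.setArr c g) where
  var_n := h.var_n
  var_m := h.var_m
  var_xstar := h.var_xstar
  var_k := h.var_k
  arr_first := by simpa [h1] using h.arr_first
  arr_second := by simpa [h2] using h.arr_second
  arr_matching := by simpa [h5] using h.arr_matching

theorem eval_count {P : Fin I.n → Prop} [DecidablePred P] {e : Tm} (h0 : σ.var 0 = I.n)
    (h : ∀ i : Fin I.n, e.eval (encode I).length (σ.setVar 10 i) = if P i then 1 else 0) :
    (Tm.count e).eval (encode I).length σ = (Finset.univ.filter P).card := by
  rw [Tm.count, Tm.eval_sumTo _ (by omega) (by rw [h0]; exact n_le_length I), h0,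
    ← Fin.sum_univ_eq_sum_range, Finset.card_filter]
  exact Finset.sum_congr rfl fun i _ => h i

theorem eval_sum_candidates {f : Fin I.m → ℕ} {e : Tm} (h1 : σ.var 1 = I.m)
    (h : ∀ x : Fin I.m, e.eval (encode I).length (σ.setVar 10 x) = f x) :
    (Tm.sumTo 10 1 e).eval (encode I).length σ = ∑ x, f x := by
  rw [Tm.eval_sumTo _ (by omega) (by rw [h1]; exact m_le_length I), h1,
    ← Fin.sum_univ_eq_sum_range]
  exact Finset.sum_congr rfl fun i _ => h i

theorem Loaded.eval_count_first (h : Loaded I σ) (x : Fin I.m) (hx : σ.var 13 = x) :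
    (Tm.count (.eq (.get 1 (.var 10)) (.var 13))).eval (encode I).length σ =
      (Finset.univ.filter fun i => first I i = x).card :=
  eval_count h.var_n fun i => by simp [Tm.eval, h.arr_first, hx, Fin.ext_iff]

theorem Loaded.eval_count_second (h : Loaded I σ) (x : Fin I.m) (hx : σ.var 13 = x) :
    (Tm.count (.eq (.get 2 (.var 10)) (.var 13))).eval (encode I).length σ =
      (Finset.univ.filter fun i => second I i = x).card :=
  eval_count h.var_n fun i => by simp [Tm.eval, h.arr_second, hx, Fin.ext_iff]

theorem Loaded.setVar (h : Loaded I σ) {x : ℕ} (hx : 4 ≤ x) (v : ℕ) : Loaded I (σ.setVar x v) where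
  var_n := by rw [Mem.setVar_var, if_neg (by omega), h.var_n]
  var_m := by rw [Mem.setVar_var, if_neg (by omega), h.var_m]
  var_xstar := by rw [Mem.setVar_var, if_neg (by omega), h.var_xstar]
  var_k := by rw [Mem.setVar_var, if_neg (by omega), h.var_k]
  arr_first := h.arr_first
  arr_second := h.arr_second
  arr_matching := h.arr_matching

/-- There is no multiplication, so the offset of a vote is a sum of copies of `m`. As `k` is in
unary, it is what remains of the length after the header and the votes. The second candidate
defaults to x* when `m = 1`, as in `second`. -/
theorem run_load (I : Instance) :
    Loaded I (Stm.load.run (encode I).length (startMem (encode I))) := by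
  have hlen := length_encode I
  have hmul : ∀ (τ : Mem) (w x : ℕ), x ≤ (encode I).length → τ.var 1 = I.m → τ.var w = x →
      10 ≠ w → (Tm.sumTo 10 w (.var 1)).eval (encode I).length τ = x * I.m := by
    intro τ w x hx h1 hw hw'
    rw [Tm.eval_sumTo _ hw'.symm (by rw [hw]; exact hx), hw]
    simp [Tm.eval, h1]
  have hlt : ∀ i : Fin I.n, (i : ℕ) < (encode I).length := fun i => i.2.trans_le (n_le_length I)
  have g0 : (encode I)[0]?.getD 0 = I.m := rfl
  have g1 : (encode I)[1]?.getD 0 = I.n := rfl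
  have g2 : (encode I)[2]?.getD 0 = (I.xstar : ℕ) := rfl
  simp only [Stm.load, Stm.run, Tm.eval]
  refine ⟨by simp [startMem, g1], by simp [startMem, g0], by simp [startMem, g2], ?_, ?_, ?_, ?_⟩
  · simp only [Mem.setVar_var, Mem.setArr_var]
    simp only [if_true]
    rw [hmul _ 0 I.n (n_le_length I) (by simp [startMem, g0]) (by simp [startMem, g1]) (by omega)]
    omega
  · intro i
    simp only [Mem.setVar_arr, Mem.setArr_arr, if_true]
    rw [if_neg (by omega), hmul _ 13 i (hlt i).le (by simp [startMem, g0]) (by simp) (by omega)]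
    have := getD_encode I i I.xstar.pos
    simpa [startMem, first, hlt i] using this
  · intro i
    simp only [Mem.setVar_arr, Mem.setArr_arr, if_true, if_pos (hlt i)]
    rw [hmul _ 13 i (hlt i).le (by simp [startMem, g0]) (by simp) (by omega)]
    by_cases hm : 1 < I.m
    · have := getD_encode I i hm
      rw [show 3 + i * I.m + 1 = 4 + i * I.m by omega] at this
      simpa [startMem, g0, hm, second] using this
    · have hnone : (I.profile i)[1]? = none := by
        rw [List.getElem?_eq_none_iff, length_profile]; omega
      simp [startMem, g0, g2, hm, second, hnone]
  · intro i
    simp [startMem]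

/-- The input of the matching program is as it should be. -/
structure Prepared (I : Instance) (σ : Mem) : Prop extends Loaded I σ where
  arr_score : ∀ x : Fin I.m, σ.arr 7 x = topScore (first I) (second I) x
  arr_excess : ∀ x : Fin I.m, σ.arr 8 x = excess (first I) (second I) I.xstar x
  arr_capTop : ∀ x : Fin I.m, σ.arr 3 x = capTop (first I) (second I) I.xstar x
  arr_capSec : ∀ x : Fin I.m, σ.arr 4 x = capSec (first I) (second I) I.xstar x

theorem run_prepare (I : Instance) :
    Prepared I (Stm.prepare.run (encode I).length (startMem (encode I))) := by
  have hlt : ∀ x : Fin I.m, (x : ℕ) < (encode I).length := fun x => x.2.trans_le (m_le_length I)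
  have h := run_load I
  simp only [Stm.prepare]
  rw [Stm.run]
  generalize Stm.load.run (encode I).length (startMem (encode I)) = σ at h
  rw [Stm.run]
  have score : ∀ x : Fin I.m, (Stm.scores.run (encode I).length σ).arr 7 x =
      topScore (first I) (second I) x := by
    intro x
    simp only [Stm.scores, Stm.run, Tm.eval, Mem.setArr_arr, if_true, if_pos (hlt x)]
    rw [(h.setVar (by omega) _).eval_count_first x (by simp),
      (h.setVar (by omega) _).eval_count_second x (by simp), topScore]
  replace h : Loaded I (Stm.scores.run (encode I).length σ) :=
    h.setArr (by omega) (by omega) (by omega) _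
  generalize Stm.scores.run (encode I).length σ = σ at h score
  rw [Stm.run]
  have exc : ∀ x : Fin I.m, (Stm.excesses.run (encode I).length σ).arr 8 x =
      excess (first I) (second I) I.xstar x := by
    intro x
    simp only [Stm.excesses, Stm.run, Tm.eval, Mem.setArr_arr, if_true, if_pos (hlt x)]
    simp [h.var_xstar, score, excess]
  replace h : Loaded I (Stm.excesses.run (encode I).length σ) :=
    h.setArr (by omega) (by omega) (by omega) _
  replace score : ∀ x : Fin I.m, (Stm.excesses.run (encode I).length σ).arr 7 x =
      topScore (first I) (second I) x := by simpa [Stm.excesses, Stm.run] using score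
  generalize Stm.excesses.run (encode I).length σ = σ at h score exc
  rw [Stm.run]
  have high : ∀ x : Fin I.m, (Stm.highCounts.run (encode I).length σ).arr 9 x =
      highCount (first I) (second I) I.xstar x := by
    intro x
    simp only [Stm.highCounts, Stm.run, Mem.setArr_arr, if_true, if_pos (hlt x)]
    refine eval_count (by simp [h.var_n]) fun i => ?_
    simp only [Tm.both, Tm.neg, Tm.eval]
    simp only [Mem.setVar_var, Mem.setVar_arr, if_true, h.arr_first, h.arr_second]
    simp only [show (2 : ℕ) ≠ 10 by omega, show (2 : ℕ) ≠ 13 by omega, show (13 : ℕ) ≠ 10 by omega,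
      if_false, h.var_xstar, ← Fin.ext_iff]
    by_cases h1 : first I i = I.xstar <;> by_cases h2 : second I i = x <;> simp [h1, h2]
  replace h : Loaded I (Stm.highCounts.run (encode I).length σ) :=
    h.setArr (by omega) (by omega) (by omega) _
  replace score : ∀ x : Fin I.m, (Stm.highCounts.run (encode I).length σ).arr 7 x =
      topScore (first I) (second I) x := by simpa [Stm.highCounts, Stm.run] using score
  replace exc : ∀ x : Fin I.m, (Stm.highCounts.run (encode I).length σ).arr 8 x =
      excess (first I) (second I) I.xstar x := by simpa [Stm.highCounts, Stm.run] using exc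
  generalize Stm.highCounts.run (encode I).length σ = σ at h score exc high
  rw [Stm.run]
  have late : ∀ x : Fin I.m, (Stm.lates.run (encode I).length σ).arr 10 x ≠ 0 ↔
      Late (first I) (second I) I.xstar x := by
    intro x
    simp only [Stm.lates, Stm.run, Mem.setArr_arr, if_true, if_pos (hlt x)]
    rw [Tm.eval_both_ne, Tm.eval_lt_ne, Tm.eval_lt_ne]
    simp [Tm.eval, exc, high, Late]
  replace h : Loaded I (Stm.lates.run (encode I).length σ) :=
    h.setArr (by omega) (by omega) (by omega) _
  replace score : ∀ x : Fin I.m, (Stm.lates.run (encode I).length σ).arr 7 x =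
      topScore (first I) (second I) x := by simpa [Stm.lates, Stm.run] using score
  replace exc : ∀ x : Fin I.m, (Stm.lates.run (encode I).length σ).arr 8 x =
      excess (first I) (second I) I.xstar x := by simpa [Stm.lates, Stm.run] using exc
  replace high : ∀ x : Fin I.m, (Stm.lates.run (encode I).length σ).arr 9 x =
      highCount (first I) (second I) I.xstar x := by simpa [Stm.lates, Stm.run] using high
  generalize Stm.lates.run (encode I).length σ = σ at h score exc high late
  rw [Stm.run]
  have hTop : ∀ x : Fin I.m, (Stm.capTops.run (encode I).length σ).arr 3 x =
      capTop (first I) (second I) I.xstar x := by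
    intro x
    simp only [Stm.capTops, Stm.run, Tm.eval, Mem.setArr_arr, if_true, if_pos (hlt x)]
    rw [(h.setVar (by omega) _).eval_count_second x (by simp),
      eval_count (P := fun i => first I i = x ∧ Late (first I) (second I) I.xstar (second I i))
        (by simp [h.var_n])]
    · simp only [Mem.setVar_var, Mem.setVar_arr, if_true, capTop, late, exc]
    · intro i
      simp only [Tm.both, Tm.eval]
      simp only [Mem.setVar_var, Mem.setVar_arr, if_true, h.arr_first, h.arr_second, late]
      simp only [show (13 : ℕ) ≠ 10 by omega, if_false, ← Fin.ext_iff]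
      by_cases h1 : first I i = x <;>
        by_cases h2 : Late (first I) (second I) I.xstar (second I i) <;> simp [h1, h2]
  replace h : Loaded I (Stm.capTops.run (encode I).length σ) :=
    h.setArr (by omega) (by omega) (by omega) _
  replace score : ∀ x : Fin I.m, (Stm.capTops.run (encode I).length σ).arr 7 x =
      topScore (first I) (second I) x := by simpa [Stm.capTops, Stm.run] using score
  replace exc : ∀ x : Fin I.m, (Stm.capTops.run (encode I).length σ).arr 8 x =
      excess (first I) (second I) I.xstar x := by simpa [Stm.capTops, Stm.run] using exc
  replace high : ∀ x : Fin I.m, (Stm.capTops.run (encode I).length σ).arr 9 x =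
      highCount (first I) (second I) I.xstar x := by simpa [Stm.capTops, Stm.run] using high
  generalize Stm.capTops.run (encode I).length σ = σ at h score exc high hTop
  have hSec : ∀ x : Fin I.m, (Stm.capSecs.run (encode I).length σ).arr 4 x =
      capSec (first I) (second I) I.xstar x := by
    intro x
    simp only [Stm.capSecs, Stm.run, Tm.eval, Mem.setArr_arr, if_true, if_pos (hlt x)]
    simp only [Mem.setVar_var, Mem.setVar_arr, if_true, exc, high, capSec, Early]
    -- The program omits the test for positive excess: a zero excess yields capacity zero in either
    -- branch.
    by_cases h1 : excess (first I) (second I) I.xstar x <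
        highCount (first I) (second I) I.xstar x
    · by_cases h2 : 0 < excess (first I) (second I) I.xstar x
      · simp [h1, h2]
      · simp [Nat.eq_zero_of_not_pos h2]
    · simp [h1]
  exact {
    toLoaded := h.setArr (by omega) (by omega) (by omega) _
    arr_score := by simpa [Stm.capSecs, Stm.run] using score
    arr_excess := by simpa [Stm.capSecs, Stm.run] using exc
    arr_capTop := by simpa [Stm.capSecs, Stm.run] using hTop
    arr_capSec := hSec }

end Prepare

/-! ### Evaluating the criterion by a program -/

/-- Nodes that are not candidates have no edges, so the arbitrary array values there impose no
constraint. -/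
theorem isBMatching_map {n m : ℕ} {a b : Fin n → Fin m} {p' q' : Fin m → ℕ} {A B p q : ℕ → ℕ}
    (hA : ∀ i : Fin n, A i = a i) (hB : ∀ i : Fin n, B i = b i) (hp : ∀ x : Fin m, p x = p' x)
    (hq : ∀ x : Fin m, q x = q' x) (M : Finset (Fin n)) :
    IsBMatching A B p q (M.map Fin.valEmbedding) ↔ IsBMatching a b p' q' M := by
  have key : ∀ {A : ℕ → ℕ} {a : Fin n → Fin m} {p : ℕ → ℕ} {p' : Fin m → ℕ},
      (∀ i : Fin n, A i = a i) → (∀ x : Fin m, p x = p' x) →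
      ((∀ x, ((M.map Fin.valEmbedding).filter fun i => A i = x).card ≤ p x) ↔
        ∀ x, (M.filter fun i => a i = x).card ≤ p' x) := by
    intro A a p p' hA hp
    have e : ∀ x, ((M.map Fin.valEmbedding).filter fun i => A i = x).card =
        (M.filter fun i => (a i : ℕ) = x).card := by
      intro x
      rw [Finset.filter_map, Finset.card_map]
      simp [hA]
    simp only [e]
    constructor
    · intro h x
      simpa [← Fin.ext_iff, hp] using h x
    · intro h x
      by_cases hx : x < m
      · have := h ⟨x, hx⟩
        rw [← hp] at this
        simpa [Fin.ext_iff] using this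
      · have : (M.filter fun i => (a i : ℕ) = x) = ∅ :=
          Finset.filter_false_of_mem fun i _ hi => hx (hi.symm.trans_lt (a i).2)
        simp [this]
  exact and_congr (key hA hp) (key hB hq)

namespace Tm

/-- The test of the criterion. -/
def crit : Tm :=
  lt (add (sumTo 10 1 (get 8 (var 10))) (sumTo 10 1 (get 3 (var 10))))
    (add (add (count (neg (neg (get 5 (var 10))))) (sumTo 10 3 (get 7 (var 2)))) (const 1))

/-- The test of the criterion if there is one new candidate. -/
def critOne : Tm :=
  both (neg (anyTo 13 1 (lt (count (eq (get 2 (var 10)) (var 13))) (get 8 (var 13)))))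
    (lt (sumTo 10 1 (get 8 (var 10))) (add (get 7 (var 2)) (const 1)))

end Tm

theorem k_le_length (I : Instance) : I.k ≤ (encode I).length := by
  rw [length_encode]; omega

/-- The criterion asks for some matching of sufficient size, so testing a maximum one is enough. The
product `k * s` is again formed as a sum, over `k` values. -/
theorem Prepared.crit_ne {I : Instance} {σ : Mem} (h : Prepared I σ) :
    Tm.crit.eval (encode I).length (Stm.matching.run (encode I).length σ) ≠ 0 ↔
      Crit (first I) (second I) I.xstar I.k := by
  obtain ⟨h1, h2, h3⟩ := run_matching (L := (encode I).length) (σ := σ) (σ₀ := σ) (n := I.n)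
    (a := σ.arr 1) (b := σ.arr 2) (p := σ.arr 3) (q := σ.arr 4) (n_le_length I)
    (fun i hi => by
      have := h.arr_first ⟨i, hi⟩
      simp only at this
      rw [this]
      exact (Fin.is_lt _).trans_le (m_le_length I))
    ⟨fun _ _ _ _ => rfl, fun _ _ _ => rfl, h.var_n, rfl, rfl, rfl, rfl⟩ h.arr_matching
  generalize Stm.matching.run (encode I).length σ = τ at h1 h2 h3
  have v1 : τ.var 1 = I.m := by rw [h1.var 1 (by omega) (by omega) (by omega), h.var_m]
  have v2 : τ.var 2 = I.xstar := by rw [h1.var 2 (by omega) (by omega) (by omega), h.var_xstar]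
  have v3 : τ.var 3 = I.k := by rw [h1.var 3 (by omega) (by omega) (by omega), h.var_k]
  have a7 : τ.arr 7 = σ.arr 7 := h1.arr 7 (by omega) (by omega)
  have a8 : τ.arr 8 = σ.arr 8 := h1.arr 8 (by omega) (by omega)
  have hcard : (Tm.count (.neg (.neg (.get 5 (.var 10))))).eval (encode I).length τ =
      (Finset.univ.filter fun i : Fin I.n => τ.arr 5 i ≠ 0).card :=
    eval_count h1.var_n fun i => by simp [Tm.neg, Tm.eval]
  have hedges : edges I.n (τ.arr 5) =
      (Finset.univ.filter fun i : Fin I.n => τ.arr 5 i ≠ 0).map Fin.valEmbedding := by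
    ext i
    rw [mem_edges]
    simp only [Finset.mem_map, Finset.mem_filter, Finset.mem_univ, true_and,
      Fin.valEmbedding_apply]
    constructor
    · exact fun hi => ⟨⟨i, hi.1⟩, hi.2, rfl⟩
    · rintro ⟨j, hj, rfl⟩
      exact ⟨j.2, hj⟩
  rw [hedges] at h2 h3
  rw [Tm.crit, Tm.eval_lt_ne]
  simp only [Tm.eval]
  rw [eval_sum_candidates (f := excess (first I) (second I) I.xstar) v1 (fun x => by
      simp [Tm.eval, a8, h.arr_excess]),
    eval_sum_candidates (f := capTop (first I) (second I) I.xstar) v1 (fun x => by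
      simp [Tm.eval, h1.arr_p, h.arr_capTop]), hcard,
    Tm.eval_sumTo _ (by omega) (by rw [v3]; exact k_le_length I), v3, Nat.lt_succ_iff]
  simp only [Tm.eval, Mem.setVar_arr, Mem.setVar_var, show (2 : ℕ) ≠ 10 by omega, if_false, v2,
    a7, h.arr_score, Finset.sum_const, Finset.card_range, smul_eq_mul]
  rw [isBMatching_map h.arr_first h.arr_second h.arr_capTop h.arr_capSec] at h2
  constructor
  · exact fun H => ⟨_, h2, H⟩
  · rintro ⟨M, hM, H⟩
    have := h3 (M.map Fin.valEmbedding) (fun i hi => by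
      obtain ⟨j, -, rfl⟩ := Finset.mem_map.1 hi
      simp)
      ((isBMatching_map h.arr_first h.arr_second h.arr_capTop h.arr_capSec M).2 hM)
    rw [Finset.card_map, Finset.card_map] at this
    omega

theorem Prepared.critOne_ne {I : Instance} {σ : Mem} (h : Prepared I σ) :
    Tm.critOne.eval (encode I).length σ ≠ 0 ↔ CritOne (first I) (second I) I.xstar := by
  rw [Tm.critOne, Tm.eval_both_ne, Tm.eval_neg_ne, Tm.eval_lt_ne, CritOne]
  refine and_congr ?_ ?_
  · rw [← not_iff_not, ← ne_eq, Tm.eval_anyTo_ne (by omega) (by rw [h.var_m]; exact m_le_length I),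
      h.var_m]
    push Not
    constructor
    · rintro ⟨x, hx, H⟩
      rw [Tm.eval_lt_ne, (h.toLoaded.setVar (by omega) _).eval_count_second ⟨x, hx⟩ (by simp)] at H
      refine ⟨⟨x, hx⟩, ?_⟩
      rw [← h.arr_excess]
      simpa [Tm.eval] using H
    · rintro ⟨x, H⟩
      refine ⟨x, x.2, ?_⟩
      rw [Tm.eval_lt_ne, (h.toLoaded.setVar (by omega) _).eval_count_second x (by simp)]
      simpa [Tm.eval, h.arr_excess] using H
  · rw [eval_sum_candidates (f := excess (first I) (second I) I.xstar) h.var_m (fun x => by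
      simp [Tm.eval, h.arr_excess])]
    simp [Tm.eval, h.var_xstar, h.arr_score]

/-- Computability concerns only the Boolean answer, so the program evaluates the criterion and does
not imitate the algorithm. The double negation turns nonzero values into 1. -/
theorem polyTimeComputable_of_crit {f : Instance → Bool}
    (hf : ∀ I, f I = true ↔ Crit (first I) (second I) I.xstar I.k) :
    PolyTimeComputable encode f := by
  refine polyTimeComputable_of_stm
    (.seq Stm.prepare (.seq Stm.matching (.assign 7 (.neg (.neg Tm.crit))))) 7 fun I => ?_
  have h := (run_prepare I).crit_ne
  rw [← hf] at h
  simp only [Stm.run, Mem.setVar_var, if_true, Tm.neg, Tm.eval]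
  by_cases hI : f I = true
  · simp [hI, h.2 hI]
  · simp [hI, not_not.1 (fun h' => hI (h.1 h'))]

/-- The answer for one new candidate is computed first and overwritten when `k ≠ 1`; the matching
program leaves the prepared data intact. -/
theorem polyTimeComputable_of_crit_of_critOne {f : Instance → Bool}
    (hf : ∀ I, f I = true ↔ if I.k = 1 then CritOne (first I) (second I) I.xstar
      else Crit (first I) (second I) I.xstar I.k) :
    PolyTimeComputable encode f := by
  refine polyTimeComputable_of_stm
    (.seq Stm.prepare (.seq (.assign 7 (.neg (.neg Tm.critOne)))
      (.cond (.neg (.eq (.var 3) (.const 1)))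
        (.seq Stm.matching (.assign 7 (.neg (.neg Tm.crit))))))) 7 fun I => ?_
  have hprep := run_prepare I
  rw [Stm.run]
  generalize Stm.prepare.run (encode I).length (startMem (encode I)) = σ at hprep
  have h1 := hprep.critOne_ne
  have hprep' : Prepared I (σ.setVar 7 ((Tm.neg (.neg Tm.critOne)).eval (encode I).length σ)) :=
    { toLoaded := hprep.toLoaded.setVar (by omega) _
      arr_score := hprep.arr_score
      arr_excess := hprep.arr_excess
      arr_capTop := hprep.arr_capTop
      arr_capSec := hprep.arr_capSec }
  have h2 := hprep'.crit_ne
  have hk := hprep'.var_k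
  rw [Stm.run, Stm.run, Stm.run]
  have hI := hf I
  by_cases h : I.k = 1
  · rw [if_pos h, ← h1] at hI
    rw [if_neg (by rw [Tm.eval_neg_ne]; simpa [Tm.eval, h] using hprep.var_k)]
    simp only [Mem.setVar_var, if_true, Tm.neg, Tm.eval]
    by_cases hI' : f I = true
    · simp [hI', hI.1 hI']
    · simp [hI', not_not.1 (fun h' => hI' (hI.2 h'))]
  · rw [if_neg h, ← h2] at hI
    rw [if_pos (by rw [Tm.eval_neg_ne]; simpa [Tm.eval, hprep.var_k] using h)]
    simp only [Stm.run, Mem.setVar_var, if_true]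
    generalize Stm.matching.run (encode I).length _ = τ at hI
    simp only [Tm.neg, Tm.eval]
    by_cases hI' : f I = true
    · simp [hI', hI.1 hI']
    · simp [hI', not_not.1 (fun h' => hI' (hI.2 h'))]

theorem inP_possibleCowinner : InP encode (PossibleCowinner 2) := by
  classical
  refine ⟨fun I => decide (if I.k = 1 then CritOne (first I) (second I) I.xstar
      else Crit (first I) (second I) I.xstar I.k),
    polyTimeComputable_of_crit_of_critOne fun I => decide_eq_true_iff, fun I => ?_⟩
  rw [decide_eq_true_iff]
  split_ifs with h
  · exact (possibleCowinner_iff_critOne I h).symm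
  · have := I.k_pos
    exact (possibleCowinner_iff_crit I (by omega)).symm

end PCW

end

theorem mainTheorem2 :
    (∀ I : PCW.Instance, 2 ≤ I.k →
      (PCW.checkCowinner I = true ↔ PCW.PossibleCowinner 2 I)) ∧
    PCW.PolyTimeComputable PCW.encode PCW.checkCowinner ∧
    PCW.InP PCW.encode (PCW.PossibleCowinner 2) :=
  ⟨fun I hk => (PCW.checkCowinner_iff_crit I).trans (PCW.possibleCowinner_iff_crit I hk).symm,
    PCW.polyTimeComputable_of_crit PCW.checkCowinner_iff_crit, PCW.inP_possibleCowinner⟩
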